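/- **Setting.** Let $\mathbb K$ be an algebraically closed field of characteristic $\neq 2$; for every $a\in\mathbb K$ fix a square root $\sqrt a$. Let $n\ge 1$, $m\ge 0$, $q\in\mathbb K^*$ with $q^2\neq\pm1$, $\epsilon=q-q^{-1}$, $\underline Q=(Q_1,\dots,Q_m)\in(\mathbb K^*)^m$, $\bullet\in\{\mathsf 0,\mathsf s,\mathsf{ss}\}$, and for $\iota\in\mathbb K^*$ put $$\mathtt q(\iota)=2\,\frac{q\iota+(q\iota)^{-1}}{q+q^{-1}},\qquad \mathtt b_\pm(\iota)=\frac{\mathtt q(\iota)}2\pm\sqrt{\frac{\mathtt q(\iota)^2}4-1}.$$ The affine Hecke–Clifford superalgebra has even generators $T_1,\dots,T_{n-1},X_1^{\pm1},\dots,X_n^{\pm1}$, odd generators $C_1,\dots,C_n$ and relations: $T_i^2=\epsilon T_i+1$; $T_iT_j=T_jT_i$ for $|i-j|>1$; $T_iT_{i+1}T_i=T_{i+1}T_iT_{i+1}$; $X_iX_j=X_jX_i$; $X_iX_i^{-1}=X_i^{-1}X_i=1$; $C_i^2=1$; $C_iC_j=-C_jC_i$ for $i\ne j$; $T_iX_i=X_{i+1}T_i-\epsilon(X_{i+1}+C_iC_{i+1}X_i)$;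 $T_iX_{i+1}=X_iT_i+\epsilon(1-C_iC_{i+1})X_{i+1}$; $T_iX_j=X_jT_i$ and $T_iC_j=C_jT_i$ for $j\ne i,i+1$; $T_iC_i=C_{i+1}T_i$; $T_iC_{i+1}=C_iT_i-\epsilon(C_i-C_{i+1})$; $X_iC_i=C_iX_i^{-1}$; $X_iC_j=C_jX_i$ for $i\neq j$. Let $\mathcal H$ be its quotient by the two-sided ideal generated by $f(X_1)=g\cdot\prod_{l=1}^m(X_1+X_1^{-1}-\mathtt q(Q_l))$, where $g=1$, $X_1-1$, $(X_1-1)(X_1+1)$ for $\bullet=\mathsf 0,\mathsf s,\mathsf{ss}$. Let $\mathscr P_n^{\bullet,m}$ be the set of multipartitions of $n$ with $m$ ordinary components $1,\dots,m$, preceded by no strict partition ($\mathsf 0$), one strict partition in component $0$ ($\mathsf s$), or two in components $0_-,0_+$ ($\mathsf{ss}$); strict partitions are drawn as shifted diagrams. Put $Q_0=Q_{0_+}=1$, $Q_{0_-}=-1$. The box in row $i$, column $j$ of component $l$ has residue $Q_lq^{2(j-i)}$; $\operatorname{res}_{\mathfrak t}(k)$ is the residue of the box of the standard tableau $\mathfrak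 t$ that contains $k$. Assume the separate condition $P_n^{(\bullet)}(q^2,\underline Q)\ne0$, i.e. $\mathtt q(\operatorname{res}_{\mathfrak t}(k))\ne\mathtt q(\operatorname{res}_{\mathfrak t}(k+1))$ for all $\underline\mu\in\mathscr P_{n+1}^{\bullet,m}$, all standard tableaux $\mathfrak t$ of shape $\underline\mu$ and all $1\le k\le n$. **The module.** Fix $\underline\lambda\in\mathscr P_n^{\bullet,m}$. Let $\mathfrak t^{\underline\lambda}$ be the standard tableau filled row by row, starting with the first component; for $\mathfrak t\in\mathrm{Std}(\underline\lambda)$ let $d_{\mathfrak t}\in\mathfrak S_n$ be defined by $\mathfrak t=d_{\mathfrak t}\mathfrak t^{\underline\lambda}$. Let $i_1<\dots<i_t$ be the entries of $\mathfrak t^{\underline\lambda}$ in the diagonal boxes of the strict components, $\mathcal D_{\mathfrak t}=d_{\mathfrak t}\{i_1,\dots,i_t\}$, $\mathcal{OD}_{\mathfrak t}=d_{\mathfrak t}\{i_1,i_3,i_5,\dots\}$ and $$\gamma_{\mathfrak t}=2^{-\lfloor t/2\rfloor}\prod_{k=1}^{\lfloor t/2\rfloor}\bigl(1+\sqrt{-1}\,C_{d_{\mathfrak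 t}(i_{2k-1})}C_{d_{\mathfrak t}(i_{2k})}\bigr).$$ For $S\subseteq[n]$ let $\mathbb Z_2(S)$ be the set of $\beta\in\mathbb Z_2^n$ supported in $S$; $C^\beta=C_1^{\beta_1}\cdots C_n^{\beta_n}$; $e_i$ is the $i$-th standard vector; $|\beta|_{<i}=\sum_{k<i}\beta_k$ (similarly $\le,>,\ge$), $|\beta|=\sum_k\beta_k$; $\nu_\beta(i)=(-1)^{\beta_i}$. With $\iota_a=\operatorname{res}_{\mathfrak t^{\underline\lambda}}(a)$ let $\mathbb L(\iota_a)=\mathbb Kv_a\oplus\mathbb Kv_a'$ ($v_a$ even, $v_a'$ odd) with $X_a^{\pm1}v_a=\mathtt b_\pm(\iota_a)v_a$, $X_a^{\pm1}v_a'=\mathtt b_\mp(\iota_a)v_a'$, $C_av_a=v_a'$, $C_av'_a=v_a$; let $\mathbb L$ be the submodule, for the algebra $\mathcal A_n$ generated by the $X_a^{\pm1},C_a$, of the super tensor product $\mathbb L(\iota_1)\otimes\dots\otimes\mathbb L(\iota_n)$ generated by $v=\gamma_{\mathfrak t^{\underline\lambda}}(v_1\otimes\dots\otimes v_n)$. Let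 $\mathbb L^{\tau}=\{z^\tau\mid z\in\mathbb L\}$ be its twist by $\tau\in\mathfrak S_n$: $X_{\tau(a)}^{\pm1}z^\tau=(X_a^{\pm1}z)^\tau$, $C_{\tau(a)}z^\tau=(C_az)^\tau$. Put $\mathbb D(\underline\lambda)=\bigoplus_{\mathfrak t\in\mathrm{Std}(\underline\lambda)}\mathbb L^{d_{\mathfrak t}}$, $v_{\mathfrak t}=v^{d_{\mathfrak t}}$, and let $$T_iz^{d_{\mathfrak t}}=\Bigl(-\tfrac{\epsilon}{X_iX_{i+1}^{-1}-1}+\tfrac{\epsilon}{X_iX_{i+1}-1}C_iC_{i+1}\Bigr)z^{d_{\mathfrak t}}+\delta(s_i\mathfrak t)\sqrt{1-\epsilon^2\Bigl(\tfrac{X_iX_{i+1}^{-1}}{(X_iX_{i+1}^{-1}-1)^2}+\tfrac{X_i^{-1}X_{i+1}^{-1}}{(X_i^{-1}X_{i+1}^{-1}-1)^2}\Bigr)}\;z^{s_id_{\mathfrak t}},$$ where $\delta(s_i\mathfrak t)=1$ if $s_i\mathfrak t$ is standard and $0$ otherwise, and functions of the diagonalizable operators $X_i,X_{i+1}$ are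 applied to their eigenvalues. **Theorem.** These formulas make $\mathbb D(\underline\lambda)$ a simple $\mathcal H$-supermodule. It has the $\mathbb K$-basis $$\bigsqcup_{\mathfrak t\in\mathrm{Std}(\underline\lambda)}\{C^{\beta}C^{\alpha}v_{\mathfrak t}\mid\beta\in\mathbb Z_2([n]\setminus\mathcal D_{\mathfrak t}),\ \alpha\in\mathbb Z_2(\mathcal{OD}_{\mathfrak t})\},$$ the part indexed by $\mathfrak t$ being a basis of $\mathbb L^{d_{\mathfrak t}}$. Put $\mathtt b_{\mathfrak t,i}=\mathtt b_-(\operatorname{res}_{\mathfrak t}(i))$ and $$\mathtt c_{\mathfrak t}(i)=1-\epsilon^2\Bigl(\tfrac{\mathtt b_{\mathfrak t,i}^{-1}\mathtt b_{\mathfrak t,i+1}}{(\mathtt b_{\mathfrak t,i}^{-1}\mathtt b_{\mathfrak t,i+1}-1)^2}+\tfrac{\mathtt b_{\mathfrak t,i}\mathtt b_{\mathfrak t,i+1}}{(\mathtt b_{\mathfrak t,i}\mathtt b_{\mathfrak t,i+1}-1)^2}\Bigr).$$ For $a=d_{\mathfrak t}(i_p)\in\mathcal D_{\mathfrak t}$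 call $a$ odd or even according to $p$, and if $p$ is even write $a^-=d_{\mathfrak t}(i_{p-1})$. For all $\mathfrak t,\beta,\alpha$ as above: 1. $X_i\,C^\beta C^\alpha v_{\mathfrak t}=\mathtt b_{\mathfrak t,i}^{-\nu_\beta(i)}C^\beta C^\alpha v_{\mathfrak t}$ for $i\in[n]$. 2. $\gamma_{\mathfrak t}v_{\mathfrak t}=v_{\mathfrak t}$. 3. For $i\in[n]$, $C_i\,C^\beta C^\alpha v_{\mathfrak t}$ equals $(-1)^{|\beta|_{<i}}C^{\beta+e_i}C^\alpha v_{\mathfrak t}$ if $i\notin\mathcal D_{\mathfrak t}$; $(-1)^{|\beta|+|\alpha|_{<i}}C^\beta C^{\alpha+e_i}v_{\mathfrak t}$ if $i\in\mathcal D_{\mathfrak t}$ is odd; $-\sqrt{-1}(-1)^{|\beta|+|\alpha|_{\le i^-}}C^\beta C^{\alpha+e_{i^-}}v_{\mathfrak t}$ if $i\in\mathcal D_{\mathfrak t}$ is even. 4. For $i\in[n-1]$, $$T_i\,C^\beta C^\alpha v_{\mathfrak t}=-\frac{\epsilon}{\mathtt b_{\mathfrak t,i}^{-\nu_\beta(i)}\mathtt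 b_{\mathfrak t,i+1}^{\nu_\beta(i+1)}-1}C^\beta C^\alpha v_{\mathfrak t}+\frac{\epsilon}{\mathtt b_{\mathfrak t,i}^{\nu_\beta(i)}\mathtt b_{\mathfrak t,i+1}^{\nu_\beta(i+1)}-1}R+\delta(s_i\mathfrak t)(-1)^{\beta_i\beta_{i+1}+\alpha_i\alpha_{i+1}}\sqrt{\mathtt c_{\mathfrak t}(i)}\,C^{s_i\beta}C^{s_i\alpha}v_{s_i\mathfrak t},$$ where, with $j=i+1$, the element $R$ is: - $i,j\notin\mathcal D_{\mathfrak t}$: $(-1)^{\beta_i}C^{\beta+e_i+e_j}C^\alpha v_{\mathfrak t}$; - $i\in\mathcal D_{\mathfrak t}$, $j\notin\mathcal D_{\mathfrak t}$: $(-1)^{1+|\beta|_{>i}+|\alpha|_{<i}}C^{\beta+e_j}C^{\alpha+e_i}v_{\mathfrak t}$ for $i$ odd, $-\sqrt{-1}(-1)^{1+|\beta|_{>i}+|\alpha|_{\le i^-}}C^{\beta+e_j}C^{\alpha+e_{i^-}}v_{\mathfrak t}$ for $i$ even; - $i\notin\mathcal D_{\mathfrak t}$, $j\in\mathcal D_{\mathfrak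 t}$: $(-1)^{|\beta|_{\ge i}+|\alpha|_{<j}}C^{\beta+e_i}C^{\alpha+e_j}v_{\mathfrak t}$ for $j$ odd, $-\sqrt{-1}(-1)^{|\beta|_{\ge i}+|\alpha|_{\le j^-}}C^{\beta+e_i}C^{\alpha+e_{j^-}}v_{\mathfrak t}$ for $j$ even; - $i,j\in\mathcal D_{\mathfrak t}$: $(-1)^{\alpha_i}C^\beta C^{\alpha+e_i+e_j}v_{\mathfrak t}$ ($i,j$ odd); $-\sqrt{-1}(-1)^{|\alpha|_{<j}+|\alpha+e_j|_{\le i^-}}C^\beta C^{\alpha+e_{i^-}+e_j}v_{\mathfrak t}$ ($i$ even, $j$ odd); $-\sqrt{-1}(-1)^{|\alpha|_{\le j^-}+|\alpha+e_{j^-}|_{<i}}C^\beta C^{\alpha+e_i+e_{j^-}}v_{\mathfrak t}$ ($i$ odd, $j$ even); $(-1)^{1+|\alpha|_{\le j^-}+|\alpha+e_{j^-}|_{\le i^-}}C^\beta C^{\alpha+e_{i^-}+e_{j^-}}v_{\mathfrak t}$ ($i,j$ even). -/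

import Mathlib

namespace HeckeClifford

/-! ### Parameters -/

/-- The three families of cyclotomic polynomials `f^(0)`, `f^(s)`, `f^(ss)`. -/
inductive Kind
  | zero
  | s
  | ss

/-- The number of strict partitions in a multipartition of the given kind. -/
def Kind.numStrict : Kind → ℕ
  | .zero => 0
  | .s => 1
  | .ss => 2

/-- The data `q`, `Q = (Q_1, …, Q_m)` and the fixed choice `a ↦ √a` of square roots in `K`.
Their properties are hypotheses of the theorem. -/
structure Params (K : Type*) (m : ℕ) where
  q : K
  Q : Fin m → K
  sqrt : K → K

namespace Params

variable {K : Type*} [Field K] {m : ℕ} (P : Params K m)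

/-- `ε = q - q⁻¹`. -/
def eps : K := P.q - P.q⁻¹

/-- `q(ι) = 2 (qι + (qι)⁻¹) / (q + q⁻¹)`. -/
def qf (x : K) : K := 2 * (P.q * x + (P.q * x)⁻¹) / (P.q + P.q⁻¹)

/-- `b_+(ι)`. -/
def bPlus (x : K) : K := P.qf x / 2 + P.sqrt (P.qf x ^ 2 / 4 - 1)

/-- `b_-(ι)`. -/
def bMinus (x : K) : K := P.qf x / 2 - P.sqrt (P.qf x ^ 2 / 4 - 1)

/-- `Q_0 = 1` in kind `s`; `Q_{0_-} = -1`, `Q_{0_+} = 1` in kind `ss`. -/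
def strictCharge (K : Type*) [Field K] : (k : Kind) → Fin k.numStrict → K
  | .zero => fun i => i.elim0
  | .s => fun _ => 1
  | .ss => ![-1, 1]

/-- The parameter `Q_l` of the component `l`; the strict components come first. -/
def charge (k : Kind) : Fin (k.numStrict + m) → K := Fin.append (strictCharge K k) P.Q

end Params

/-! ### Multipartitions and standard tableaux -/

/-- A box (row, column, component). Rows and columns are counted from `0`; the components
`0, …, k.numStrict - 1` are those of the strict partitions (in kind `ss` first `0_-`, then `0_+`),
and they are followed by the `m` ordinary ones. -/
structure Box (k : Kind) (m : ℕ) where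
  comp : Fin (k.numStrict + m)
  row : ℕ
  col : ℕ

/-- The order in which a multipartition is read: by components, then by rows from left to right. -/
instance (k : Kind) (m : ℕ) : LinearOrder (Box k m) :=
  LinearOrder.lift' (fun b => toLex (b.comp, toLex (b.row, b.col))) (by
    rintro ⟨a, b, c⟩ ⟨a', b', c'⟩ h
    simpa using h)

/-- The box lies in a component that carries a strict partition. -/
abbrev Box.IsStrict {k : Kind} {m : ℕ} (b : Box k m) : Prop := (b.comp : ℕ) < k.numStrict

/-- The box is a diagonal box of a strict component. -/
abbrev Box.IsDiag {k : Kind} {m : ℕ} (b : Box k m) : Prop := b.IsStrict ∧ b.row = b.col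

/-- The set `𝒫^{•,m}_n`: an element is given by its `n` boxes. The boxes of an ordinary component
form a Young diagram, those of a strict component a shifted Young diagram (row `i` starts at
column `i`, so that the row lengths are strictly decreasing). -/
structure Shape (k : Kind) (m n : ℕ) where
  cells : Finset (Box k m)
  shifted : ∀ b ∈ cells, b.IsStrict → b.row ≤ b.col
  left_closed : ∀ (l : Fin (k.numStrict + m)) (i j : ℕ), (⟨l, i, j + 1⟩ : Box k m) ∈ cells →
    ((l : ℕ) < k.numStrict → i ≤ j) → (⟨l, i, j⟩ : Box k m) ∈ cells
  up_closed : ∀ (l : Fin (k.numStrict + m)) (i j : ℕ), (⟨l, i + 1, j⟩ : Box k m) ∈ cells →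
    (⟨l, i, j⟩ : Box k m) ∈ cells
  card_cells : cells.card = n

section Tableaux

variable {k : Kind} {m n : ℕ}

/-- Entries increase along the rows and down the columns of every component. -/
def IsStandard (lam : Shape k m n) (e : lam.cells ≃ Fin n) : Prop :=
  ∀ a b : lam.cells, a.1.comp = b.1.comp →
    (a.1.row = b.1.row ∧ a.1.col < b.1.col ∨ a.1.col = b.1.col ∧ a.1.row < b.1.row) → e a < e b

/-- `Std(λ)`. The entries `1, …, n` are represented by `Fin n`. -/
def Std (lam : Shape k m n) : Type := {e : lam.cells ≃ Fin n // IsStandard lam e}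

/-- The initial tableau `t^λ`, filled row by row from the first component on. -/
def initial (lam : Shape k m n) : Std lam :=
  ⟨(lam.cells.orderIsoOfFin lam.card_cells).symm.toEquiv, by
    rintro ⟨⟨l, i, j⟩, ha⟩ ⟨⟨l', i', j'⟩, hb⟩ h h'
    apply (lam.cells.orderIsoOfFin lam.card_cells).symm.lt_iff_lt.2
    change toLex (l, toLex (i, j)) < toLex (l', toLex (i', j'))
    simp only [Prod.Lex.toLex_lt_toLex] at h h' ⊢
    tauto⟩

/-- The permutation `d(t, t^λ)`, characterized by `t = d(t, t^λ) t^λ`. -/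
def dperm {lam : Shape k m n} (t : Std lam) : Equiv.Perm (Fin n) :=
  (initial lam).1.symm.trans t.1

/-- The tableau (standard or not) obtained from `t` by exchanging the entries `i` and `j`. -/
def swapped {lam : Shape k m n} (t : Std lam) (i j : Fin n) : lam.cells ≃ Fin n :=
  t.1.trans (Equiv.swap i j)

/-- The set `D_{t^λ}` of the entries of `t^λ` in the diagonal boxes of strict components. -/
def diag (lam : Shape k m n) : Finset (Fin n) :=
  Finset.univ.filter fun a => ((initial lam).1.symm a).1.IsDiag

/-- The increasing list `i_1 < i_2 < … < i_t` of the elements of `D_{t^λ}`. -/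
def diagList (lam : Shape k m n) : List (Fin n) := (diag lam).sort (· ≤ ·)

/-- `D_t = d(t, t^λ) (D_{t^λ})`. -/
def diagSet {lam : Shape k m n} (t : Std lam) : Finset (Fin n) :=
  (diag lam).map (dperm t).toEmbedding

/-- For `i ∈ D_t`, the number `p ∈ {1, …, t}` with `i = d(t, t^λ)(i_p)`. -/
def pos {lam : Shape k m n} (t : Std lam) (i : Fin n) : ℕ :=
  (diagList lam).idxOf ((dperm t).symm i) + 1

/-- For `i = d(t, t^λ)(i_p)` with `p ≥ 2`, the entry `d(t, t^λ)(i_{p-1})`. -/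
def prev {lam : Shape k m n} (t : Std lam) (i : Fin n) : Fin n :=
  dperm t ((diagList lam).getD (pos t i - 2) ((dperm t).symm i))

/-- `OD_t = d(t, t^λ) {i_1, i_3, i_5, …}`. -/
def oddDiagSet {lam : Shape k m n} (t : Std lam) : Finset (Fin n) :=
  (diagSet t).filter fun i => Odd (pos t i)

end Tableaux

/-! ### Residues and the separate condition -/

namespace Params

variable {K : Type*} [Field K] {k : Kind} {m n : ℕ} (P : Params K m)

/-- `res(i, j, l) = Q_l q^{2(j-i)}`. -/
def boxRes (b : Box k m) : K := P.charge k b.comp * P.q ^ (2 * ((b.col : ℤ) - (b.row : ℤ)))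

/-- `res_t(a)`. -/
def res {lam : Shape k m n} (t : Std lam) (a : Fin n) : K := P.boxRes (t.1.symm a).1

/-- `(q, Q)` is separate with respect to `μ`. -/
def IsSeparate (mu : Shape k m n) : Prop :=
  ∀ (t : Std mu) (i j : Fin n), (j : ℕ) = i + 1 → P.qf (P.res t i) ≠ P.qf (P.res t j)

/-- `b_{t,i} = b_-(res_t(i))`. -/
def b {lam : Shape k m n} (t : Std lam) (i : Fin n) : K := P.bMinus (P.res t i)

/-- `c_t(i)`, where `j = i + 1`. -/
def c {lam : Shape k m n} (t : Std lam) (i j : Fin n) : K :=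
  1 - P.eps ^ 2 * (((P.b t i)⁻¹ * P.b t j) / ((P.b t i)⁻¹ * P.b t j - 1) ^ 2
    + (P.b t i * P.b t j) / (P.b t i * P.b t j - 1) ^ 2)

end Params

/-! ### The affine and the cyclotomic Hecke-Clifford algebra with `n = N + 1` -/

/-- Generators; `T i` stands for `T_{i+1}` and `X j`, `Xinv j`, `C j` for
`X_{j+1}`, `X_{j+1}⁻¹`, `C_{j+1}`. -/
inductive Gen (N : ℕ)
  | T (i : Fin N)
  | X (j : Fin (N + 1))
  | Xinv (j : Fin (N + 1))
  | C (j : Fin (N + 1))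

section Algebra

variable {K : Type*} [Field K]

/-- A generator of the free algebra. -/
abbrev free (K : Type*) [Field K] {N : ℕ} (g : Gen N) : FreeAlgebra K (Gen N) :=
  FreeAlgebra.ι K g

/-- The defining relations of the affine Hecke-Clifford algebra, with `ε = q - q⁻¹`. Here
`i.castSucc` and `i.succ` are the indices `i` and `i + 1`. -/
inductive AffineRel (ε : K) (N : ℕ) :
    FreeAlgebra K (Gen N) → FreeAlgebra K (Gen N) → Prop
  | quad (i : Fin N) : AffineRel ε N
      (free K (.T i) * free K (.T i)) (ε • free K (.T i) + 1)
  | far (i j : Fin N) (h : (i : ℕ) + 1 < j ∨ (j : ℕ) + 1 < i) : AffineRel ε N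
      (free K (.T i) * free K (.T j))
      (free K (.T j) * free K (.T i))
  | braid (i j : Fin N) (h : (j : ℕ) = i + 1) : AffineRel ε N
      (free K (.T i) * free K (.T j) * free K (.T i))
      (free K (.T j) * free K (.T i) * free K (.T j))
  | XX (i j : Fin (N + 1)) : AffineRel ε N
      (free K (.X i) * free K (.X j))
      (free K (.X j) * free K (.X i))
  | XXinv (i : Fin (N + 1)) : AffineRel ε N
      (free K (.X i) * free K (.Xinv i)) 1
  | XinvX (i : Fin (N + 1)) : AffineRel ε N
      (free K (.Xinv i) * free K (.X i)) 1
  | CC_self (i : Fin (N + 1)) : AffineRel ε N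
      (free K (.C i) * free K (.C i)) 1
  | CC (i j : Fin (N + 1)) (h : i ≠ j) : AffineRel ε N
      (free K (.C i) * free K (.C j))
      (-(free K (.C j) * free K (.C i)))
  | TX (i : Fin N) : AffineRel ε N
      (free K (.T i) * free K (.X i.castSucc))
      (free K (.X i.succ) * free K (.T i)
        - ε • (free K (.X i.succ)
          + free K (.C i.castSucc) * free K (.C i.succ)
            * free K (.X i.castSucc)))
  | TX_succ (i : Fin N) : AffineRel ε N
      (free K (.T i) * free K (.X i.succ))
      (free K (.X i.castSucc) * free K (.T i)
        + ε • ((1 - free K (.C i.castSucc) * free K (.C i.succ))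
          * free K (.X i.succ)))
  | TX_far (i : Fin N) (j : Fin (N + 1)) (h : j ≠ i.castSucc) (h' : j ≠ i.succ) : AffineRel ε N
      (free K (.T i) * free K (.X j))
      (free K (.X j) * free K (.T i))
  | TC (i : Fin N) : AffineRel ε N
      (free K (.T i) * free K (.C i.castSucc))
      (free K (.C i.succ) * free K (.T i))
  | TC_succ (i : Fin N) : AffineRel ε N
      (free K (.T i) * free K (.C i.succ))
      (free K (.C i.castSucc) * free K (.T i)
        - ε • (free K (.C i.castSucc) - free K (.C i.succ)))
  | TC_far (i : Fin N) (j : Fin (N + 1)) (h : j ≠ i.castSucc) (h' : j ≠ i.succ) : AffineRel ε N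
      (free K (.T i) * free K (.C j))
      (free K (.C j) * free K (.T i))
  | XC_self (i : Fin (N + 1)) : AffineRel ε N
      (free K (.X i) * free K (.C i))
      (free K (.C i) * free K (.Xinv i))
  | XC (i j : Fin (N + 1)) (h : i ≠ j) : AffineRel ε N
      (free K (.X i) * free K (.C j))
      (free K (.C j) * free K (.X i))

variable {m : ℕ}

/-- The affine Hecke-Clifford algebra. -/
abbrev Affine (P : Params K m) (N : ℕ) : Type _ := RingQuot (AffineRel P.eps N)

/-- A generator of the affine Hecke-Clifford algebra. -/
noncomputable def affineGen (P : Params K m) {N : ℕ} (g : Gen N) : Affine P N :=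
  RingQuot.mkAlgHom K (AffineRel P.eps N) (FreeAlgebra.ι K g)

/-- The strict part of the cyclotomic polynomial: `1`, `x - 1` or `(x - 1)(x + 1)`. -/
def strictFactor {A : Type*} [Ring A] (x : A) : Kind → A
  | .zero => 1
  | .s => x - 1
  | .ss => (x - 1) * (x + 1)

/-- The element `f(X_1)` of the affine Hecke-Clifford algebra. -/
noncomputable def cycElement (P : Params K m) (k : Kind) (N : ℕ) : Affine P N :=
  strictFactor (affineGen P (.X 0)) k *
    (List.ofFn fun i : Fin m => affineGen P (.X 0) + affineGen P (.Xinv 0)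
      - algebraMap K (Affine P N) (P.qf (P.Q i))).prod

/-- The relation `f(X_1) = 0`. -/
inductive CycRel (P : Params K m) (k : Kind) (N : ℕ) : Affine P N → Affine P N → Prop
  | mk : CycRel P k N (cycElement P k N) 0

/-- The cyclotomic Hecke-Clifford algebra: the quotient of the affine one by the two-sided ideal
generated by `f(X_1)`. -/
abbrev Cyc (P : Params K m) (k : Kind) (N : ℕ) : Type _ := RingQuot (CycRel P k N)

/-- A generator of the cyclotomic Hecke-Clifford algebra. -/
noncomputable def gen (P : Params K m) (k : Kind) {N : ℕ} (g : Gen N) : Cyc P k N :=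
  RingQuot.mkAlgHom K (CycRel P k N) (affineGen P g)

/-- `C^β = C_1^{β_1} ⋯ C_n^{β_n}`. -/
noncomputable def Cpow (P : Params K m) (k : Kind) {N : ℕ} (β : Fin (N + 1) → ZMod 2) :
    Cyc P k N :=
  (List.ofFn fun j => gen P k (.C j) ^ (β j).val).prod

/-- `F(a_1, a_2) F(a_3, a_4) ⋯`, over the consecutive pairs of the list `a_1, a_2, …`; a last
unpaired member is ignored. -/
def pairProd {α M : Type*} [Monoid M] (F : α → α → M) : List α → M
  | a :: b :: l => F a b * pairProd F l
  | _ => 1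

/-- `γ_t = 2^{-⌊t/2⌋} ∏_k (1 + √-1 C_{d(i_{2k-1})} C_{d(i_{2k})})` with `d = d(t, t^λ)`. -/
noncomputable def gammaElt (P : Params K m) {k : Kind} {N : ℕ} {lam : Shape k m (N + 1)}
    (t : Std lam) : Cyc P k N :=
  ((2 : K)⁻¹ ^ ((diagList lam).length / 2)) •
    pairProd (fun a b => 1 + P.sqrt (-1) • (gen P k (.C a) * gen P k (.C b)))
      ((diagList lam).map (dperm t))

end Algebra

/-! ### Vectors in `ℤ_2^n` and signs -/

section Signs

variable {n : ℕ}

/-- `(-1)^a` for `a ∈ ℤ_2`. -/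
def sgn (K : Type*) [Field K] (a : ZMod 2) : K := (-1) ^ a.val

/-- The standard vector `e_i`. -/
def e (i : Fin n) : Fin n → ZMod 2 := Pi.single i 1

/-- `|β|`. -/
def deg (β : Fin n → ZMod 2) : ZMod 2 := ∑ j, β j

/-- `|β|_{<i}`. -/
def degLT (β : Fin n → ZMod 2) (i : Fin n) : ZMod 2 := ∑ j ∈ Finset.Iio i, β j

/-- `|β|_{≤i}`. -/
def degLE (β : Fin n → ZMod 2) (i : Fin n) : ZMod 2 := ∑ j ∈ Finset.Iic i, β j

/-- `|β|_{>i}`. -/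
def degGT (β : Fin n → ZMod 2) (i : Fin n) : ZMod 2 := ∑ j ∈ Finset.Ioi i, β j

/-- `|β|_{≥i}`. -/
def degGE (β : Fin n → ZMod 2) (i : Fin n) : ZMod 2 := ∑ j ∈ Finset.Ici i, β j

/-- `ν_β(i) = (-1)^{β_i}` as an integer. -/
def nu (β : Fin n → ZMod 2) (i : Fin n) : ℤ := if β i = 1 then -1 else 1

/-- `ℤ_2(S)`: the vectors whose support is contained in `S`. -/
def Z2 (S : Set (Fin n)) : Type := {β : Fin n → ZMod 2 // ∀ i, β i ≠ 0 → i ∈ S}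

end Signs

/-! ### The module `𝔻(λ)` -/

section Module

variable {K : Type*} [Field K] {k : Kind} {m n : ℕ}

/-- The tensor product `𝕃(ι_1) ⊗ ⋯ ⊗ 𝕃(ι_n)`, in coordinates with respect to the basis
`C^β (v_1 ⊗ ⋯ ⊗ v_n)`, `β ∈ ℤ_2^n`; this basis vector is the tensor product of the `v_i`
(for `β_i = 0`) and `v'_i = C_i v_i` (for `β_i = 1`), and has parity `|β|`. -/
abbrev Tens (K : Type*) (n : ℕ) : Type _ := (Fin n → ZMod 2) → K

/-- The eigenvalue of `X_a` on `C^β (v_1 ⊗ ⋯ ⊗ v_n)` in `𝕃(ι_1) ⊗ ⋯ ⊗ 𝕃(ι_n)`: it is `b_+(ι_a)`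
if the `a`-th factor is `v_a`, and `b_-(ι_a)` if it is `v'_a`. -/
def Params.eig (P : Params K m) (ι : Fin n → K) (a : Fin n) (β : Fin n → ZMod 2) : K :=
  if β a = 0 then P.bPlus (ι a) else P.bMinus (ι a)

/-- The action of `C_a` on the tensor product:
`C_a C^β (v_1 ⊗ ⋯ ⊗ v_n) = (-1)^{|β|_{<a}} C^{β + e_a} (v_1 ⊗ ⋯ ⊗ v_n)`. -/
def cliff (a : Fin n) (f : Tens K n) : Tens K n :=
  fun β => sgn K (degLT β a) * f (β + e a)

/-- The operator `ρ_a : C^β (v_1 ⊗ ⋯ ⊗ v_n) ↦ C^β C_a (v_1 ⊗ ⋯ ⊗ v_n)`, that is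
`C^β (v_1 ⊗ ⋯ ⊗ v_n) ↦ (-1)^{|β|_{>a}} C^{β + e_a} (v_1 ⊗ ⋯ ⊗ v_n)`. -/
def rightCliff (a : Fin n) : Module.End K (Tens K n) where
  toFun f := fun β => sgn K (degGT β a) * f (β + e a)
  map_add' f g := by ext β; simp [mul_add]
  map_smul' r f := by ext β; simp [mul_left_comm]

/-- The projection
`ρ(γ)`, `γ = 2^{-⌊t/2⌋} ∏_k (1 - √-1 C_{2k-1} C_{2k})`, where `ρ(C_j) = ρ_{i_j}`.
Since `ρ_a ρ_b (v_1 ⊗ ⋯ ⊗ v_n) = C_b C_a (v_1 ⊗ ⋯ ⊗ v_n)`, the image of `v_1 ⊗ ⋯ ⊗ v_n` is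
`2^{-⌊t/2⌋} ∏_k (1 + √-1 C_{i_{2k-1}} C_{i_{2k}}) (v_1 ⊗ ⋯ ⊗ v_n)`. -/
noncomputable def Params.proj (P : Params K m) (lam : Shape k m n) : Module.End K (Tens K n) :=
  ((2 : K)⁻¹ ^ ((diagList lam).length / 2)) •
    pairProd (fun a b => 1 - P.sqrt (-1) • (rightCliff a * rightCliff b)) (diagList lam)

/-- The irreducible component `𝕃(res(t^λ)) = 𝕃(ι_1) ⊛ ⋯ ⊛ 𝕃(ι_n)` of the tensor product, for
`ι = res(t^λ)`: the image of a primitive idempotent. -/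
noncomputable def Params.L (P : Params K m) (lam : Shape k m n) : Submodule K (Tens K n) :=
  LinearMap.range (P.proj lam)

/-- The direct sum over `t ∈ Std(λ)` of the tensor products twisted by `d(t, t^λ)`. The member
`∑_t z_t^{d(t, t^λ)}` is the function `t ↦ z_t`. -/
abbrev Ambient (K : Type*) (lam : Shape k m n) : Type _ := Std lam → Tens K n

/-- `𝔻(λ) = ⨁_t 𝕃(res(t^λ))^{d(t, t^λ)}`. -/
noncomputable def Params.D (P : Params K m) (lam : Shape k m n) :
    Submodule K (Ambient K lam) :=
  Submodule.pi Set.univ fun _ => P.L lam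

noncomputable instance (P : Params K m) (lam : Shape k m n) : AddCommGroup (P.D lam) :=
  Submodule.addCommGroup _

noncomputable instance (P : Params K m) (lam : Shape k m n) : Module K (P.D lam) :=
  Submodule.module _

noncomputable instance (P : Params K m) (lam : Shape k m n) : MulAction K (P.D lam) :=
  Module.toDistribMulAction.toMulAction

/-- The eigenvalue of `X_a` on `(C^β (v_1 ⊗ ⋯ ⊗ v_n))^{d(t, t^λ)}`; on a module twisted by `τ`,
`X_a` acts as `X_{τ⁻¹(a)}` does on the original one. -/
noncomputable def Params.eigT (P : Params K m) {lam : Shape k m n} (t : Std lam) (a : Fin n)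
    (β : Fin n → ZMod 2) : K :=
  P.eig (P.res (initial lam)) ((dperm t).symm a) β

/-- The action of `X_a` on the direct sum of twisted modules. -/
noncomputable def Params.opX (P : Params K m) {lam : Shape k m n} (a : Fin n)
    (f : Ambient K lam) : Ambient K lam :=
  fun t β => P.eigT t a β * f t β

/-- The action of `C_a` on the direct sum of twisted modules. -/
def opC {lam : Shape k m n} (a : Fin n) (f : Ambient K lam) : Ambient K lam :=
  fun t => cliff ((dperm t).symm a) (f t)

open Classical in
/-- The action of `T_i`, where `j = i + 1`:
`T_i z^{d(t)} = Ξ_i z^{d(t)} + Ω_i z^{s_i d(t)}`, the second summand being present only if `s_i t`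
is standard, with
`Ξ_i = - ε / (X_i X_j⁻¹ - 1) + ε / (X_i X_j - 1) C_i C_j` and
`Ω_i = √(1 - ε² (X_i X_j⁻¹ / (X_i X_j⁻¹ - 1)² + X_i⁻¹ X_j⁻¹ / (X_i⁻¹ X_j⁻¹ - 1)²))`.
Functions of the commuting diagonal operators `X_i`, `X_j` are applied to their eigenvalues
`x`, `y`. The component at `t` of the result receives its second summand from `s_i t`. -/
noncomputable def Params.opT (P : Params K m) {lam : Shape k m n} (i j : Fin n)
    (f : Ambient K lam) : Ambient K lam :=
  fun t β =>
    let x := P.eigT t i β;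
    let y := P.eigT t j β;
    -(P.eps / (x * y⁻¹ - 1)) * f t β
      + P.eps / (x * y - 1) * opC i (opC j f) t β
      + if h : IsStandard lam (swapped t i j) then
          P.sqrt (1 - P.eps ^ 2 * ((x * y⁻¹) / (x * y⁻¹ - 1) ^ 2
            + (x⁻¹ * y⁻¹) / (x⁻¹ * y⁻¹ - 1) ^ 2)) * f ⟨swapped t i j, h⟩ β
        else 0

/-- The parity operator: `z ↦ (-1)^{|z|} z` on homogeneous `z`. -/
def parity {lam : Shape k m n} (f : Ambient K lam) : Ambient K lam :=
  fun t β => sgn K (deg β) * f t β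

open Classical in
/-- `v_t = (ρ(γ)(v_1 ⊗ ⋯ ⊗ v_n))^{d(t, t^λ)}`. -/
noncomputable def Params.v (P : Params K m) {lam : Shape k m n} (t : Std lam) : P.D lam :=
  ⟨fun u => if u = t then P.proj lam (Pi.single 0 1) else 0, by
    simp only [Params.D, Submodule.mem_pi]
    intro u _
    split_ifs
    · exact ⟨_, rfl⟩
    · exact Submodule.zero_mem _⟩

/-- A representation of the algebra `A` on `𝔻(λ)` is simple as a supermodule: it is nonzero, and
the only `ℤ_2`-graded (equivalently, stable under the parity operator) subspaces stable under `A`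
are the two trivial ones. -/
def Params.IsSimpleSuper (P : Params K m) (lam : Shape k m n) {A : Type*} [Semiring A] [Algebra K A]
    (ρ : A →ₐ[K] Module.End K (P.D lam)) : Prop :=
  Nontrivial (P.D lam) ∧
    ∀ S : Submodule K (P.D lam), (∀ (a : A), ∀ x ∈ S, ρ a x ∈ S) →
      (∀ x ∈ S, ∀ y : P.D lam, (y : Ambient K lam) = parity (x : Ambient K lam) → y ∈ S) →
      S = ⊥ ∨ S = ⊤

/-- The element `R(i, β, α, t)`, where `j = i + 1` and `w β α` stands for `C^β C^α v_t`. -/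
noncomputable def Params.R (P : Params K m) {lam : Shape k m n} (t : Std lam) {M : Type*}
    [AddCommGroup M] [Module K M] (w : (Fin n → ZMod 2) → (Fin n → ZMod 2) → M) (i j : Fin n)
    (β α : Fin n → ZMod 2) : M :=
  if i ∈ diagSet t then
    if j ∈ diagSet t then
      if Odd (pos t i) then
        if Odd (pos t j) then
          sgn K (α i) • w β (α + e i + e j)
        else
          (-P.sqrt (-1) * sgn K (degLE α (prev t j) + degLT (α + e (prev t j)) i)) •
            w β (α + e i + e (prev t j))
      else
        if Odd (pos t j) then
          (-P.sqrt (-1) * sgn K (degLT α j + degLE (α + e j) (prev t i))) •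
            w β (α + e (prev t i) + e j)
        else
          sgn K (1 + degLE α (prev t j) + degLE (α + e (prev t j)) (prev t i)) •
            w β (α + e (prev t i) + e (prev t j))
    else
      if Odd (pos t i) then
        sgn K (1 + degGT β i + degLT α i) • w (β + e j) (α + e i)
      else
        (-P.sqrt (-1) * sgn K (1 + degGT β i + degLE α (prev t i))) •
          w (β + e j) (α + e (prev t i))
  else
    if j ∈ diagSet t then
      if Odd (pos t j) then
        sgn K (degGE β i + degLT α j) • w (β + e i) (α + e j)
      else
        (-P.sqrt (-1) * sgn K (degGE β i + degLE α (prev t j))) •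
          w (β + e i) (α + e (prev t j))
    else
      sgn K (β i) • w (β + e i + e j) α

end Module

/-- The vector `C^β C^α v_t` of `𝔻(λ)`, for a given representation of the cyclotomic
Hecke-Clifford algebra on `𝔻(λ)`. -/
noncomputable def Params.vec {K : Type*} [Field K] {k : Kind} {m N : ℕ} (P : Params K m)
    {lam : Shape k m (N + 1)} (ρ : Cyc P k N →ₐ[K] Module.End K (P.D lam)) (t : Std lam)
    (β α : Fin (N + 1) → ZMod 2) : P.D lam :=
  ρ (Cpow P k β * Cpow P k α) (P.v t)

end HeckeClifford

/-!
In coordinates, a vector of `𝔻(λ)` is a family of tensors indexed by the standard tableaux `t`, and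
`X_i`, `C_i` act on the component at `t` through the tensor factor `a = ix t i`, the entry in the
initial tableau of the box that contains `i` in `t`. The tensor factors themselves are never
permuted, so with `a = ix t i` and `b = ix t j`, `j = i + 1`, the generator `T_i` becomes

  `(T_i f)_t = Ξ_{a b} f_t + Ω_{a b} f_{s_i t}`.

Here `Ξ_{a b}` (`Xi`) is an operator on the tensor product, and `Ω_{a b}` (`om`) is a scalar:
`u_a = X_a + X_a⁻¹` is a scalar, and `Ω_{a b}² = c(u_a, u_b)` is a rational function of two such
scalars.

*The relations.* The relations of `T_i` with `X_j` and `C_j` hold for each `Ξ` separately. The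
quadratic relation amounts to `Ξ_{a b} + Ξ_{b a} = ε` and `Ξ_{a b}² = ε Ξ_{a b} + 1 - c(u_a, u_b)`
(`Xi_add_swap`, `Xi_sq`). In the braid relation one compares the coefficients of the permuted
components: they agree by a Yang-Baxter equation (`Xi_yangBaxter`) and by a relation
(`Xi_braid_of_ne`) in which the difference of the two cubic expressions in `Ξ` is balanced by the
difference of two values of `c`. If `u_a = u_c` for the outer two of the three boxes, then none of
the exchanges is possible, so the boxes form a row, a column, or a hook that starts and ends on the
diagonal of a strict component (`blocked_chain`); then the two cubic expressions agree already
(`Xi_braid_of_blocked`). In all of this `T_i` may be applied at tableaux that are not standard, with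
zero components there, since `Ω = 0` whenever `s_i t` is not standard (`cf_eq_zero_of_not`). The
space `𝔻(λ)` is stable, because the projection that defines it is composed of right Clifford
multiplications, which commute with the left ones (`proj_cl`) and with every function of the `X_a`,
these being scalars at the diagonal boxes (`proj_mul`).

*The separate condition.* It says that `q(res)` takes different values at two boxes that are added
successively to a diagram (`qf_ne_of_chain`). A suitable choice of the diagram gives what is needed:
consecutive entries have `u_a ≠ u_b`, so that there are no zero denominators
(`qf_ne_of_consecutive`); the sequence of the `u` determines the tableau (`eq_of_qf_eq`); off the
diagonals of the strict components `X_a` has two different eigenvalues (`qf_sq_ne_four`); and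
`Ω ≠ 0` if `s_i t` is standard (`cf_ne_zero`).

*The basis.* The generator `v` of `𝕃` satisfies `C_b v = -√-1 C_a v` for the members `a`, `b` of a
pair of diagonal entries (`cl_vac`). This gives the action of the `C_i` on the vectors
`C^β C^α v_t`, and hence these vectors span. They are signed translates of `v`, and each of them has
a coordinate at which the others vanish (`coe_vec_apply_eq_zero_iff`), so they are independent.

*Simplicity.* The basis vectors are separated by operators that act diagonally on them: `X_i +
X_i⁻¹` recognizes `t`, then `X_i` recognizes `β`, and `C_{i⁻} C_i` together with the parity
recognizes `α`. A vector of minimal support in a stable graded subspace is therefore a multiple of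
one basis vector (`exists_vec_mem`). From there the invertible `C_i` lead to `v_t`, and the `T_i`
to all the other `v_s`, as the exchanges of consecutive entries connect the standard tableaux
(`std_induction`) and the coefficients `Ω` of admissible exchanges do not vanish.
-/


namespace HeckeClifford

/-! ### Signs -/

section SignLemmas

variable (K : Type*) [Field K]

@[simp] lemma sgn_zero : sgn K 0 = 1 := by simp [sgn]

@[simp] lemma sgn_one : sgn K 1 = -1 := by simp [sgn, ZMod.val_one]

lemma zmod_two_cases (a : ZMod 2) : a = 0 ∨ a = 1 := by
  revert a; decide

lemma sgn_add (a b : ZMod 2) : sgn K (a + b) = sgn K a * sgn K b := by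
  have h : (1 : ZMod 2) + 1 = 0 := by decide
  rcases zmod_two_cases a with rfl | rfl <;> rcases zmod_two_cases b with rfl | rfl <;> simp [h]

lemma sgn_mul_self (a : ZMod 2) : sgn K a * sgn K a = 1 := by
  rcases zmod_two_cases a with rfl | rfl <;> simp

lemma sgn_ne_zero (a : ZMod 2) : sgn K a ≠ 0 := fun h => by
  simpa [h] using sgn_mul_self K a

variable {n : ℕ}

lemma add_self_zero (β : Fin n → ZMod 2) : β + β = 0 := by
  ext i; exact CharTwo.add_self_eq_zero (β i)

lemma add_e_add_e (β : Fin n → ZMod 2) (a : Fin n) : β + e a + e a = β := by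
  rw [add_assoc, add_self_zero, add_zero]

lemma add_e_self (β : Fin n → ZMod 2) (a : Fin n) : (β + e a) a = β a + 1 := by
  simp [e]

lemma add_e_of_ne (β : Fin n → ZMod 2) {a b : Fin n} (h : b ≠ a) : (β + e a) b = β b := by
  simp [e, h]

lemma sum_e (S : Finset (Fin n)) (a : Fin n) :
    ∑ j ∈ S, (e a : Fin n → ZMod 2) j = if a ∈ S then 1 else 0 := by
  simp [e, Finset.sum_pi_single']

lemma degLT_add (β γ : Fin n → ZMod 2) (i : Fin n) :
    degLT (β + γ) i = degLT β i + degLT γ i := by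
  simp [degLT, Finset.sum_add_distrib]

lemma degGT_add (β γ : Fin n → ZMod 2) (i : Fin n) :
    degGT (β + γ) i = degGT β i + degGT γ i := by
  simp [degGT, Finset.sum_add_distrib]

lemma deg_add (β γ : Fin n → ZMod 2) : deg (β + γ) = deg β + deg γ := by
  simp [deg, Finset.sum_add_distrib]

lemma degLT_e (a i : Fin n) : degLT (e a) i = if a < i then 1 else 0 := by
  simp [degLT, sum_e]

lemma degGT_e (a i : Fin n) : degGT (e a) i = if i < a then 1 else 0 := by
  simp [degGT, sum_e]

lemma deg_e (a : Fin n) : deg (e a) = 1 := by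
  simp [deg, sum_e]

end SignLemmas

/-! ### Left and right Clifford multiplications -/

section Clifford

variable {K : Type*} [Field K] {n : ℕ}

/-- `cliff a` as a linear map. -/
def cl (a : Fin n) : Module.End K (Tens K n) where
  toFun := cliff a
  map_add' f g := by ext β; simp [cliff, mul_add]
  map_smul' r f := by ext β; simp [cliff, mul_left_comm]

lemma cl_apply (a : Fin n) (f : Tens K n) (β : Fin n → ZMod 2) :
    cl a f β = sgn K (degLT β a) * f (β + e a) := rfl

lemma rightCliff_apply (a : Fin n) (f : Tens K n) (β : Fin n → ZMod 2) :
    rightCliff a f β = sgn K (degGT β a) * f (β + e a) := rfl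

lemma cl_cl_self (a : Fin n) (f : Tens K n) : cl a (cl a f) = f := by
  ext β
  simp only [cl_apply, degLT_add, degLT_e, lt_irrefl, if_false, add_zero, add_e_add_e]
  rw [← mul_assoc, sgn_mul_self, one_mul]

lemma cl_anticomm {a b : Fin n} (h : a ≠ b) (f : Tens K n) :
    cl a (cl b f) = -cl b (cl a f) := by
  ext β
  simp only [cl_apply, degLT_add, degLT_e, Pi.neg_apply, sgn_add, add_right_comm β (e a)]
  rcases lt_or_gt_of_ne h with h | h <;> simp [h, not_lt.2 h.le] <;> ring

lemma rightCliff_self (a : Fin n) (f : Tens K n) : rightCliff a (rightCliff a f) = f := by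
  ext β
  simp only [rightCliff_apply, degGT_add, degGT_e, lt_irrefl, if_false, add_zero, add_e_add_e]
  rw [← mul_assoc, sgn_mul_self, one_mul]

lemma rightCliff_anticomm {a b : Fin n} (h : a ≠ b) (f : Tens K n) :
    rightCliff a (rightCliff b f) = -rightCliff b (rightCliff a f) := by
  ext β
  simp only [rightCliff_apply, degGT_add, degGT_e, Pi.neg_apply, sgn_add, add_right_comm β (e a)]
  rcases lt_or_gt_of_ne h with h | h <;> simp [h, not_lt.2 h.le] <;> ring

lemma cl_rightCliff (a b : Fin n) (f : Tens K n) :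
    cl a (rightCliff b f) = rightCliff b (cl a f) := by
  ext β
  simp only [cl_apply, rightCliff_apply, degGT_add, degGT_e, degLT_add, degLT_e, sgn_add,
    add_right_comm β (e a)]
  by_cases h : b < a <;> simp [h] <;> ring

/-- A diagonal operator passes through `C_a` at the price of translating its eigenvalues. -/
lemma cl_mul (a : Fin n) (φ f : Tens K n) :
    cl a (φ * f) = (fun β => φ (β + e a)) * cl a f := by
  ext β
  simp only [cl_apply, Pi.mul_apply]
  ring

lemma rightCliff_mul (a : Fin n) (φ f : Tens K n) :
    rightCliff a (φ * f) = (fun β => φ (β + e a)) * rightCliff a f := by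
  ext β
  simp only [rightCliff_apply, Pi.mul_apply]
  ring

end Clifford

/-! ### The operators `Ξ` -/

section Xi

variable {K : Type*} [Field K] {n : ℕ}

/-- The coefficient `-ε / (x y⁻¹ - 1)` of the identity in `Ξ`. -/
def pf (ε x y : K) : K := -(ε / (x * y⁻¹ - 1))

/-- The coefficient `ε / (x y - 1)` of `C_a C_b` in `Ξ`. -/
def rf (ε x y : K) : K := ε / (x * y - 1)

/-- The square of the coefficient `Ω`, in terms of `u = x + x⁻¹` and `w = y + y⁻¹`. -/
def cf (ε u w : K) : K := 1 - ε ^ 2 * ((u * w - 4) / (u - w) ^ 2)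

/-- The polynomial `G` in `c(u₂, u₃) - c(u₁, u₂) = (u₃ - u₁) G / ((u₁ - u₂)² (u₂ - u₃)²)`. It
vanishes when `u₁` and `u₃` are the two zeros of `c(·, u₂)`. -/
def gf (ε u v w : K) : K := ε ^ 2 * (u * v * w - v ^ 3 - 4 * (u + w) + 8 * v)

lemma pf_eq (ε : K) {x y : K} (hy : y ≠ 0) : pf ε x y = -(ε * y / (x - y)) := by
  unfold pf
  rw [show x * y⁻¹ - 1 = (x - y) / y by field_simp, div_div_eq_mul_div]

/-- The eigenvalues of the commuting operators `X_a` on the basis `C^β (v_1 ⊗ ⋯ ⊗ v_n)`: the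
operator `C_a` inverts the eigenvalue of `X_a` and keeps the others, so that `X_a + X_a⁻¹` is the
scalar `u a`. -/
structure IsEig (x : Fin n → Tens K n) (u : Fin n → K) : Prop where
  ne_zero : ∀ a β, x a β ≠ 0
  flip : ∀ a β, x a (β + e a) = (x a β)⁻¹
  const : ∀ a b β, a ≠ b → x a (β + e b) = x a β
  add_inv : ∀ a β, x a β + (x a β)⁻¹ = u a

/-- The operator `Ξ = -ε / (X_a X_b⁻¹ - 1) + ε / (X_a X_b - 1) C_a C_b`. -/
def Xi (ε : K) (x : Fin n → Tens K n) (a b : Fin n) : Module.End K (Tens K n) where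
  toFun f := (fun β => pf ε (x a β) (x b β)) * f + (fun β => rf ε (x a β) (x b β)) * cl a (cl b f)
  map_add' f g := by simp only [map_add, mul_add]; abel
  map_smul' r f := by simp only [map_smul, mul_smul_comm, smul_add, RingHom.id_apply]

lemma Xi_apply (ε : K) (x : Fin n → Tens K n) (a b : Fin n) (f : Tens K n) :
    Xi ε x a b f =
      (fun β => pf ε (x a β) (x b β)) * f + (fun β => rf ε (x a β) (x b β)) * cl a (cl b f) := rfl

lemma Xi_apply_apply (ε : K) (x : Fin n → Tens K n) (a b : Fin n) (f : Tens K n)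
    (β : Fin n → ZMod 2) :
    Xi ε x a b f β = pf ε (x a β) (x b β) * f β + rf ε (x a β) (x b β) * cl a (cl b f) β := rfl

end Xi

end HeckeClifford

namespace HeckeClifford

/-! ### Rational identities between the coefficients of `Ξ` -/

section Rational

variable {K : Type*} [Field K] (ε : K) {x y z : K}

lemma pf_inv_inv : pf ε x⁻¹ y⁻¹ = pf ε y x := by
  simp [pf, mul_comm]

lemma pf_inv_right : pf ε x y⁻¹ = -rf ε x y := by simp [pf, rf]

lemma rf_inv_right : rf ε x y⁻¹ = -pf ε x y := by simp [pf, rf]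

lemma rf_comm : rf ε x y = rf ε y x := by simp [rf, mul_comm]

lemma rf_inv_left : rf ε x⁻¹ y = -pf ε y x := by rw [rf_comm, rf_inv_right]

lemma pf_inv_left (hx : x ≠ 0) (hy : y ≠ 0) (h : x * y ≠ 1) :
    pf ε x⁻¹ y = ε + rf ε x y := by
  have h1 : x * y - 1 ≠ 0 := sub_ne_zero.2 h
  have h1' : y * x - 1 ≠ 0 := mul_comm x y ▸ h1
  rw [pf_eq _ hy, rf, show x⁻¹ - y = -(x * y - 1) / x by field_simp; ring]
  field_simp
  ring

lemma rf_inv_inv (hx : x ≠ 0) (hy : y ≠ 0) (h : x * y ≠ 1) :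
    rf ε x⁻¹ y⁻¹ = -ε - rf ε x y := by
  rw [rf_inv_right, pf_inv_left ε hx hy h]
  ring

lemma pf_add_swap (hx : x ≠ 0) (hy : y ≠ 0) (h : x ≠ y) : pf ε x y + pf ε y x = ε := by
  have h1 : x - y ≠ 0 := sub_ne_zero.2 h
  rw [pf_eq _ hx, pf_eq _ hy, ← neg_sub x y]
  field_simp
  ring

lemma add_inv_sub_add_inv (hx : x ≠ 0) (hy : y ≠ 0) :
    x + x⁻¹ - (y + y⁻¹) = (x - y) * (x * y - 1) / (x * y) := by
  field_simp
  ring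

/-- `z / (z - 1)²` for `z = x y⁻¹` and `z = x⁻¹ y⁻¹`, in terms of `x + x⁻¹` and `y + y⁻¹`. -/
lemma omega_sq_eq (hx : x ≠ 0) (hy : y ≠ 0) (h : x ≠ y) (h' : x * y ≠ 1) :
    1 - ε ^ 2 * ((x * y⁻¹) / (x * y⁻¹ - 1) ^ 2 + (x⁻¹ * y⁻¹) / (x⁻¹ * y⁻¹ - 1) ^ 2) =
      cf ε (x + x⁻¹) (y + y⁻¹) := by
  have h1 : x - y ≠ 0 := sub_ne_zero.2 h
  have h2 : x * y - 1 ≠ 0 := sub_ne_zero.2 h'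
  have h2' : y * x - 1 ≠ 0 := mul_comm x y ▸ h2
  rw [cf, show x * y⁻¹ - 1 = (x - y) / y by field_simp,
    show x⁻¹ * y⁻¹ - 1 = -(x * y - 1) / (x * y) by field_simp; ring, add_inv_sub_add_inv hx hy]
  congr 2
  field_simp
  ring

/-- The identity component of `Ξ² = ε Ξ + 1 - c`. -/
lemma quad_rational (hx : x ≠ 0) (hy : y ≠ 0) (h : x ≠ y) (h' : x * y ≠ 1) :
    pf ε x y ^ 2 + rf ε x y * (ε + rf ε x y) = ε * pf ε x y + 1 - cf ε (x + x⁻¹) (y + y⁻¹) := by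
  have h1 : x - y ≠ 0 := sub_ne_zero.2 h
  have h2 : x * y - 1 ≠ 0 := sub_ne_zero.2 h'
  have h2' : y * x - 1 ≠ 0 := mul_comm x y ▸ h2
  rw [cf, pf_eq _ hy, rf, add_inv_sub_add_inv hx hy]
  field_simp
  ring

lemma pf_swap (hx : x ≠ 0) (hy : y ≠ 0) (h : x ≠ y) : pf ε y x = ε - pf ε x y :=
  eq_sub_of_add_eq' (pf_add_swap ε hx hy h)

section Triple

variable (hx : x ≠ 0) (hy : y ≠ 0) (hz : z ≠ 0) (hxy : x ≠ y) (hxy' : x * y ≠ 1)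
  (hyz : y ≠ z) (hyz' : y * z ≠ 1) (hxz : x ≠ z) (hxz' : x * z ≠ 1)

include hx hy hz hxy hxy' hyz hyz' in
/-- The coefficient of the identity in the difference `Ξ_{ab} Ξ_{bc} Ξ_{ab} - Ξ_{bc} Ξ_{ab} Ξ_{bc}`,
where `x`, `y`, `z` are the eigenvalues of `X_a`, `X_b`, `X_c`. -/
lemma braid_rational_one :
    pf ε x y ^ 2 * pf ε y z + rf ε x y * (ε + rf ε y z) * (ε + rf ε x y)
      - (pf ε y z ^ 2 * pf ε x y - rf ε x y * rf ε y z * (ε + rf ε y z)) =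
      ε * (z - x⁻¹) * gf ε (x + x⁻¹) (y + y⁻¹) (z + z⁻¹) /
        ((x + x⁻¹ - (y + y⁻¹)) ^ 2 * (y + y⁻¹ - (z + z⁻¹)) ^ 2) := by
  have h1 : x - y ≠ 0 := sub_ne_zero.2 hxy
  have h2 : x * y - 1 ≠ 0 := sub_ne_zero.2 hxy'
  have h2' : y * x - 1 ≠ 0 := mul_comm x y ▸ h2
  have h3 : y - z ≠ 0 := sub_ne_zero.2 hyz
  have h4 : y * z - 1 ≠ 0 := sub_ne_zero.2 hyz'
  have h4' : z * y - 1 ≠ 0 := mul_comm y z ▸ h4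
  rw [add_inv_sub_add_inv hx hy, add_inv_sub_add_inv hy hz, pf_eq _ hy, pf_eq _ hz, rf, rf, gf]
  field_simp
  ring

include hx hy hz hxy hxy' hyz hyz' in
/-- The coefficient of `C_a C_c` in `Ξ_{ab} Ξ_{bc} Ξ_{ab} - Ξ_{bc} Ξ_{ab} Ξ_{bc}`. -/
lemma braid_rational_AC :
    pf ε x y * rf ε y z * pf ε x y - rf ε x y * (ε - pf ε y z) * (ε + rf ε x y)
      - (-(pf ε y z * rf ε x y * (ε - pf ε y z)) - rf ε y z * pf ε x y * rf ε y z) =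
      ε * (x⁻¹ - z⁻¹) * gf ε (x + x⁻¹) (y + y⁻¹) (z + z⁻¹) /
        ((x + x⁻¹ - (y + y⁻¹)) ^ 2 * (y + y⁻¹ - (z + z⁻¹)) ^ 2) := by
  have h1 : x - y ≠ 0 := sub_ne_zero.2 hxy
  have h2 : x * y - 1 ≠ 0 := sub_ne_zero.2 hxy'
  have h2' : y * x - 1 ≠ 0 := mul_comm x y ▸ h2
  have h3 : y - z ≠ 0 := sub_ne_zero.2 hyz
  have h4 : y * z - 1 ≠ 0 := sub_ne_zero.2 hyz'
  have h4' : z * y - 1 ≠ 0 := mul_comm y z ▸ h4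
  rw [add_inv_sub_add_inv hx hy, add_inv_sub_add_inv hy hz, pf_eq _ hy, pf_eq _ hz, rf, rf, gf]
  field_simp
  ring

include hy hz hxy hxy' hyz hyz' in
/-- The coefficients of `C_a C_b` in `Ξ_{ab} Ξ_{bc} Ξ_{ab}` and `Ξ_{bc} Ξ_{ab} Ξ_{bc}` agree. -/
lemma braid_rational_AB :
    pf ε x y * pf ε y z * rf ε x y + rf ε x y * (ε + rf ε y z) * (ε - pf ε x y)
      = pf ε y z * rf ε x y * (ε + rf ε y z) + rf ε y z * pf ε x y * pf ε y z := by
  have h1 : x - y ≠ 0 := sub_ne_zero.2 hxy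
  have h2 : x * y - 1 ≠ 0 := sub_ne_zero.2 hxy'
  have h2' : y * x - 1 ≠ 0 := mul_comm x y ▸ h2
  have h3 : y - z ≠ 0 := sub_ne_zero.2 hyz
  have h4 : y * z - 1 ≠ 0 := sub_ne_zero.2 hyz'
  have h4' : z * y - 1 ≠ 0 := mul_comm y z ▸ h4
  rw [pf_eq _ hy, pf_eq _ hz, rf, rf]
  field_simp
  ring

include hy hz hxy hxy' hyz hyz' in
/-- The coefficients of `C_b C_c` in `Ξ_{ab} Ξ_{bc} Ξ_{ab}` and `Ξ_{bc} Ξ_{ab} Ξ_{bc}` agree. -/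
lemma braid_rational_BC :
    -(pf ε x y * rf ε y z * rf ε x y) + rf ε x y * (ε - pf ε y z) * (ε - pf ε x y)
      = pf ε y z * pf ε x y * rf ε y z - rf ε y z * rf ε x y * (ε - pf ε y z) := by
  have h1 : x - y ≠ 0 := sub_ne_zero.2 hxy
  have h2 : x * y - 1 ≠ 0 := sub_ne_zero.2 hxy'
  have h2' : y * x - 1 ≠ 0 := mul_comm x y ▸ h2
  have h3 : y - z ≠ 0 := sub_ne_zero.2 hyz
  have h4 : y * z - 1 ≠ 0 := sub_ne_zero.2 hyz'
  have h4' : z * y - 1 ≠ 0 := mul_comm y z ▸ h4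
  rw [pf_eq _ hy, pf_eq _ hz, rf, rf]
  field_simp
  ring

include hy hz hxy hyz hxz in
/-- The coefficients of the identity in `Ξ_{ab} Ξ_{bc} + Ξ_{ac} Ξ_{ba} = Ξ_{bc} Ξ_{ac}`. -/
lemma yb_rational_one :
    pf ε x y * pf ε y z + pf ε x z * (ε - pf ε x y) = pf ε y z * pf ε x z := by
  have h1 : x - y ≠ 0 := sub_ne_zero.2 hxy
  have h3 : y - z ≠ 0 := sub_ne_zero.2 hyz
  have h5 : x - z ≠ 0 := sub_ne_zero.2 hxz
  rw [pf_eq _ hy, pf_eq _ hz, pf_eq _ hz]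
  field_simp
  ring

include hz hxy' hyz' hxz in
/-- The coefficients of `C_a C_b` in `Ξ_{ab} Ξ_{bc} + Ξ_{ac} Ξ_{ba} = Ξ_{bc} Ξ_{ac}`. -/
lemma yb_rational_AB :
    rf ε x y * (ε + rf ε y z) - pf ε x z * rf ε x y = -(rf ε y z * pf ε x z) := by
  have h2 : x * y - 1 ≠ 0 := sub_ne_zero.2 hxy'
  have h2' : y * x - 1 ≠ 0 := mul_comm x y ▸ h2
  have h4 : y * z - 1 ≠ 0 := sub_ne_zero.2 hyz'
  have h4' : z * y - 1 ≠ 0 := mul_comm y z ▸ h4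
  have h5 : x - z ≠ 0 := sub_ne_zero.2 hxz
  rw [pf_eq _ hz, rf, rf]
  field_simp
  ring

include hy hxy hyz' hxz' in
/-- The coefficients of `C_b C_c` in `Ξ_{ab} Ξ_{bc} + Ξ_{ac} Ξ_{ba} = Ξ_{bc} Ξ_{ac}`. -/
lemma yb_rational_BC :
    pf ε x y * rf ε y z + rf ε x z * (ε - pf ε x y) = -(rf ε y z * rf ε x z) := by
  have h1 : x - y ≠ 0 := sub_ne_zero.2 hxy
  have h4 : y * z - 1 ≠ 0 := sub_ne_zero.2 hyz'
  have h4' : z * y - 1 ≠ 0 := mul_comm y z ▸ h4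
  have h6 : x * z - 1 ≠ 0 := sub_ne_zero.2 hxz'
  have h6' : z * x - 1 ≠ 0 := mul_comm x z ▸ h6
  rw [pf_eq _ hy, rf, rf]
  field_simp
  ring

include hz hxy' hyz hxz' in
/-- The coefficients of `C_a C_c` in `Ξ_{ab} Ξ_{bc} + Ξ_{ac} Ξ_{ba} = Ξ_{bc} Ξ_{ac}`. -/
lemma yb_rational_AC :
    -(rf ε x y * (ε - pf ε y z)) - rf ε x z * rf ε x y = pf ε y z * rf ε x z := by
  have h2 : x * y - 1 ≠ 0 := sub_ne_zero.2 hxy'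
  have h2' : y * x - 1 ≠ 0 := mul_comm x y ▸ h2
  have h3 : y - z ≠ 0 := sub_ne_zero.2 hyz
  have h6 : x * z - 1 ≠ 0 := sub_ne_zero.2 hxz'
  have h6' : z * x - 1 ≠ 0 := mul_comm x z ▸ h6
  rw [pf_eq _ hz, rf, rf]
  field_simp
  ring

end Triple

end Rational

/-! ### Relations between the operators `Ξ` -/

section XiRelations

variable {K : Type*} [Field K] {n : ℕ} {ε : K} {x : Fin n → Tens K n} {u : Fin n → K}

namespace IsEig

lemma ne_of_ne (hx : IsEig x u) {a b : Fin n} (h : u a ≠ u b) (β) : x a β ≠ x b β := by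
  intro h'
  apply h
  rw [← hx.add_inv a β, ← hx.add_inv b β, h']

lemma mul_ne_one_of_ne (hx : IsEig x u) {a b : Fin n} (h : u a ≠ u b) (β) :
    x a β * x b β ≠ 1 := by
  intro h'
  apply h
  rw [← hx.add_inv a β, ← hx.add_inv b β, eq_inv_of_mul_eq_one_left h', inv_inv, add_comm]

end IsEig

lemma cl_cl_mul (a b : Fin n) (φ f : Tens K n) :
    cl a (cl b (φ * f)) = (fun β => φ (β + e a + e b)) * cl a (cl b f) := by
  rw [cl_mul, cl_mul]

/-- The mixed term of the quadratic relation: `T_i` uses `Ξ_{ab}` at `t` and `Ξ_{ba}` at `s_i t`. -/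
lemma Xi_add_swap (hx : IsEig x u) {a b : Fin n} (h : u a ≠ u b) (f : Tens K n) :
    Xi ε x a b f + Xi ε x b a f = ε • f := by
  ext β
  have h1 := pf_add_swap ε (hx.ne_zero a β) (hx.ne_zero b β) (hx.ne_of_ne h β)
  have h2 := cl_anticomm (ne_of_apply_ne u h) f
  simp only [Pi.add_apply, Xi_apply_apply, Pi.smul_apply, smul_eq_mul]
  rw [h2, Pi.neg_apply, rf_comm ε (x := x b β)]
  linear_combination f β * h1

/-- The diagonal term of the quadratic relation; the defect `c` is made up by `Ω²`. -/
lemma Xi_sq (hx : IsEig x u) {a b : Fin n} (h : u a ≠ u b) (f : Tens K n) :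
    Xi ε x a b (Xi ε x a b f) = ε • Xi ε x a b f + (1 - cf ε (u a) (u b)) • f := by
  have hab := ne_of_apply_ne u h
  have h3 : cl a (cl b (cl a (cl b f))) = -f := by
    rw [cl_anticomm hab (cl a _), cl_cl_self, cl_cl_self]
  ext β
  have h0 := hx.ne_of_ne h β
  have h0' := hx.mul_ne_one_of_ne h β
  have h1 := pf_add_swap ε (hx.ne_zero a β) (hx.ne_zero b β) h0
  have h2 := quad_rational ε (hx.ne_zero a β) (hx.ne_zero b β) h0 h0'
  rw [hx.add_inv, hx.add_inv] at h2
  rw [Xi_apply_apply]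
  conv_lhs => rw [Xi_apply, map_add, map_add, cl_cl_mul, cl_cl_mul, h3]
  simp only [Pi.add_apply, Pi.mul_apply, Xi_apply_apply, Pi.smul_apply, smul_eq_mul,
    Pi.neg_apply, hx.flip, hx.const _ _ _ hab, hx.const _ _ _ hab.symm,
    pf_inv_inv ε, rf_inv_inv ε (hx.ne_zero a β) (hx.ne_zero b β) h0']
  linear_combination (f β) * h2 + rf ε (x a β) (x b β) * cl a (cl b f) β * h1

section Three

variable {a b c : Fin n}

lemma word_sq (hab : a ≠ b) (f : Tens K n) : cl a (cl b (cl a (cl b f))) = -f := by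
  rw [cl_anticomm hab (cl a _), cl_cl_self, cl_cl_self]

lemma word_ac_ab (hbc : b ≠ c) (hac : a ≠ c) (f : Tens K n) :
    cl a (cl c (cl a (cl b f))) = cl b (cl c f) := by
  rw [cl_anticomm hac.symm, map_neg, cl_cl_self, cl_anticomm hbc.symm, neg_neg]

lemma word_ab_ac (hab : a ≠ b) (f : Tens K n) :
    cl a (cl b (cl a (cl c f))) = -cl b (cl c f) := by
  rw [cl_anticomm hab, cl_cl_self]

lemma word_bc_ac (hab : a ≠ b) (hac : a ≠ c) (f : Tens K n) :
    cl b (cl c (cl a (cl c f))) = cl a (cl b f) := by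
  rw [cl_anticomm hac, map_neg, cl_cl_self, map_neg, cl_anticomm hab.symm, neg_neg]

lemma word_bc_ab (hab : a ≠ b) (hbc : b ≠ c) (hac : a ≠ c) (f : Tens K n) :
    cl b (cl c (cl a (cl b f))) = -cl a (cl c f) := by
  rw [cl_anticomm hab, map_neg, cl_anticomm hbc.symm, neg_neg, cl_cl_self, cl_anticomm hac.symm]

/-- The relation between the coefficients of a simple reflection in the braid relation. -/
lemma Xi_yangBaxter (hx : IsEig x u) (h1 : u a ≠ u b) (h2 : u b ≠ u c) (h3 : u a ≠ u c)
    (f : Tens K n) :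
    Xi ε x a b (Xi ε x b c f) + Xi ε x a c (Xi ε x b a f) = Xi ε x b c (Xi ε x a c f) := by
  have hab := ne_of_apply_ne u h1
  have hbc := ne_of_apply_ne u h2
  have hac := ne_of_apply_ne u h3
  ext β
  have ha0 := hx.ne_zero a β
  have hb0 := hx.ne_zero b β
  have hc0 := hx.ne_zero c β
  have hxy := hx.ne_of_ne h1 β
  have hxy' := hx.mul_ne_one_of_ne h1 β
  have hyz := hx.ne_of_ne h2 β
  have hyz' := hx.mul_ne_one_of_ne h2 β
  have hxz := hx.ne_of_ne h3 β
  have hxz' := hx.mul_ne_one_of_ne h3 β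
  have e1 := yb_rational_one ε hb0 hc0 hxy hyz hxz
  have e2 := yb_rational_AB ε hc0 hxy' hyz' hxz
  have e3 := yb_rational_BC ε hb0 hxy hyz' hxz'
  have e4 := yb_rational_AC ε hc0 hxy' hyz hxz'
  simp only [Pi.add_apply, Xi_apply_apply]
  simp only [Xi_apply, map_add, cl_cl_mul]
  rw [cl_cl_self, cl_anticomm hab.symm, map_neg, map_neg, word_ac_ab hbc hac, word_bc_ac hab hac]
  simp only [Pi.add_apply, Pi.mul_apply, Pi.neg_apply, hx.flip, hx.const _ _ _ hab,
    hx.const _ _ _ hab.symm, hx.const _ _ _ hbc, hx.const _ _ _ hbc.symm, hx.const _ _ _ hac,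
    hx.const _ _ _ hac.symm, pf_inv_left ε hb0 hc0 hyz', rf_inv_left, pf_inv_right,
    rf_inv_right, pf_swap ε ha0 hb0 hxy, pf_swap ε hb0 hc0 hyz, rf_comm ε (x := x b β) (y := x a β)]
  linear_combination f β * e1 + cl a (cl b f) β * e2 + cl b (cl c f) β * e3 + cl a (cl c f) β * e4

/-- The difference of the two sides of the braid relation for the operators `Ξ`. It has no
denominator that vanishes for `u a = u c`. -/
lemma Xi_braid (hx : IsEig x u) (h1 : u a ≠ u b) (h2 : u b ≠ u c) (hac : a ≠ c)
    (f : Tens K n) (β : Fin n → ZMod 2) :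
    Xi ε x a b (Xi ε x b c (Xi ε x a b f)) β - Xi ε x b c (Xi ε x a b (Xi ε x b c f)) β =
      ε * (x c β - (x a β)⁻¹) * gf ε (u a) (u b) (u c) /
        ((u a - u b) ^ 2 * (u b - u c) ^ 2) * f β +
      ε * ((x a β)⁻¹ - (x c β)⁻¹) * gf ε (u a) (u b) (u c) /
        ((u a - u b) ^ 2 * (u b - u c) ^ 2) * cl a (cl c f) β := by
  have hab := ne_of_apply_ne u h1
  have hbc := ne_of_apply_ne u h2
  have ha0 := hx.ne_zero a β
  have hb0 := hx.ne_zero b β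
  have hc0 := hx.ne_zero c β
  have hxy := hx.ne_of_ne h1 β
  have hxy' := hx.mul_ne_one_of_ne h1 β
  have hyz := hx.ne_of_ne h2 β
  have hyz' := hx.mul_ne_one_of_ne h2 β
  have e1 := braid_rational_one ε ha0 hb0 hc0 hxy hxy' hyz hyz'
  have e2 := braid_rational_AB ε hb0 hc0 hxy hxy' hyz hyz'
  have e3 := braid_rational_BC ε hb0 hc0 hxy hxy' hyz hyz'
  have e4 := braid_rational_AC ε ha0 hb0 hc0 hxy hxy' hyz hyz'
  simp only [hx.add_inv] at e1 e4
  rw [← e1, ← e4]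
  simp only [Xi_apply_apply]
  simp only [Xi_apply, map_add, cl_cl_mul, mul_add]
  simp only [cl_cl_self, word_sq hab, word_sq hbc, word_bc_ab hab hbc hac, word_ab_ac hab,
    word_bc_ac hab hac, map_neg]
  simp only [Pi.add_apply, Pi.mul_apply, Pi.neg_apply, hx.flip, hx.const _ _ _ hab,
    hx.const _ _ _ hab.symm, hx.const _ _ _ hbc, hx.const _ _ _ hbc.symm, hx.const _ _ _ hac,
    hx.const _ _ _ hac.symm, inv_inv, pf_inv_left ε hb0 hc0 hyz',
    pf_inv_left ε ha0 hb0 hxy', rf_inv_left, pf_inv_right, rf_inv_right, pf_swap ε ha0 hb0 hxy,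
    pf_swap ε hb0 hc0 hyz]
  linear_combination cl a (cl b f) β * e2 + cl b (cl c f) β * e3

/-- The relation between the coefficients of the identity in the braid relation. -/
lemma Xi_braid_of_ne (hx : IsEig x u) (h1 : u a ≠ u b) (h2 : u b ≠ u c) (h3 : u a ≠ u c)
    (f : Tens K n) :
    Xi ε x a b (Xi ε x b c (Xi ε x a b f)) + cf ε (u a) (u b) • Xi ε x a c f =
      Xi ε x b c (Xi ε x a b (Xi ε x b c f)) + cf ε (u b) (u c) • Xi ε x a c f := by
  have hac := ne_of_apply_ne u h3
  ext β
  have h := Xi_braid (ε := ε) hx h1 h2 hac f β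
  have ha0 := hx.ne_zero a β
  have hc0 := hx.ne_zero c β
  have hxz := sub_ne_zero.2 (hx.ne_of_ne h3 β)
  have hxz' := sub_ne_zero.2 (hx.mul_ne_one_of_ne h3 β)
  have hxz'' := mul_comm (x a β) (x c β) ▸ hxz'
  have h1' := sub_ne_zero.2 h1
  have h2' := sub_ne_zero.2 h2
  have hc : cf ε (u b) (u c) - cf ε (u a) (u b) = (u c - u a) * gf ε (u a) (u b) (u c) /
        ((u a - u b) ^ 2 * (u b - u c) ^ 2) := by
    rw [cf, cf, gf]
    field_simp
    ring
  have hu : u c - u a = (x c β - x a β) * (x c β * x a β - 1) / (x c β * x a β) := by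
    rw [← hx.add_inv c β, ← hx.add_inv a β, add_inv_sub_add_inv hc0 ha0]
  have k1 : (u c - u a) * pf ε (x a β) (x c β) = ε * (x c β - (x a β)⁻¹) := by
    rw [hu, pf_eq _ hc0]
    field_simp
    ring
  have k2 : (u c - u a) * rf ε (x a β) (x c β) = ε * ((x a β)⁻¹ - (x c β)⁻¹) := by
    rw [hu, rf]
    field_simp
  rw [← k1, ← k2] at h
  simp only [Pi.add_apply, Pi.smul_apply, smul_eq_mul]
  rw [Xi_apply_apply _ _ a c]
  linear_combination h - hc * (pf ε (x a β) (x c β) * f β + rf ε (x a β) (x c β) * cl a (cl c f) β)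

/-- The operators `Ξ` themselves satisfy the braid relation if `G` vanishes, or if `X_a` and `X_c`
are the same scalar `±1`. Both can occur with `u a = u c`. -/
lemma Xi_braid_of_gf (hx : IsEig x u) (h1 : u a ≠ u b) (h2 : u b ≠ u c) (hac : a ≠ c)
    (h : gf ε (u a) (u b) (u c) = 0 ∨ ∀ β, x a β = (x a β)⁻¹ ∧ x c β = x a β)
    (f : Tens K n) :
    Xi ε x a b (Xi ε x b c (Xi ε x a b f)) = Xi ε x b c (Xi ε x a b (Xi ε x b c f)) := by
  ext β
  rw [← sub_eq_zero, Xi_braid hx h1 h2 hac]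
  rcases h with h | h
  · simp [h]
  · obtain ⟨h, h'⟩ := h β
    rw [h', ← h]
    simp

end Three

end XiRelations

end HeckeClifford

namespace HeckeClifford

/-! ### Relations of `Ξ` with the generators `X` and `C` -/

section XiMixed

variable {K : Type*} [Field K] {n : ℕ} {ε : K} {x : Fin n → Tens K n} {u : Fin n → K}

lemma IsEig.inv_comp (hx : IsEig x u) (a : Fin n) (f : Tens K n) :
    cl a (x a * f) = (x a)⁻¹ * cl a f := by
  rw [cl_mul]
  simp only [hx.flip]
  rfl

lemma IsEig.comp_of_ne (hx : IsEig x u) {a b : Fin n} (h : b ≠ a) (f : Tens K n) :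
    cl a (x b * f) = x b * cl a f := by
  rw [cl_mul]
  simp only [hx.const _ _ _ h]

lemma Xi_X (hx : IsEig x u) {a b : Fin n} (h : u a ≠ u b) (f : Tens K n) :
    Xi ε x a b (x a * f) =
      x b * Xi ε x a b f - ε • (x b * f + cl a (cl b (x a * f))) := by
  have hab := ne_of_apply_ne u h
  ext β
  have ha0 := hx.ne_zero a β
  have hb0 := hx.ne_zero b β
  have hxy := sub_ne_zero.2 (hx.ne_of_ne h β)
  have hxy' := sub_ne_zero.2 (hx.mul_ne_one_of_ne h β)
  have hxy'' := mul_comm (x a β) (x b β) ▸ hxy'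
  simp only [Pi.sub_apply, Pi.mul_apply, Pi.smul_apply, Pi.add_apply, Xi_apply_apply, smul_eq_mul,
    hx.comp_of_ne hab, hx.inv_comp, Pi.inv_apply, pf_eq _ hb0, rf]
  field_simp
  ring

lemma Xi_X_succ (hx : IsEig x u) {a b : Fin n} (h : u a ≠ u b) (f : Tens K n) :
    Xi ε x a b (x b * f) =
      x a * Xi ε x a b f + ε • (x b * f - cl a (cl b (x b * f))) := by
  have hab := ne_of_apply_ne u h
  ext β
  have ha0 := hx.ne_zero a β
  have hb0 := hx.ne_zero b β
  have hxy := sub_ne_zero.2 (hx.ne_of_ne h β)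
  have hxy' := sub_ne_zero.2 (hx.mul_ne_one_of_ne h β)
  have hxy'' := mul_comm (x a β) (x b β) ▸ hxy'
  have h1 : cl a ((x b)⁻¹ * cl b f) = (x b)⁻¹ * cl a (cl b f) := by
    rw [cl_mul]
    simp only [Pi.inv_apply, hx.const _ _ _ hab.symm]
    rfl
  simp only [Pi.sub_apply, Pi.mul_apply, Pi.smul_apply, Pi.add_apply, Xi_apply_apply, smul_eq_mul,
    hx.inv_comp, h1, Pi.inv_apply, pf_eq _ hb0, rf]
  field_simp
  ring

lemma Xi_X_far (hx : IsEig x u) {a b c : Fin n} (ha : c ≠ a) (hb : c ≠ b) (f : Tens K n) :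
    Xi ε x a b (x c * f) = x c * Xi ε x a b f := by
  simp only [Xi_apply, hx.comp_of_ne ha, hx.comp_of_ne hb]
  ring

lemma Xi_cl (hx : IsEig x u) {a b : Fin n} (hab : a ≠ b) (f : Tens K n) :
    Xi ε x a b (cl a f) = cl b (Xi ε x a b f) := by
  ext β
  simp only [Xi_apply_apply]
  simp only [Xi_apply, map_add, cl_mul, hx.flip, hx.const _ _ _ hab,
    pf_inv_right, rf_inv_right]
  rw [cl_anticomm hab.symm f, cl_anticomm hab.symm (cl b f), map_neg, cl_cl_self, cl_cl_self]
  simp only [Pi.add_apply, Pi.mul_apply, Pi.neg_apply]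
  ring

lemma Xi_cl_succ (hx : IsEig x u) {a b : Fin n} (h : u a ≠ u b) (f : Tens K n) :
    Xi ε x a b (cl b f) = cl a (Xi ε x a b f) - ε • (cl a f - cl b f) := by
  have hab := ne_of_apply_ne u h
  ext β
  simp only [Xi_apply_apply, Pi.sub_apply, Pi.smul_apply]
  simp only [Xi_apply, map_add, cl_mul, hx.flip, hx.const _ _ _ hab.symm, rf_inv_left]
  rw [cl_cl_self, cl_cl_self]
  simp only [Pi.add_apply, Pi.mul_apply, smul_eq_mul,
    pf_inv_left ε (hx.ne_zero a β) (hx.ne_zero b β) (hx.mul_ne_one_of_ne h β),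
    pf_swap ε (hx.ne_zero a β) (hx.ne_zero b β) (hx.ne_of_ne h β)]
  ring

lemma cl_cl_comm {a b c : Fin n} (ha : c ≠ a) (hb : c ≠ b) (f : Tens K n) :
    cl a (cl b (cl c f)) = cl c (cl a (cl b f)) := by
  rw [cl_anticomm hb.symm, map_neg, cl_anticomm ha.symm, neg_neg]

lemma Xi_cl_far (hx : IsEig x u) {a b c : Fin n} (ha : c ≠ a) (hb : c ≠ b) (f : Tens K n) :
    Xi ε x a b (cl c f) = cl c (Xi ε x a b f) := by
  simp only [Xi_apply, map_add, cl_mul, hx.const _ _ _ ha.symm, hx.const _ _ _ hb.symm,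
    cl_cl_comm ha hb]

lemma Xi_comm (hx : IsEig x u) {a b c d : Fin n} (hac : a ≠ c) (had : a ≠ d) (hbc : b ≠ c)
    (hbd : b ≠ d) (f : Tens K n) :
    Xi ε x a b (Xi ε x c d f) = Xi ε x c d (Xi ε x a b f) := by
  have h (φ : Tens K n) (hφ : ∀ β, φ (β + e c) = φ β) (hφ' : ∀ β, φ (β + e d) = φ β)
      (g : Tens K n) : Xi ε x c d (φ * g) = φ * Xi ε x c d g := by
    simp only [Xi_apply, cl_cl_mul, hφ, hφ']
    ring
  rw [Xi_apply _ _ a b f, map_add, h, h, Xi_apply _ _ a b, Xi_cl_far hx hac had,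
    Xi_cl_far hx hbc hbd]
  all_goals
    intro β
    simp only [hx.const _ _ _ hac, hx.const _ _ _ had, hx.const _ _ _ hbc, hx.const _ _ _ hbd]

end XiMixed

end HeckeClifford

namespace HeckeClifford

/-! ### Diagrams as order ideals of boxes -/

section Diagrams

variable {k : Kind} {m n : ℕ}

/-- The box is allowed in a (shifted) Young diagram: in a strict component it lies on or above the
diagonal. -/
def Box.Valid (b : Box k m) : Prop := b.IsStrict → b.row ≤ b.col

/-- `a` lies weakly to the north-west of `b` in the same component. -/
def Box.Below (a b : Box k m) : Prop := a.comp = b.comp ∧ a.row ≤ b.row ∧ a.col ≤ b.col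

/-- A set of boxes of a multipartition, i.e. an order ideal of the set of valid boxes. -/
def IsDiagram (F : Finset (Box k m)) : Prop :=
  ∀ b ∈ F, b.Valid ∧ ∀ a : Box k m, a.Valid → a.Below b → a ∈ F

lemma Box.ext_iff' {a b : Box k m} :
    a = b ↔ a.comp = b.comp ∧ a.row = b.row ∧ a.col = b.col := by
  cases a; cases b; simp

lemma Box.Below.antisymm {a b : Box k m} (h : a.Below b) (h' : b.Below a) : a = b :=
  Box.ext_iff'.2 ⟨h.1, le_antisymm h.2.1 h'.2.1, le_antisymm h.2.2 h'.2.2⟩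

lemma Box.Below.refl (a : Box k m) : a.Below a := ⟨rfl, le_rfl, le_rfl⟩

lemma Box.Below.trans {a b c : Box k m} (h : a.Below b) (h' : b.Below c) : a.Below c :=
  ⟨h.1.trans h'.1, h.2.1.trans h'.2.1, h.2.2.trans h'.2.2⟩

lemma Box.lt_iff {a b : Box k m} : a < b ↔ a.comp < b.comp ∨
    a.comp = b.comp ∧ (a.row < b.row ∨ a.row = b.row ∧ a.col < b.col) := by
  change toLex (a.comp, toLex (a.row, a.col)) < toLex (b.comp, toLex (b.row, b.col)) ↔ _
  simp only [Prod.Lex.toLex_lt_toLex]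

lemma Box.Below.lt {a b : Box k m} (h : a.Below b) (hne : a ≠ b) : a < b := by
  obtain ⟨h1, h2, h3⟩ := h
  rw [Ne, Box.ext_iff'] at hne
  rw [Box.lt_iff]
  omega

/-- Closure under single steps to the left and upwards gives closure under `Below`: one moves up
first, which cannot cross the diagonal, and then to the left. -/
lemma Shape.isDiagram (lam : Shape k m n) : IsDiagram lam.cells := by
  rintro ⟨l, i, j⟩ hb
  refine ⟨lam.shifted _ hb, ?_⟩
  rintro ⟨l', i', j'⟩ hv ⟨h1, h2, h3⟩
  dsimp only at h1 h2 h3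
  subst h1
  have up : ∀ d i, (⟨l', i + d, j⟩ : Box k m) ∈ lam.cells → (⟨l', i, j⟩ : Box k m) ∈ lam.cells := by
    intro d
    induction d with
    | zero => intro i h; exact h
    | succ d ih => intro i h; exact ih i (lam.up_closed _ _ _ h)
  have left : ∀ d j, ((l' : ℕ) < k.numStrict → i' ≤ j) → (⟨l', i', j + d⟩ : Box k m) ∈ lam.cells →
      (⟨l', i', j⟩ : Box k m) ∈ lam.cells := by
    intro d
    induction d with
    | zero => intro j _ h; exact h
    | succ d ih =>
      intro j hj h
      exact ih j hj (lam.left_closed _ _ _ h fun hl => (hj hl).trans (by omega))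
  obtain ⟨d, rfl⟩ := Nat.exists_eq_add_of_le h2
  obtain ⟨d', rfl⟩ := Nat.exists_eq_add_of_le h3
  exact left d' j' hv (up d i' hb)

/-- The multipartition with a given diagram. -/
def IsDiagram.toShape {F : Finset (Box k m)} (h : IsDiagram F) (hn : F.card = n) :
    Shape k m n where
  cells := F
  shifted b hb := (h b hb).1
  left_closed _ _ _ hb hv := (h _ hb).2 _ hv ⟨rfl, le_rfl, Nat.le_succ _⟩
  up_closed _ _ _ hb := (h _ hb).2 _ (fun hl => (Nat.le_succ _).trans ((h _ hb).1 hl))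
    ⟨rfl, Nat.le_succ _, le_rfl⟩
  card_cells := hn

/-- Boxes can be added to a nonempty diagram, at the end of a first row. -/
lemma IsDiagram.exists_extension {F : Finset (Box k m)} (h : IsDiagram F) (hne : F.Nonempty)
    (d : ℕ) : ∃ D : Finset (Box k m), IsDiagram D ∧ F ⊆ D ∧ D.card = F.card + d := by
  induction d with
  | zero => exact ⟨F, h, subset_rfl, rfl⟩
  | succ d ih =>
    obtain ⟨D, hD, hFD, hcard⟩ := ih
    obtain ⟨b, hb⟩ := hne
    have hinj : Function.Injective fun j : ℕ => (⟨b.comp, 0, j⟩ : Box k m) := fun i j hij => by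
      simpa using hij
    obtain ⟨j, hj⟩ : ∃ j, (⟨b.comp, 0, j⟩ : Box k m) ∉ D := by
      by_contra! hall
      exact Set.infinite_of_injective_forall_mem hinj hall D.finite_toSet
    classical
    have hex : ∃ j, (⟨b.comp, 0, j⟩ : Box k m) ∉ D := ⟨j, hj⟩
    refine ⟨insert ⟨b.comp, 0, Nat.find hex⟩ D, ?_, hFD.trans (Finset.subset_insert _ _), ?_⟩
    · intro c hc
      rw [Finset.mem_insert] at hc
      rcases hc with rfl | hc
      · refine ⟨fun _ => Nat.zero_le _, ?_⟩
        rintro ⟨l, r, s⟩ _ ⟨h1, h2, h3⟩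
        dsimp only at h1 h2 h3
        subst h1
        obtain rfl : r = 0 := by omega
        rw [Finset.mem_insert]
        rcases h3.lt_or_eq with h3 | h3
        · exact Or.inr (not_not.1 (Nat.find_min hex h3))
        · exact Or.inl (by rw [h3])
      · exact ⟨(hD c hc).1, fun a ha hac => Finset.mem_insert_of_mem ((hD c hc).2 a ha hac)⟩
    · rw [Finset.card_insert_of_notMem (Nat.find_spec hex), hcard, add_assoc]

/-- Numbering the boxes in the order of an injective key. -/
lemma exists_equiv_of_key {α : Type*} [LinearOrder α] (lam : Shape k m n) (κ : lam.cells → α)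
    (hκ : Function.Injective κ) : ∃ t : lam.cells ≃ Fin n, ∀ a b, t a < t b ↔ κ a < κ b := by
  classical
  let f := Equiv.ofInjective κ hκ
  let o := Fintype.orderIsoFinOfCardEq (Set.range κ) (k := n)
    ((Fintype.card_congr f).symm.trans (by simp [lam.card_cells]))
  exact ⟨f.trans o.symm.toEquiv, fun a b => o.symm.lt_iff_lt⟩

lemma below_of_line {a b : Box k m} (h : a.comp = b.comp)
    (h' : a.row = b.row ∧ a.col < b.col ∨ a.col = b.col ∧ a.row < b.row) : a.Below b ∧ a ≠ b := by
  refine ⟨⟨h, ?_, ?_⟩, fun hab => ?_⟩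
  · omega
  · omega
  · subst hab; omega

variable {K : Type*} [Field K] (P : Params K m)

/-- The separate condition for two boxes that are added successively to a diagram. -/
lemma qf_ne_of_chain {M : ℕ} (hsep : ∀ mu : Shape k m M, P.IsSeparate mu)
    {E F : Finset (Box k m)} {U V : Box k m} (hE : IsDiagram E) (hF : IsDiagram F)
    (hEU : ∀ b ∈ F, b ∈ E ∨ b = U ∨ b = V) (hUF : U ∈ F) (hVF : V ∈ F)
    (hU : U ∉ E) (hV : V ∉ E) (hUV : U ≠ V) (hVU : ¬ V.Below U) (hM : F.card ≤ M) :
    P.qf (P.boxRes U) ≠ P.qf (P.boxRes V) := by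
  classical
  obtain ⟨D, hD, hFD, hcard⟩ := hF.exists_extension ⟨U, hUF⟩ (M - F.card)
  rw [Nat.add_sub_cancel' hM] at hcard
  let mu := hD.toShape hcard
  let cls : Box k m → ℕ := fun b => if b ∈ E then 0 else if b = U then 1 else if b = V then 2 else 3
  have cU : cls U = 1 := by simp [cls, hU]
  have cV : cls V = 2 := by simp [cls, hV, hUV.symm]
  have c1 : ∀ b, cls b = 1 → b = U := by
    intro b hb; simp only [cls] at hb; split_ifs at hb <;> simp_all
  have c2 : ∀ b, cls b = 2 → b = V := by
    intro b hb; simp only [cls] at hb; split_ifs at hb <;> simp_all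
  let κ : mu.cells → ℕ ×ₗ Box k m := fun b => toLex (cls b.1, b.1)
  have hκ : Function.Injective κ := by
    intro a b hab
    exact Subtype.ext (by simpa [κ] using congrArg (fun z => (ofLex z).2) hab)
  obtain ⟨t, ht⟩ := exists_equiv_of_key mu κ hκ
  have hlt : ∀ a b : mu.cells, t a < t b ↔
      cls a.1 < cls b.1 ∨ cls a.1 = cls b.1 ∧ a.1 < b.1 := fun a b => by
    rw [ht, Prod.Lex.toLex_lt_toLex]
  have hstd : IsStandard mu t := by
    intro a b h h'
    obtain ⟨hb, hne⟩ := below_of_line h h'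
    rw [hlt]
    have hle : cls a.1 ≤ cls b.1 := by
      have hav := (hD a.1 a.2).1
      by_cases hbE : b.1 ∈ E
      · simp [cls, (hE b.1 hbE).2 a.1 hav hb]
      by_cases hbF : b.1 ∈ F
      · have haF := (hF b.1 hbF).2 a.1 hav hb
        have h1 := hEU _ haF
        have h2 := hEU _ hbF
        rcases h1 with h1 | h1 | h1
        · simp [cls, h1]
        · rcases h2 with h2 | h2 | h2
          · exact absurd h2 hbE
          · rw [h1, h2]
          · rw [h1, h2, cU, cV]; omega
        · rcases h2 with h2 | h2 | h2
          · exact absurd h2 hbE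
          · exact absurd (h1 ▸ h2 ▸ hb) hVU
          · rw [h1, h2]
      · have : cls b.1 = 3 := by
          have : b.1 ≠ U := fun h => hbF (h ▸ hUF)
          have : b.1 ≠ V := fun h => hbF (h ▸ hVF)
          simp [cls, *]
        rw [this]
        simp only [cls]
        split_ifs <;> omega
    rcases hle.lt_or_eq with hle | hle
    · exact Or.inl hle
    · exact Or.inr ⟨hle, hb.lt hne⟩
  let bU : mu.cells := ⟨U, hFD hUF⟩
  let bV : mu.cells := ⟨V, hFD hVF⟩
  have hUVt : t bU < t bV := (hlt _ _).2 (Or.inl (by change cls U < cls V; omega))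
  have hcons : (t bV : ℕ) = t bU + 1 := by
    by_contra hne
    have hlt1 : (t bU : ℕ) + 1 < t bV := by
      have : (t bU : ℕ) < t bV := hUVt
      omega
    have hM' : (t bU : ℕ) + 1 < M := hlt1.trans (t bV).2
    obtain ⟨z, hz⟩ := t.surjective ⟨(t bU : ℕ) + 1, hM'⟩
    have h1 : t bU < t z := by rw [hz, Fin.lt_def]; simp
    have h2 : t z < t bV := by rw [hz, Fin.lt_def]; exact hlt1
    rw [hlt] at h1 h2
    change cls U < _ ∨ cls U = _ ∧ _ at h1
    change _ < cls V ∨ _ = cls V ∧ _ at h2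
    rw [cU] at h1
    rw [cV] at h2
    rcases h1 with h1 | ⟨h1, h1'⟩
    · rcases h2 with h2 | ⟨h2, h2'⟩
      · omega
      · exact h2'.ne (c2 _ h2)
    · exact h1'.ne' (c1 _ h1.symm)
  have := hsep mu ⟨t, hstd⟩ (t bU) (t bV) hcons
  simpa [Params.res, bU, bV] using this

end Diagrams

end HeckeClifford

namespace HeckeClifford

/-! ### Standard tableaux -/

section Tableaux

variable {k : Kind} {m n : ℕ} {lam : Shape k m n}

/-- The box that contains the entry `i` of a (not necessarily standard) tableau. -/
def bx (t : lam.cells ≃ Fin n) (i : Fin n) : Box k m := (t.symm i).1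

lemma bx_mem (t : lam.cells ≃ Fin n) (i : Fin n) : bx t i ∈ lam.cells := (t.symm i).2

lemma bx_injective (t : lam.cells ≃ Fin n) : Function.Injective (bx t) :=
  Subtype.val_injective.comp t.symm.injective

lemma bx_inj (t : lam.cells ≃ Fin n) {i j : Fin n} : bx t i = bx t j ↔ i = j :=
  (bx_injective t).eq_iff

lemma exists_bx (t : lam.cells ≃ Fin n) {b : Box k m} (hb : b ∈ lam.cells) : ∃ i, bx t i = b :=
  ⟨t ⟨b, hb⟩, by simp [bx]⟩

/-- The boxes lie in the same row or in the same column. -/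
def Blocked (a b : Box k m) : Prop := a.comp = b.comp ∧ (a.row = b.row ∨ a.col = b.col)

/-- Entries increase along the relation `Below`: two boxes in this relation are joined by a hook
whose corner lies in the diagram. -/
lemma isStandard_iff (t : lam.cells ≃ Fin n) :
    IsStandard lam t ↔ ∀ i j, (bx t i).Below (bx t j) → i ≠ j → i < j := by
  constructor
  · intro ht i j hb hne
    have key : ∀ i j, (bx t i).Below (bx t j) → Blocked (bx t i) (bx t j) → i ≠ j → i < j := by
      intro i j hb hl hne
      have hne' := mt (bx_inj t).1 hne
      rw [Box.ext_iff'] at hne'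
      have := ht (t.symm i) (t.symm j) hb.1 (by
        have h1 := hb.2.1
        have h2 := hb.2.2
        have h3 := hb.1
        have h4 := hl.2
        simp only [bx] at h1 h2 h3 h4 hne'
        omega)
      simpa using this
    by_cases hl : Blocked (bx t i) (bx t j)
    · exact key i j hb hl hne
    -- otherwise the corner of the hook from `i` to `j` holds an intermediate entry
    have hc : (⟨(bx t i).comp, (bx t i).row, (bx t j).col⟩ : Box k m) ∈ lam.cells := by
      refine (lam.isDiagram _ (bx_mem t j)).2 _ (fun hs => ?_) ⟨hb.1, hb.2.1, le_rfl⟩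
      exact ((lam.isDiagram _ (bx_mem t i)).1 hs).trans hb.2.2
    obtain ⟨c, hc⟩ := exists_bx t hc
    have hl' : ¬ ((bx t i).row = (bx t j).row ∨ (bx t i).col = (bx t j).col) := fun h =>
      hl ⟨hb.1, h⟩
    have h1 : i < c := by
      refine key i c ?_ ?_ ?_
      · rw [hc]; exact ⟨rfl, le_rfl, hb.2.2⟩
      · rw [hc]; exact ⟨rfl, Or.inl rfl⟩
      · rintro rfl; have h := congrArg Box.col hc; exact hl' (Or.inr h)
    have h2 : c < j := by
      refine key c j ?_ ?_ ?_
      · rw [hc]; exact ⟨hb.1, hb.2.1, le_rfl⟩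
      · rw [hc]; exact ⟨hb.1, Or.inr rfl⟩
      · rintro rfl; have h := congrArg Box.row hc; exact hl' (Or.inl h.symm)
    exact h1.trans h2
  · intro h a b hab hl
    obtain ⟨hb, hne⟩ := below_of_line hab hl
    refine h (t a) (t b) (by simpa [bx] using hb) fun h' => hne ?_
    rw [t.injective h']

/-- The boxes with the first `i` entries. -/
def seg (t : lam.cells ≃ Fin n) (i : ℕ) : Finset (Box k m) :=
  (Finset.univ.filter fun a : Fin n => (a : ℕ) < i).map ⟨bx t, bx_injective t⟩

lemma mem_seg {t : lam.cells ≃ Fin n} {i : ℕ} {b : Box k m} :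
    b ∈ seg t i ↔ ∃ a : Fin n, (a : ℕ) < i ∧ bx t a = b := by
  simp [seg]

lemma bx_mem_seg {t : lam.cells ≃ Fin n} {i : ℕ} {a : Fin n} :
    bx t a ∈ seg t i ↔ (a : ℕ) < i := by
  simp [mem_seg, bx_inj]

lemma card_seg_le (t : lam.cells ≃ Fin n) (i : ℕ) : (seg t i).card ≤ i := by
  rw [seg, Finset.card_map]
  calc _ = ((Finset.univ.filter fun a : Fin n => (a : ℕ) < i).map Fin.valEmbedding).card := by
        rw [Finset.card_map]
    _ ≤ (Finset.range i).card := Finset.card_le_card fun a => by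
        simp only [Finset.mem_map, Finset.mem_filter, Finset.mem_univ, true_and, Finset.mem_range]
        rintro ⟨b, hb, rfl⟩; exact hb
    _ = i := Finset.card_range i

lemma isDiagram_seg {t : lam.cells ≃ Fin n} (ht : IsStandard lam t) (i : ℕ) :
    IsDiagram (seg t i) := by
  intro b hb
  obtain ⟨c, hc, rfl⟩ := mem_seg.1 hb
  refine ⟨(lam.isDiagram _ (bx_mem t c)).1, fun a ha hac => ?_⟩
  obtain ⟨d, rfl⟩ := exists_bx t ((lam.isDiagram _ (bx_mem t c)).2 a ha hac)
  rw [bx_mem_seg]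
  rcases eq_or_ne d c with rfl | hne
  · exact hc
  · exact lt_trans ((isStandard_iff t).1 ht d c hac hne) hc

lemma bx_trans_swap (t : lam.cells ≃ Fin n) (i j a : Fin n) :
    bx (t.trans (Equiv.swap i j)) a = bx t (Equiv.swap i j a) := by
  simp [bx]

lemma swap_lt_swap {i j a b : Fin n} (hij : (j : ℕ) = i + 1) (hab : a < b)
    (h : ¬ (a = i ∧ b = j)) : Equiv.swap i j a < Equiv.swap i j b := by
  simp only [Equiv.swap_apply_def]
  split_ifs <;> simp only [Fin.lt_def, Fin.ext_iff] at * <;> omega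

/-- The exchange of consecutive entries destroys standardness exactly if they are in one line. -/
lemma isStandard_swap_iff {t : lam.cells ≃ Fin n} (ht : IsStandard lam t) {i j : Fin n}
    (hij : (j : ℕ) = i + 1) :
    IsStandard lam (t.trans (Equiv.swap i j)) ↔ ¬ Blocked (bx t i) (bx t j) := by
  have hne : i ≠ j := by rintro rfl; omega
  have hlt : i < j := by rw [Fin.lt_def]; omega
  constructor
  · intro hs hbl
    have hb : (bx t i).Below (bx t j) := by
      have hne' := mt (bx_inj t).1 hne
      have h1 : ¬ (bx t j).Below (bx t i) := fun h =>
        (((isStandard_iff t).1 ht j i h hne.symm).trans hlt).false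
      rw [Box.ext_iff'] at hne'
      obtain ⟨h2, h3⟩ := hbl
      refine ⟨h2, ?_⟩
      by_contra hcon
      refine h1 ⟨h2.symm, ?_⟩
      omega
    have := (isStandard_iff _).1 hs j i (by simpa [bx_trans_swap] using hb) hne.symm
    exact (this.trans hlt).false
  · intro hbl a b hab hl
    have h1 := ht a b hab hl
    refine swap_lt_swap hij h1 fun h => hbl ?_
    rw [← h.1, ← h.2]
    simp only [bx, Equiv.symm_apply_apply]
    exact ⟨hab, hl.imp And.left And.left⟩

/-- Consecutive entries in the same row or column lie in adjacent boxes. -/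
lemma Blocked.adjacent {t : lam.cells ≃ Fin n} (ht : IsStandard lam t) {i j : Fin n}
    (hij : (j : ℕ) = i + 1) (h : Blocked (bx t i) (bx t j)) :
    (bx t j = ⟨(bx t i).comp, (bx t i).row, (bx t i).col + 1⟩) ∨
      bx t j = ⟨(bx t i).comp, (bx t i).row + 1, (bx t i).col⟩ := by
  have hne : i ≠ j := by rintro rfl; omega
  have hne' := mt (bx_inj t).1 hne
  have hs := (isStandard_iff t).1 ht
  have h1 : ¬ (bx t j).Below (bx t i) := fun h => by
    have : (j : ℕ) < i := hs j i h hne.symm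
    omega
  have hb : (bx t i).Below (bx t j) := by
    rw [Box.ext_iff'] at hne'
    obtain ⟨h2, h3⟩ := h
    refine ⟨h2, ?_⟩
    by_contra hcon
    refine h1 ⟨h2.symm, ?_⟩
    omega
  have hv := (lam.isDiagram _ (bx_mem t i)).1
  have hv' := (lam.isDiagram _ (bx_mem t j)).1
  have nobetween : ∀ c : Box k m, c.Valid → (bx t i).Below c → c.Below (bx t j) →
      c = bx t i ∨ c = bx t j := by
    intro c hc h2 h3
    obtain ⟨a, rfl⟩ := exists_bx t ((lam.isDiagram _ (bx_mem t j)).2 c hc h3)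
    by_contra! hcon
    have h4 : (i : ℕ) < a := hs i a h2 fun h => hcon.1 (h ▸ rfl)
    have h5 : (a : ℕ) < j := hs a j h3 fun h => hcon.2 (h ▸ rfl)
    omega
  obtain ⟨h2, h3⟩ := h
  obtain ⟨hb1, hb2, hb3⟩ := hb
  rcases h3 with h3 | h3
  · left
    have := nobetween ⟨(bx t i).comp, (bx t i).row, (bx t i).col + 1⟩
      (fun hs => (hv hs).trans (Nat.le_succ _)) ⟨rfl, le_rfl, Nat.le_succ _⟩
      ⟨hb1, hb2, by
        rw [Box.ext_iff'] at hne'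
        dsimp only
        omega⟩
    rcases this with h | h
    · simp [Box.ext_iff'] at h
    · exact h.symm
  · right
    have := nobetween ⟨(bx t i).comp, (bx t i).row + 1, (bx t i).col⟩
      (fun hs => by
        have := hv' (by unfold Box.IsStrict at *; rw [← hb1]; exact hs)
        rw [Box.ext_iff'] at hne'
        dsimp only
        omega) ⟨rfl, Nat.le_succ _, le_rfl⟩
      ⟨hb1, by
        rw [Box.ext_iff'] at hne'
        dsimp only
        omega, hb3⟩
    rcases this with h | h
    · simp [Box.ext_iff'] at h
    · exact h.symm

/-- Three consecutive entries in a connected position form a row, a column, or a hook that starts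
and ends on the diagonal of a strict component. -/
lemma blocked_chain {t : lam.cells ≃ Fin n} (ht : IsStandard lam t) {i j l : Fin n}
    (hij : (j : ℕ) = i + 1) (hjl : (l : ℕ) = j + 1) (h : Blocked (bx t i) (bx t j))
    (h' : Blocked (bx t j) (bx t l)) :
    (bx t j = ⟨(bx t i).comp, (bx t i).row, (bx t i).col + 1⟩ ∧
      bx t l = ⟨(bx t i).comp, (bx t i).row, (bx t i).col + 2⟩) ∨
    (bx t j = ⟨(bx t i).comp, (bx t i).row + 1, (bx t i).col⟩ ∧
      bx t l = ⟨(bx t i).comp, (bx t i).row + 2, (bx t i).col⟩) ∨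
    ((bx t i).IsDiag ∧ (bx t l).IsDiag ∧ (bx t i).comp = (bx t l).comp) := by
  have hs := (isStandard_iff t).1 ht
  have hv := (lam.isDiagram _ (bx_mem t i)).1
  have hv' := (lam.isDiagram _ (bx_mem t l)).1
  -- a box strictly between the outer two is the middle one
  have between : ∀ c : Box k m, c.Valid → (bx t i).Below c → c.Below (bx t l) →
      c ≠ bx t i → c ≠ bx t l → c = bx t j := by
    intro c hc h2 h3 h4 h5
    obtain ⟨a, rfl⟩ := exists_bx t ((lam.isDiagram _ (bx_mem t l)).2 c hc h3)
    have h6 : (i : ℕ) < a := hs i a h2 fun h => h4 (h ▸ rfl)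
    have h7 : (a : ℕ) < l := hs a l h3 fun h => h5 (h ▸ rfl)
    congr 1
    ext
    omega
  rcases h.adjacent ht hij with h1 | h1 <;> rcases h'.adjacent ht hjl with h2 | h2 <;>
    rw [h1] at h2
  · exact Or.inl ⟨h1, h2⟩
  · right; right
    dsimp only at h2
    by_cases hd : (bx t i).IsDiag
    · refine ⟨hd, ?_, by rw [h2]⟩
      have := hd.2
      rw [h2]
      exact ⟨hd.1, by simp [this]⟩
    · have := between ⟨(bx t i).comp, (bx t i).row + 1, (bx t i).col⟩ (fun hs => by
          have h3 := hv hs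
          have h4 : (bx t i).row ≠ (bx t i).col := fun h => hd ⟨hs, h⟩
          dsimp only
          omega) ⟨rfl, Nat.le_succ _, le_rfl⟩ (by rw [h2]; exact ⟨rfl, le_rfl, Nat.le_succ _⟩)
          (by simp [Box.ext_iff']) (by simp [h2])
      rw [h1] at this
      simp [Box.ext_iff'] at this
  · have := between ⟨(bx t i).comp, (bx t i).row, (bx t i).col + 1⟩ (fun hs => by
          have h3 := hv hs
          dsimp only
          omega) ⟨rfl, le_rfl, Nat.le_succ _⟩ (by rw [h2]; exact ⟨rfl, Nat.le_succ _, le_rfl⟩)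
          (by simp [Box.ext_iff']) (by simp [h2])
    rw [h1] at this
    simp [Box.ext_iff'] at this
  · exact Or.inr (Or.inl ⟨h1, h2⟩)

lemma bx_zero {t : lam.cells ≃ Fin n} (ht : IsStandard lam t) (i : Fin n) (hi : (i : ℕ) = 0) :
    (bx t i).row = 0 ∧ (bx t i).col = 0 := by
  have hs := (isStandard_iff t).1 ht
  have hv := (lam.isDiagram _ (bx_mem t i)).1
  obtain ⟨a, ha⟩ := exists_bx t ((lam.isDiagram _ (bx_mem t i)).2 ⟨(bx t i).comp, 0, 0⟩
    (fun _ => le_rfl) ⟨rfl, Nat.zero_le _, Nat.zero_le _⟩)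
  have hai : a = i := by
    by_contra hne
    have : (a : ℕ) < i := hs a i (by rw [ha]; exact ⟨rfl, Nat.zero_le _, Nat.zero_le _⟩) hne
    omega
  rw [← hai, ha]
  exact ⟨rfl, rfl⟩

end Tableaux

end HeckeClifford

namespace HeckeClifford

/-! ### Consequences of the separate condition -/

section Residues

variable {K : Type*} [Field K] {m : ℕ} (P : Params K m)

/-- If `x = ±1`, as on the diagonal of a strict component, the residues `x` and `q⁻² x` give the
same value. -/
lemma qf_eq_of_sq {x : K} (hq : P.q ≠ 0) (hx : x * x = 1) : P.qf x = P.qf (P.q ^ (-2 : ℤ) * x) := by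
  have hx0 : x ≠ 0 := fun h => by simp [h] at hx
  have hinv : x⁻¹ = x := inv_eq_of_mul_eq_one_left hx
  have h2 : P.q ^ (-2 : ℤ) = P.q⁻¹ ^ 2 := by
    rw [zpow_neg, inv_pow]; norm_cast
  rw [Params.qf, Params.qf, h2, mul_inv, mul_inv, mul_inv, hinv, inv_pow, inv_inv]
  congr 2
  field_simp
  ring

lemma qf_of_sq {x : K} (hq : P.q ≠ 0) (hq2 : P.q ^ 2 ≠ -1) (hx : x * x = 1) : P.qf x = 2 * x := by
  have hs : P.q + P.q⁻¹ ≠ 0 := fun h => hq2 (by field_simp at h; linear_combination h)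
  have hinv : x⁻¹ = x := inv_eq_of_mul_eq_one_left hx
  rw [Params.qf, mul_inv, hinv, ← add_mul, mul_comm _ x, ← mul_assoc, mul_div_cancel_right₀ _ hs]

/-- The eigenvalues `b_±(x)` coincide only for `x = ±1` and `x = ±q⁻²`. -/
lemma sq_eq_one_of_qf {x : K} (hq : P.q ≠ 0) (hq2 : P.q ^ 2 ≠ -1) (h20 : (2 : K) ≠ 0) (hx : x ≠ 0)
    (h : P.qf x ^ 2 = 4) : x * x = 1 ∨ (P.q ^ 2 * x) * (P.q ^ 2 * x) = 1 := by
  have hs : P.q + P.q⁻¹ ≠ 0 := fun h => hq2 (by field_simp at h; linear_combination h)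
  rw [Params.qf, div_pow, div_eq_iff (pow_ne_zero 2 hs)] at h
  have h4 : (4 : K) ≠ 0 := by
    rw [show (4 : K) = 2 * 2 by norm_num]; exact mul_ne_zero h20 h20
  have h1 : (x * x - 1) * ((P.q ^ 2 * x) * (P.q ^ 2 * x) - 1) = 0 := by
    have h2 : (P.q * x + (P.q * x)⁻¹) ^ 2 = (P.q + P.q⁻¹) ^ 2 :=
      mul_left_cancel₀ h4 (by linear_combination h)
    field_simp at h2
    linear_combination h2
  exact (mul_eq_zero.1 h1).imp sub_eq_zero.1 sub_eq_zero.1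

/-- `c(u, ·)` vanishes exactly at the values that belong to the residues `q^{±2} x`. -/
lemma qf_factor (x : K) (w : K) (hq : P.q ≠ 0) (hq2 : P.q ^ 2 ≠ -1) (hx : x ≠ 0) :
    (w - P.qf (P.q ^ (2 : ℤ) * x)) * (w - P.qf (P.q ^ (-2 : ℤ) * x)) =
      (P.qf x - w) ^ 2 - P.eps ^ 2 * (P.qf x * w - 4) := by
  have hs : P.q ^ 2 + 1 ≠ 0 := fun h => hq2 (by linear_combination h)
  have h2 : P.q ^ (-2 : ℤ) = P.q⁻¹ ^ 2 := by
    rw [zpow_neg, inv_pow]; norm_cast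
  have h3 : P.q ^ (2 : ℤ) = P.q ^ 2 := zpow_ofNat _ 2
  rw [Params.qf, Params.qf, Params.qf, Params.eps, h2, h3,
    show P.q + P.q⁻¹ = (P.q ^ 2 + 1) / P.q by field_simp]
  field_simp
  ring

lemma qf_sum (x : K) (hq : P.q ≠ 0) (hx : x ≠ 0) :
    P.qf (P.q ^ (2 : ℤ) * x) + P.qf (P.q ^ (-2 : ℤ) * x) = (2 + P.eps ^ 2) * P.qf x := by
  have h2 : P.q ^ (-2 : ℤ) = P.q⁻¹ ^ 2 := by
    rw [zpow_neg, inv_pow]; norm_cast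
  have h3 : P.q ^ (2 : ℤ) = P.q ^ 2 := zpow_ofNat _ 2
  rw [Params.qf, Params.qf, Params.qf, Params.eps, h2, h3, ← add_div, ← mul_div_assoc]
  congr 1
  field_simp
  ring

lemma cf_ne_zero_iff {x w : K} (hq : P.q ≠ 0) (hq2 : P.q ^ 2 ≠ -1) (hx : x ≠ 0)
    (h : P.qf x ≠ w) : cf P.eps (P.qf x) w ≠ 0 ↔
      w ≠ P.qf (P.q ^ (2 : ℤ) * x) ∧ w ≠ P.qf (P.q ^ (-2 : ℤ) * x) := by
  have h1 := sub_ne_zero.2 h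
  have h2 : cf P.eps (P.qf x) w = (w - P.qf (P.q ^ (2 : ℤ) * x)) * (w - P.qf (P.q ^ (-2 : ℤ) * x))
      / (P.qf x - w) ^ 2 := by
    rw [qf_factor P x w hq hq2 hx, cf]
    field_simp
  rw [h2, ← sub_ne_zero (a := w), ← sub_ne_zero (a := w), ← mul_ne_zero_iff]
  simp [h1]

/-- The polynomial `G` vanishes at three boxes in a row or column, with residues `q² x`, `x`,
`q⁻² x`. -/
lemma gf_eq_zero {x : K} (hq : P.q ≠ 0) (hq2 : P.q ^ 2 ≠ -1) (hx : x ≠ 0) :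
    gf P.eps (P.qf (P.q ^ (2 : ℤ) * x)) (P.qf x) (P.qf (P.q ^ (-2 : ℤ) * x)) = 0 := by
  have h1 := qf_factor P x 0 hq hq2 hx
  have h2 := qf_sum P x hq hx
  rw [gf]
  linear_combination P.eps ^ 2 * P.qf x * h1 - 4 * P.eps ^ 2 * h2

lemma gf_symm (ε u v w : K) : gf ε u v w = gf ε w v u := by
  rw [gf, gf]; ring

variable {k : Kind}

lemma boxRes_right (b : Box k m) (hq : P.q ≠ 0) :
    P.boxRes ⟨b.comp, b.row, b.col + 1⟩ = P.q ^ (2 : ℤ) * P.boxRes b := by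
  rw [Params.boxRes, Params.boxRes, mul_left_comm, ← zpow_add₀ hq]
  congr 2
  push_cast
  ring

lemma boxRes_down (b : Box k m) (hq : P.q ≠ 0) :
    P.boxRes ⟨b.comp, b.row + 1, b.col⟩ = P.q ^ (-2 : ℤ) * P.boxRes b := by
  rw [Params.boxRes, Params.boxRes, mul_left_comm, ← zpow_add₀ hq]
  congr 2
  push_cast
  ring

lemma boxRes_ne_zero (b : Box k m) (hq : P.q ≠ 0) (hQ : ∀ i, P.Q i ≠ 0) : P.boxRes b ≠ 0 := by
  refine mul_ne_zero ?_ (zpow_ne_zero _ hq)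
  rw [Params.charge]
  refine Fin.addCases (fun i => ?_) (fun i => ?_) b.comp
  · rw [Fin.append_left]
    cases k with
    | zero => exact i.elim0
    | s => simp [Params.strictCharge]
    | ss =>
      change Fin 2 at i
      fin_cases i <;> simp [Params.strictCharge]
  · rw [Fin.append_right]; exact hQ i

lemma charge_strict (l : Fin (k.numStrict + m)) (h : (l : ℕ) < k.numStrict) :
    P.charge k l * P.charge k l = 1 := by
  rw [Params.charge]
  revert h
  refine Fin.addCases (fun i => ?_) (fun i => ?_) l
  · intro _
    rw [Fin.append_left]
    cases k with
    | zero => exact i.elim0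
    | s => simp [Params.strictCharge]
    | ss =>
      change Fin 2 at i
      fin_cases i <;> simp [Params.strictCharge]
  · intro h; simp at h

lemma boxRes_diag {b : Box k m} (h : b.IsDiag) : P.boxRes b = P.charge k b.comp := by
  simp [Params.boxRes, h.2]

end Residues

end HeckeClifford

namespace HeckeClifford

/-! ### Separation of boxes in diagrams and tableaux -/

section Separation

variable {K : Type*} [Field K] {k : Kind} {m M : ℕ} {P : Params K m}

/-- The separate condition for `W` and `B`, when `A`, `B` are corners of a diagram and `W` becomes
one after the removal of `A`. -/
lemma qf_ne_of_corner (hsep : ∀ mu : Shape k m M, P.IsSeparate mu) {F : Finset (Box k m)}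
    (hF : IsDiagram F) {A B W : Box k m} (hA : ∀ b ∈ F, A.Below b → b = A)
    (hB : ∀ b ∈ F, B.Below b → b = B) (hAB : A ≠ B) (hBF : B ∈ F) (hWF : W ∈ F) (hWA : W ≠ A)
    (hWB : W ≠ B) (hBW : ¬ B.Below W) (hW : ∀ b ∈ F, W.Below b → b = W ∨ b = A)
    (hM : F.card ≤ M) : P.qf (P.boxRes W) ≠ P.qf (P.boxRes B) := by
  classical
  refine qf_ne_of_chain P hsep (E := ((F.erase A).erase B).erase W) (F := F.erase A) ?_ ?_ ?_ ?_ ?_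
    ?_ ?_ hWB hBW ((Finset.card_le_card (Finset.erase_subset _ _)).trans hM)
  · intro b hb
    simp only [Finset.mem_erase] at hb
    obtain ⟨h1, h2, h3, h4⟩ := hb
    refine ⟨(hF b h4).1, fun a ha hab => ?_⟩
    simp only [Finset.mem_erase]
    refine ⟨?_, ?_, ?_, (hF b h4).2 a ha hab⟩
    · rintro rfl; exact (hW b h4 hab).elim h1 h3
    · rintro rfl; exact h2 (hB b h4 hab)
    · rintro rfl; exact h3 (hA b h4 hab)
  · intro b hb
    simp only [Finset.mem_erase] at hb
    refine ⟨(hF b hb.2).1, fun a ha hab => ?_⟩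
    simp only [Finset.mem_erase]
    refine ⟨?_, (hF b hb.2).2 a ha hab⟩
    rintro rfl; exact hb.1 (hA b hb.2 hab)
  · intro b hb
    simp only [Finset.mem_erase] at hb ⊢
    tauto
  all_goals simp only [Finset.mem_erase]; tauto

lemma isDiagram_insert {F : Finset (Box k m)} [DecidableEq (Box k m)] (hF : IsDiagram F)
    {V : Box k m} (hV : V.Valid)
    (h : ∀ a : Box k m, a.Valid → a.Below V → a ≠ V → a ∈ F) : IsDiagram (insert V F) := by
  intro b hb
  rw [Finset.mem_insert] at hb
  rcases hb with rfl | hb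
  · refine ⟨hV, fun a ha hab => ?_⟩
    rw [Finset.mem_insert]
    by_cases hne : a = b
    · exact Or.inl hne
    · exact Or.inr (h a ha hab hne)
  · exact ⟨(hF b hb).1, fun a ha hab => Finset.mem_insert_of_mem ((hF b hb).2 a ha hab)⟩

/-- The separate condition for a corner `B` of a diagram and a box that can be added to it. -/
lemma qf_ne_of_addable (hsep : ∀ mu : Shape k m M, P.IsSeparate mu) {F : Finset (Box k m)}
    (hF : IsDiagram F) {B V : Box k m} (hB : ∀ b ∈ F, B.Below b → b = B) (hBF : B ∈ F)
    (hVF : V ∉ F) (hV : V.Valid) (h : ∀ a : Box k m, a.Valid → a.Below V → a ≠ V → a ∈ F)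
    (hM : F.card + 1 ≤ M) : P.qf (P.boxRes B) ≠ P.qf (P.boxRes V) := by
  classical
  have hBV : B ≠ V := fun h => hVF (h ▸ hBF)
  refine qf_ne_of_chain P hsep (E := F.erase B) (F := insert V F) ?_ (isDiagram_insert hF hV h)
    ?_ ?_ ?_ ?_ ?_ hBV ?_ ?_
  · intro b hb
    simp only [Finset.mem_erase] at hb
    refine ⟨(hF b hb.2).1, fun a ha hab => ?_⟩
    simp only [Finset.mem_erase]
    refine ⟨?_, (hF b hb.2).2 a ha hab⟩
    rintro rfl; exact hb.1 (hB b hb.2 hab)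
  · intro b hb
    simp only [Finset.mem_erase, Finset.mem_insert] at hb ⊢
    tauto
  · simp [hBF]
  · simp
  · simp
  · simp [hVF]
  · exact fun h => hVF ((hF B hBF).2 V hV h)
  · rwa [Finset.card_insert_of_notMem hVF]

/-- Adjacent boxes satisfy the separate condition. -/
lemma qf_ne_of_adjacent (hsep : ∀ mu : Shape k m M, P.IsSeparate mu) {F : Finset (Box k m)}
    (hF : IsDiagram F) {A B : Box k m} (hAF : A ∈ F) (hBF : B ∈ F) (hAB : A.Below B)
    (hadj : B.row + B.col = A.row + A.col + 1) (hM : F.card ≤ M) :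
    P.qf (P.boxRes A) ≠ P.qf (P.boxRes B) := by
  classical
  have hne : A ≠ B := by rintro rfl; omega
  have mid : ∀ b : Box k m, A.Below b → b.Below B → b = A ∨ b = B := by
    intro b h1 h2
    simp only [Box.ext_iff']
    obtain ⟨h1, h1', h1''⟩ := h1
    obtain ⟨h2, h2', h2''⟩ := h2
    have h3 := hAB.1
    by_cases h : b.row + b.col = A.row + A.col
    · left; exact ⟨h1.symm, by omega, by omega⟩
    · right; exact ⟨h2, by omega, by omega⟩
  refine qf_ne_of_chain P hsep (E := ((F.filter fun b => b.Below B).erase B).erase A)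
    (F := F.filter fun b => b.Below B) ?_ ?_ ?_ ?_ ?_ ?_ ?_ hne ?_
    ((Finset.card_le_card (Finset.filter_subset _ _)).trans hM)
  · intro b hb
    simp only [Finset.mem_erase, Finset.mem_filter] at hb
    obtain ⟨h1, h2, h3, h4⟩ := hb
    refine ⟨(hF b h3).1, fun a ha hab => ?_⟩
    simp only [Finset.mem_erase, Finset.mem_filter]
    refine ⟨?_, ?_, (hF b h3).2 a ha hab, hab.trans h4⟩
    · rintro rfl; exact (mid b hab h4).elim h1 h2
    · rintro rfl; exact h2 (h4.antisymm hab)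
  · intro b hb
    simp only [Finset.mem_filter] at hb ⊢
    exact ⟨(hF b hb.1).1, fun a ha hab => ⟨(hF b hb.1).2 a ha hab, hab.trans hb.2⟩⟩
  · intro b hb
    simp only [Finset.mem_erase, Finset.mem_filter] at hb ⊢
    tauto
  · simp [hAF, hAB]
  · simp [hBF, Box.Below.refl]
  · simp
  · simp
  · exact fun h => hne (hAB.antisymm h)

variable (hq : P.q ≠ 0) (hq2 : P.q ^ 2 ≠ -1) (h20 : (2 : K) ≠ 0)

include hq in
/-- Of two adjacent boxes, the one with the larger content does not have residue `±1`. -/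
lemma boxRes_sq_ne_of_adjacent (hsep : ∀ mu : Shape k m M, P.IsSeparate mu) {F : Finset (Box k m)}
    (hF : IsDiagram F) {A B : Box k m} (hA : A ∈ F) (hB : B ∈ F) (hM : F.card ≤ M)
    (h : B = ⟨A.comp, A.row + 1, A.col⟩ ∨ A = ⟨B.comp, B.row, B.col + 1⟩) :
    P.boxRes A * P.boxRes A ≠ 1 := by
  intro hsq
  have h1 := qf_eq_of_sq P hq hsq
  rcases h with h | h
  · rw [← boxRes_down P A hq, ← h] at h1
    exact qf_ne_of_adjacent hsep hF hA hB (by rw [h]; exact ⟨rfl, Nat.le_succ _, le_rfl⟩)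
      (by rw [h]; dsimp only; omega) hM h1
  · have h2 : P.q ^ (-2 : ℤ) * P.boxRes A = P.boxRes B := by
      rw [h, boxRes_right P B hq, ← mul_assoc, ← zpow_add₀ hq]
      simp
    rw [h2] at h1
    exact qf_ne_of_adjacent hsep hF hB hA (by rw [h]; exact ⟨rfl, le_rfl, Nat.le_succ _⟩)
      (by rw [h]; dsimp only; omega) hM h1.symm

include hq hq2 h20 in
/-- Outside the diagonals of the strict components the eigenvalues `b_±` differ. -/
lemma qf_sq_ne_four (hsep : ∀ mu : Shape k m M, P.IsSeparate mu) (hQ : ∀ i, P.Q i ≠ 0)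
    {F : Finset (Box k m)} (hF : IsDiagram F) {A : Box k m} (hA : A ∈ F) (hd : ¬ A.IsDiag)
    (hM : F.card + 1 ≤ M) : P.qf (P.boxRes A) ^ 2 ≠ 4 := by
  classical
  have hv := (hF A hA).1
  have hcard (V : Box k m) : (insert V F).card ≤ M := (Finset.card_insert_le _ _).trans hM
  intro hsq
  rcases sq_eq_one_of_qf P hq hq2 h20 (boxRes_ne_zero P A hq hQ) hsq with h | h
  · by_cases hleft : 1 ≤ A.col ∧ (A.IsStrict → A.row + 1 ≤ A.col)
    · obtain ⟨h1, h2⟩ := hleft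
      refine boxRes_sq_ne_of_adjacent hq hsep hF (B := ⟨A.comp, A.row, A.col - 1⟩) hA ?_ (by omega)
        (Or.inr ?_) h
      · refine (hF A hA).2 _ (fun hs => ?_) ⟨rfl, le_rfl, Nat.sub_le _ _⟩
        have := h2 hs
        dsimp only
        omega
      · simp [Box.ext_iff']; omega
    · -- the box below `A` belongs to the diagram or can be added to it
      have hns : ¬ A.IsStrict := fun hs => by
        have h1 := hv hs
        have h2 : A.row ≠ A.col := fun h => hd ⟨hs, h⟩
        exact hleft ⟨by omega, fun _ => by omega⟩
      have hcol : A.col = 0 := by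
        by_contra h0
        exact hleft ⟨by omega, fun hs => absurd hs hns⟩
      refine boxRes_sq_ne_of_adjacent hq hsep (F := insert ⟨A.comp, A.row + 1, A.col⟩ F)
        (B := ⟨A.comp, A.row + 1, A.col⟩) (isDiagram_insert hF (fun hs => absurd hs hns) ?_)
        (Finset.mem_insert_of_mem hA) (Finset.mem_insert_self _ _) (hcard _) (Or.inl rfl) h
      intro a ha hab hne
      refine (hF A hA).2 a ha ⟨hab.1, ?_, hab.2.2⟩
      have h1 := hab.2.1
      have h2 := hab.2.2
      have h3 := hab.1
      rw [Ne, Box.ext_iff'] at hne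
      dsimp only at h1 h2 h3 hne
      omega
  · have h2 : P.q ^ (2 : ℤ) = P.q ^ 2 := zpow_ofNat _ 2
    by_cases hrow : 1 ≤ A.row
    · have hA' : A = ⟨A.comp, A.row - 1 + 1, A.col⟩ := by simp [Box.ext_iff']; omega
      have h3 : P.boxRes ⟨A.comp, A.row - 1, A.col⟩ = P.q ^ 2 * P.boxRes A := by
        have := boxRes_down P ⟨A.comp, A.row - 1, A.col⟩ hq
        dsimp only at this
        rw [← hA'] at this
        rw [this, ← h2, ← mul_assoc, ← zpow_add₀ hq]
        simp
      rw [← h3] at h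
      refine boxRes_sq_ne_of_adjacent hq hsep hF (A := ⟨A.comp, A.row - 1, A.col⟩) ?_ hA (by omega)
        (Or.inl hA') h
      refine (hF A hA).2 _ (fun hs => ?_) ⟨rfl, Nat.sub_le _ _, le_rfl⟩
      have := hv hs
      dsimp only
      omega
    · -- the box to the right of `A` belongs to the diagram or can be added to it
      rw [← h2, ← boxRes_right P A hq] at h
      refine boxRes_sq_ne_of_adjacent hq hsep (F := insert ⟨A.comp, A.row, A.col + 1⟩ F)
        (B := A) (isDiagram_insert hF (fun hs => (hv hs).trans (Nat.le_succ _)) ?_)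
        (Finset.mem_insert_self _ _) (Finset.mem_insert_of_mem hA) (hcard _) (Or.inr rfl) h
      intro a ha hab hne
      refine (hF A hA).2 a ha ⟨hab.1, hab.2.1, ?_⟩
      have h1 := hab.2.1
      have h2 := hab.2.2
      have h3 := hab.1
      rw [Ne, Box.ext_iff'] at hne
      dsimp only at h1 h2 h3 hne
      omega

end Separation

section SeparationTableaux

variable {K : Type*} [Field K] {k : Kind} {m n : ℕ} {P : Params K m} {lam : Shape k m n}

/-- The separate condition for consecutive entries of a standard tableau. -/
lemma qf_ne_of_consecutive (hsep : ∀ mu : Shape k m (n + 1), P.IsSeparate mu)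
    {t : lam.cells ≃ Fin n} (ht : IsStandard lam t) {i j : Fin n} (hij : (j : ℕ) = i + 1) :
    P.qf (P.boxRes (bx t i)) ≠ P.qf (P.boxRes (bx t j)) := by
  refine qf_ne_of_chain P hsep (isDiagram_seg ht i) (isDiagram_seg ht (i + 2)) ?_ ?_ ?_ ?_ ?_ ?_ ?_
    ((card_seg_le t _).trans (by omega))
  · intro b hb
    obtain ⟨a, ha, rfl⟩ := mem_seg.1 hb
    rw [bx_mem_seg, bx_inj, bx_inj, Fin.ext_iff, Fin.ext_iff]
    omega
  · rw [bx_mem_seg]; omega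
  · rw [bx_mem_seg]; omega
  · rw [bx_mem_seg]; omega
  · rw [bx_mem_seg]; omega
  · rw [Ne, bx_inj, Fin.ext_iff]; omega
  · intro h
    have : (j : ℕ) < i := (isStandard_iff t).1 ht j i h (by rw [Ne, Fin.ext_iff]; omega)
    omega

/-- The sequence of the `q(res(i))` determines a standard tableau. -/
lemma eq_of_qf_eq (hsep : ∀ mu : Shape k m (n + 1), P.IsSeparate mu)
    {t s : lam.cells ≃ Fin n} (ht : IsStandard lam t) (hs : IsStandard lam s)
    (h : ∀ i, P.qf (P.boxRes (bx t i)) = P.qf (P.boxRes (bx s i))) : t = s := by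
  classical
  have hall : ∀ i : ℕ, ∀ hi : i < n, bx t ⟨i, hi⟩ = bx s ⟨i, hi⟩ := by
    intro i
    induction i using Nat.strong_induction_on with
    | _ i ih =>
      intro hi
      by_contra hne
      -- the boxes of the entry `i` in `t` and `s` can both be added to the common initial segment
      have hseg : seg t i = seg s i := by
        ext b
        simp only [mem_seg]
        refine exists_congr fun a => and_congr_right fun ha => ?_
        rw [ih a ha a.2]
      have sub (r : lam.cells ≃ Fin n) (hr : IsStandard lam r) (a : Box k m) (ha : a.Valid)
          (hab : a.Below (bx r ⟨i, hi⟩)) : a ∈ seg r i ∨ a = bx r ⟨i, hi⟩ := by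
        have : a ∈ seg r (i + 1) := (isDiagram_seg hr (i + 1) _ (bx_mem_seg.2 (by simp))).2 a ha hab
        obtain ⟨c, hc, rfl⟩ := mem_seg.1 this
        rw [bx_mem_seg, bx_inj, Fin.ext_iff]
        simp only
        omega
      have hvt := (lam.isDiagram _ (bx_mem t ⟨i, hi⟩)).1
      have hvs := (lam.isDiagram _ (bx_mem s ⟨i, hi⟩)).1
      have hnt : bx t ⟨i, hi⟩ ∉ seg t i := by rw [bx_mem_seg]; simp
      have hns : bx s ⟨i, hi⟩ ∉ seg t i := by rw [hseg, bx_mem_seg]; simp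
      have hst : ¬ (bx s ⟨i, hi⟩).Below (bx t ⟨i, hi⟩) := fun hb =>
        (sub t ht _ hvs hb).elim hns (Ne.symm hne)
      refine qf_ne_of_chain P hsep (E := seg t i)
        (F := insert (bx t ⟨i, hi⟩) (insert (bx s ⟨i, hi⟩) (seg t i))) (isDiagram_seg ht i) ?_ ?_ ?_
        ?_ hnt hns hne hst ?_ (h ⟨i, hi⟩)
      · refine isDiagram_insert (isDiagram_insert (isDiagram_seg ht i) hvs ?_) hvt ?_
        · intro a ha hab hne'
          rw [hseg]
          exact (sub s hs a ha hab).resolve_right hne'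
        · intro a ha hab hne'
          exact Finset.mem_insert_of_mem ((sub t ht a ha hab).resolve_right hne')
      · intro b
        simp only [Finset.mem_insert]
        tauto
      · simp
      · simp
      · refine (Finset.card_insert_le _ _).trans ?_
        have := Finset.card_insert_le (bx s ⟨i, hi⟩) (seg t i)
        have := card_seg_le t i
        omega
  have : t.symm = s.symm := by
    ext i : 1
    exact Subtype.ext (hall i i.2)
  rw [← Equiv.symm_symm t, this, Equiv.symm_symm]

/-- If `s_i t` is standard, then the coefficient of `v_{s_i t}` in `T_i v_t` does not vanish. -/
lemma cf_ne_zero (hsep : ∀ mu : Shape k m (n + 1), P.IsSeparate mu) (hq : P.q ≠ 0)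
    (hq2 : P.q ^ 2 ≠ -1) (hQ : ∀ i, P.Q i ≠ 0)
    {t : lam.cells ≃ Fin n} (ht : IsStandard lam t) {i j : Fin n} (hij : (j : ℕ) = i + 1)
    (hbl : ¬ Blocked (bx t i) (bx t j)) :
    cf P.eps (P.qf (P.boxRes (bx t i))) (P.qf (P.boxRes (bx t j))) ≠ 0 := by
  have hcons := qf_ne_of_consecutive hsep ht hij
  have hs := (isStandard_iff t).1 ht
  have hF := isDiagram_seg ht (i + 2)
  have hFcard := card_seg_le t (i + 2)
  have hin : (i : ℕ) + 2 ≤ n := by omega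
  have hAF : bx t i ∈ seg t (i + 2) := by rw [bx_mem_seg]; omega
  have hBF : bx t j ∈ seg t (i + 2) := by rw [bx_mem_seg]; omega
  have hABne : bx t i ≠ bx t j := by rw [Ne, bx_inj, Fin.ext_iff]; omega
  have hB : ∀ b ∈ seg t (i + 2), (bx t j).Below b → b = bx t j := by
    intro b hb hjb
    obtain ⟨a, ha, rfl⟩ := mem_seg.1 hb
    by_contra hne
    have : (j : ℕ) < a := hs j a hjb fun h => hne (h ▸ rfl)
    omega
  -- swapping the entries shows that the first box is also a corner
  have hA : ∀ b ∈ seg t (i + 2), (bx t i).Below b → b = bx t i := by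
    intro b hb hib
    obtain ⟨a, ha, rfl⟩ := mem_seg.1 hb
    by_contra hne
    have hia : i ≠ a := fun h => hne (h ▸ rfl)
    have h1 : (i : ℕ) < a := hs i a hib hia
    have h2 : a = j := by ext; omega
    subst h2
    have h3 := (isStandard_iff _).1 ((isStandard_swap_iff ht hij).2 hbl) a i
      (by simpa [bx_trans_swap] using hib) hia.symm
    exact absurd h1 (not_lt.2 h3.le)
  have hv := (hF _ hAF).1
  have hBA : ¬ (bx t j).Below (bx t i) := fun h => hABne (hB _ hAF h)
  rw [cf_ne_zero_iff P hq hq2 (boxRes_ne_zero P _ hq hQ) hcons]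
  constructor
  · rw [← boxRes_right P _ hq]
    set V : Box k m := ⟨(bx t i).comp, (bx t i).row, (bx t i).col + 1⟩ with hV
    have hAV : (bx t i).Below V := ⟨rfl, le_rfl, Nat.le_succ _⟩
    have hVF : V ∉ seg t (i + 2) := fun h => by
      have := hA V h hAV
      simp [hV, Box.ext_iff'] at this
    have hVval : V.Valid := fun hs => (hv hs).trans (Nat.le_succ _)
    by_cases hadd : 1 ≤ (bx t i).row →
        (⟨(bx t i).comp, (bx t i).row - 1, (bx t i).col + 1⟩ : Box k m) ∈ seg t (i + 2)
    · refine qf_ne_of_addable hsep hF hB hBF hVF hVval ?_ (by omega)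
      intro a ha hab hne
      obtain ⟨h1, h2, h3⟩ := hab
      rw [Ne, Box.ext_iff'] at hne
      simp only [hV] at h1 h2 h3 hne
      by_cases h4 : a.col ≤ (bx t i).col
      · exact (hF _ hAF).2 a ha ⟨h1, h2, h4⟩
      · exact (hF _ (hadd (by omega))).2 a ha ⟨h1, by dsimp only; omega, by dsimp only; omega⟩
    · push Not at hadd
      obtain ⟨hr, hadd⟩ := hadd
      set W : Box k m := ⟨(bx t i).comp, (bx t i).row - 1, (bx t i).col⟩ with hW
      have hWV : P.boxRes W = P.boxRes V := by
        simp only [Params.boxRes, hW, hV]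
        congr 3
        push_cast [Nat.cast_sub hr]
        ring
      have hWA : W.Below (bx t i) := ⟨rfl, Nat.sub_le _ _, le_rfl⟩
      have hWval : W.Valid := fun hs => by
        have := hv hs
        simp only [hW]
        omega
      have hBW : ¬ (bx t j).Below W := fun h => hBA (h.trans hWA)
      rw [← hWV]
      refine (qf_ne_of_corner hsep hF hA hB hABne hBF ((hF _ hAF).2 W hWval hWA) ?_ ?_ hBW ?_
        (by omega)).symm
      · intro h
        have := congrArg Box.row h
        simp only [hW] at this
        omega
      · intro h; exact hBW (h ▸ Box.Below.refl _)
      · intro b hb hWb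
        obtain ⟨h1, h2, h3⟩ := hWb
        simp only [hW] at h1 h2 h3
        by_cases h4 : (bx t i).col + 1 ≤ b.col
        · refine absurd ((hF b hb).2 ⟨(bx t i).comp, (bx t i).row - 1, (bx t i).col + 1⟩
            (fun hs => ?_) ⟨h1, h2, h4⟩) hadd
          have := hv hs
          dsimp only
          omega
        · by_cases h5 : (bx t i).row ≤ b.row
          · exact Or.inr (hA b hb ⟨h1, h5, h3⟩)
          · left
            rw [Box.ext_iff']
            exact ⟨h1.symm, by simp only [hW]; omega, by simp only [hW]; omega⟩
  · by_cases hd : (bx t i).IsDiag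
    · have h1 := charge_strict P (bx t i).comp hd.1
      rw [← boxRes_diag P hd] at h1
      rw [← qf_eq_of_sq P hq h1]
      exact hcons.symm
    rw [← boxRes_down P _ hq]
    set V : Box k m := ⟨(bx t i).comp, (bx t i).row + 1, (bx t i).col⟩ with hV
    have hAV : (bx t i).Below V := ⟨rfl, Nat.le_succ _, le_rfl⟩
    have hVF : V ∉ seg t (i + 2) := fun h => by
      have := hA V h hAV
      simp [hV, Box.ext_iff'] at this
    have hVval : V.Valid := fun hs => by
      have h1 := hv hs
      have h2 : (bx t i).row ≠ (bx t i).col := fun h => hd ⟨hs, h⟩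
      simp only [hV]
      omega
    by_cases hadd : 1 ≤ (bx t i).col →
        (⟨(bx t i).comp, (bx t i).row + 1, (bx t i).col - 1⟩ : Box k m).Valid →
        (⟨(bx t i).comp, (bx t i).row + 1, (bx t i).col - 1⟩ : Box k m) ∈ seg t (i + 2)
    · refine qf_ne_of_addable hsep hF hB hBF hVF hVval ?_ (by omega)
      intro a ha hab hne
      obtain ⟨h1, h2, h3⟩ := hab
      rw [Ne, Box.ext_iff'] at hne
      simp only [hV] at h1 h2 h3 hne
      by_cases h4 : a.row ≤ (bx t i).row
      · exact (hF _ hAF).2 a ha ⟨h1, h4, h3⟩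
      · refine (hF _ (hadd (by omega) ?_)).2 a ha ⟨h1, by dsimp only; omega, by dsimp only; omega⟩
        intro hs
        have := ha (by unfold Box.IsStrict at *; rw [h1]; exact hs)
        dsimp only
        omega
    · push Not at hadd
      obtain ⟨hr, hval', hadd⟩ := hadd
      set W : Box k m := ⟨(bx t i).comp, (bx t i).row, (bx t i).col - 1⟩ with hW
      have hWV : P.boxRes W = P.boxRes V := by
        simp only [Params.boxRes, hW, hV]
        congr 3
        push_cast [Nat.cast_sub hr]
        ring
      have hWA : W.Below (bx t i) := ⟨rfl, le_rfl, Nat.sub_le _ _⟩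
      have hWval : W.Valid := fun hs => by
        have := hval' hs
        dsimp only at this
        simp only [hW]
        omega
      have hBW : ¬ (bx t j).Below W := fun h => hBA (h.trans hWA)
      rw [← hWV]
      refine (qf_ne_of_corner hsep hF hA hB hABne hBF ((hF _ hAF).2 W hWval hWA) ?_ ?_ hBW ?_
        (by omega)).symm
      · intro h
        have := congrArg Box.col h
        simp only [hW] at this
        omega
      · intro h; exact hBW (h ▸ Box.Below.refl _)
      · intro b hb hWb
        obtain ⟨h1, h2, h3⟩ := hWb
        simp only [hW] at h1 h2 h3
        by_cases h4 : (bx t i).row + 1 ≤ b.row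
        · exact absurd ((hF b hb).2 _ hval' ⟨h1, h4, h3⟩) hadd
        · by_cases h5 : (bx t i).col ≤ b.col
          · exact Or.inr (hA b hb ⟨h1, h2, h5⟩)
          · left
            rw [Box.ext_iff']
            exact ⟨h1.symm, by simp only [hW]; omega, by simp only [hW]; omega⟩

end SeparationTableaux

end HeckeClifford

namespace HeckeClifford

/-! ### The operators on the direct sum of twisted modules -/

section Operators

variable {K : Type*} [Field K] {k : Kind} {m n : ℕ} {P : Params K m} {lam : Shape k m n}

/-- The position in the initial tableau of the box with entry `i`. The operators `X_i` and `C_i`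
act on the component of `t` through this tensor factor. -/
def ix (t : lam.cells ≃ Fin n) (i : Fin n) : Fin n := (initial lam).1 (t.symm i)

lemma dperm_symm_apply (t : Std lam) (i : Fin n) : (dperm t).symm i = ix t.1 i := rfl

lemma ix_injective (t : lam.cells ≃ Fin n) : Function.Injective (ix t) :=
  (initial lam).1.injective.comp t.symm.injective

lemma ix_ne (t : lam.cells ≃ Fin n) {i j : Fin n} (h : i ≠ j) : ix t i ≠ ix t j :=
  (ix_injective t).ne h

lemma res_ix (t : lam.cells ≃ Fin n) (i : Fin n) :
    P.res (initial lam) (ix t i) = P.boxRes (bx t i) := by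
  simp [Params.res, ix, bx]

lemma ix_swap (t : lam.cells ≃ Fin n) (i j a : Fin n) :
    ix (t.trans (Equiv.swap i j)) a = ix t (Equiv.swap i j a) := by
  simp [ix]

variable (P) in
/-- The eigenvalues of the `X_a` on the tensor product. -/
def eigF (lam : Shape k m n) (a : Fin n) : Tens K n := P.eig (P.res (initial lam)) a

variable (P) in
/-- The scalar `X_a + X_a⁻¹`. -/
def uF (lam : Shape k m n) (a : Fin n) : K := P.qf (P.res (initial lam) a)

variable (P) in
/-- The coefficient `Ω` of `T_i`; `a` and `b` are the tensor factors of the entries `i`, `i + 1`. -/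
def om (lam : Shape k m n) (a b : Fin n) : K := P.sqrt (cf P.eps (uF P lam a) (uF P lam b))

lemma uF_ix (t : lam.cells ≃ Fin n) (i : Fin n) : uF P lam (ix t i) = P.qf (P.boxRes (bx t i)) := by
  rw [uF, res_ix]

lemma bPlus_add_bMinus (h20 : (2 : K) ≠ 0) (x : K) : P.bPlus x + P.bMinus x = P.qf x := by
  rw [Params.bPlus, Params.bMinus]
  field_simp
  ring

lemma bPlus_mul_bMinus (hsqrt : ∀ a : K, P.sqrt a * P.sqrt a = a) (h20 : (2 : K) ≠ 0) (x : K) :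
    P.bPlus x * P.bMinus x = 1 := by
  have h := hsqrt (P.qf x ^ 2 / 4 - 1)
  have h4 : (4 : K) = 2 * 2 := by norm_num
  have h5 : P.qf x / 2 * (P.qf x / 2) = P.qf x ^ 2 / 4 := by rw [h4]; field_simp
  rw [Params.bPlus, Params.bMinus]
  linear_combination h5 - h

lemma bPlus_eq_inv (hsqrt : ∀ a : K, P.sqrt a * P.sqrt a = a) (h20 : (2 : K) ≠ 0) (x : K) :
    P.bPlus x = (P.bMinus x)⁻¹ :=
  eq_inv_of_mul_eq_one_left (bPlus_mul_bMinus hsqrt h20 x)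

/-- The abstract properties of the eigenvalues hold since `b_+` and `b_-` are inverse to each other
and have the sum `q(·)`. -/
lemma isEig (hsqrt : ∀ a : K, P.sqrt a * P.sqrt a = a) (h20 : (2 : K) ≠ 0) (lam : Shape k m n) :
    IsEig (eigF P lam) (uF P lam) where
  ne_zero a β := by
    have h := bPlus_mul_bMinus hsqrt h20 (P.res (initial lam) a)
    rw [eigF, Params.eig]
    split_ifs
    · exact left_ne_zero_of_mul_eq_one h
    · exact right_ne_zero_of_mul_eq_one h
  flip a β := by
    have h := bPlus_eq_inv hsqrt h20 (P.res (initial lam) a)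
    have h1 : (1 : ZMod 2) + 1 = 0 := by decide
    simp only [eigF, Params.eig, add_e_self]
    rcases zmod_two_cases (β a) with h0 | h0 <;> simp [h0, h1, h]
  const a b β h := by
    simp only [eigF, Params.eig, add_e_of_ne β h]
  add_inv a β := by
    have h := bPlus_eq_inv hsqrt h20 (P.res (initial lam) a)
    have h' := bPlus_add_bMinus (P := P) h20 (P.res (initial lam) a)
    simp only [eigF, Params.eig, uF]
    rw [← h']
    split_ifs
    · rw [h, inv_inv]
    · rw [h, add_comm]

lemma om_mul_self (hsqrt : ∀ a : K, P.sqrt a * P.sqrt a = a) (a b : Fin n) :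
    om P lam a b * om P lam a b = cf P.eps (uF P lam a) (uF P lam b) := hsqrt _

lemma cf_comm (ε u w : K) : cf ε u w = cf ε w u := by
  rw [cf, cf, mul_comm u w, ← neg_sub w u, neg_sq]

lemma om_comm (a b : Fin n) : om P lam a b = om P lam b a := by rw [om, om, cf_comm]

open Classical in
/-- The component at a tableau, set to be zero at tableaux that are not standard. -/
noncomputable def ext0 (f : Ambient K lam) (t : lam.cells ≃ Fin n) : Tens K n :=
  if h : IsStandard lam t then f ⟨t, h⟩ else 0

lemma ext0_of (f : Ambient K lam) {t : lam.cells ≃ Fin n} (h : IsStandard lam t) :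
    ext0 f t = f (⟨t, h⟩ : Std lam) := by rw [ext0, dif_pos h]

lemma ext0_std (f : Ambient K lam) (t : Std lam) : ext0 f t.1 = f t :=
  ext0_of f t.2

lemma ext0_of_not (f : Ambient K lam) {t : lam.cells ≃ Fin n} (h : ¬ IsStandard lam t) :
    ext0 f t = 0 := by rw [ext0, dif_neg h]

lemma ext0_add (f g : Ambient K lam) (t : lam.cells ≃ Fin n) :
    ext0 (f + g) t = ext0 f t + ext0 g t := by
  by_cases h : IsStandard lam t
  · simp only [ext0_of _ h]; rfl
  · simp [ext0_of_not _ h]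

lemma ext0_smul (r : K) (f : Ambient K lam) (t : lam.cells ≃ Fin n) :
    ext0 (r • f) t = r • ext0 f t := by
  by_cases h : IsStandard lam t
  · simp only [ext0_of _ h]; rfl
  · simp [ext0_of_not _ h]

variable (P lam) in
/-- The operator of `X_a`, in terms of the tensor factors `ix t a`. -/
def lX (a : Fin n) : Module.End K (Ambient K lam) where
  toFun f t := eigF P lam (ix t.1 a) * f t
  map_add' f g := by ext t : 1; simp [mul_add]
  map_smul' r f := by ext t : 1; simp

variable (P lam) in
/-- The operator of `X_a⁻¹`, in terms of the tensor factors `ix t a`. -/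
def lXinv (a : Fin n) : Module.End K (Ambient K lam) where
  toFun f t := (eigF P lam (ix t.1 a))⁻¹ * f t
  map_add' f g := by ext t : 1; simp [mul_add]
  map_smul' r f := by ext t : 1; simp

variable (K lam) in
/-- The operator of `C_a`, in terms of the tensor factors `ix t a`. -/
def lC (a : Fin n) : Module.End K (Ambient K lam) where
  toFun f t := cl (ix t.1 a) (f t)
  map_add' f g := by ext t : 1; simp
  map_smul' r f := by ext t : 1; simp

variable (P lam) in
/-- The operator of `T_i`, where `j = i + 1`, in terms of `Ξ` and `Ω`. -/
noncomputable def lT (i j : Fin n) : Module.End K (Ambient K lam) where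
  toFun f t := Xi P.eps (eigF P lam) (ix t.1 i) (ix t.1 j) (f t) +
    om P lam (ix t.1 i) (ix t.1 j) • ext0 f (t.1.trans (Equiv.swap i j))
  map_add' f g := by ext t : 1; simp only [Pi.add_apply, map_add, ext0_add, smul_add]; abel
  map_smul' r f := by
    ext t : 1
    simp only [Pi.smul_apply, map_smul, ext0_smul, smul_add, RingHom.id_apply, smul_comm r]

lemma lX_apply (a : Fin n) (f : Ambient K lam) (t : Std lam) :
    lX P lam a f t = eigF P lam (ix t.1 a) * f t := rfl

lemma lXinv_apply (a : Fin n) (f : Ambient K lam) (t : Std lam) :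
    lXinv P lam a f t = (eigF P lam (ix t.1 a))⁻¹ * f t := rfl

lemma lC_apply (a : Fin n) (f : Ambient K lam) (t : Std lam) :
    lC K lam a f t = cl (ix t.1 a) (f t) := rfl

lemma lT_apply (i j : Fin n) (f : Ambient K lam) (t : Std lam) :
    lT P lam i j f t = Xi P.eps (eigF P lam) (ix t.1 i) (ix t.1 j) (f t) +
      om P lam (ix t.1 i) (ix t.1 j) • ext0 f (t.1.trans (Equiv.swap i j)) := rfl

lemma ext0_lX (a : Fin n) (f : Ambient K lam) (t : lam.cells ≃ Fin n) :
    ext0 (lX P lam a f) t = eigF P lam (ix t a) * ext0 f t := by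
  by_cases h : IsStandard lam t
  · simp only [ext0_of _ h]; rfl
  · simp [ext0_of_not _ h]

lemma ext0_lC (a : Fin n) (f : Ambient K lam) (t : lam.cells ≃ Fin n) :
    ext0 (lC K lam a f) t = cl (ix t a) (ext0 f t) := by
  by_cases h : IsStandard lam t
  · simp only [ext0_of _ h]; rfl
  · simp [ext0_of_not _ h]

lemma ext0_lT (i j : Fin n) (f : Ambient K lam) {t : lam.cells ≃ Fin n} (h : IsStandard lam t) :
    ext0 (lT P lam i j f) t = Xi P.eps (eigF P lam) (ix t i) (ix t j) (ext0 f t) +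
      om P lam (ix t i) (ix t j) • ext0 f (t.trans (Equiv.swap i j)) := by
  rw [ext0_of _ h, ext0_of f h]
  rfl

section Sep

variable (hsep : ∀ mu : Shape k m (n + 1), P.IsSeparate mu)

include hsep in
lemma uF_ne {t : lam.cells ≃ Fin n} (ht : IsStandard lam t) {i j : Fin n} (hij : (j : ℕ) = i + 1) :
    uF P lam (ix t i) ≠ uF P lam (ix t j) := by
  rw [uF_ix, uF_ix]
  exact qf_ne_of_consecutive hsep ht hij

include hsep in
/-- The operator `lT` agrees with `opT`: the radicand in the latter takes the same value on all
eigenvectors. -/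
lemma lT_eq (hsqrt : ∀ a : K, P.sqrt a * P.sqrt a = a) (h20 : (2 : K) ≠ 0) {i j : Fin n}
    (hij : (j : ℕ) = i + 1) (f : Ambient K lam) : lT P lam i j f = P.opT i j f := by
  have hx := isEig hsqrt h20 lam
  ext t β
  have hu := uF_ne hsep t.2 hij
  have h1 := omega_sq_eq P.eps (hx.ne_zero (ix t.1 i) β) (hx.ne_zero (ix t.1 j) β)
    (hx.ne_of_ne hu β) (hx.mul_ne_one_of_ne hu β)
  rw [hx.add_inv, hx.add_inv] at h1
  rw [lT_apply, Pi.add_apply, Xi_apply_apply, Params.opT]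
  simp only [Params.eigT, dperm_symm_apply]
  congr 1
  rw [Pi.smul_apply, smul_eq_mul, om, ← h1]
  split_ifs with h
  · exact congrArg _ (congrFun (ext0_of f h) β)
  · exact (congrArg _ (congrFun (ext0_of_not f h) β)).trans (mul_zero _)

variable (hq : P.q ≠ 0) (hq2 : P.q ^ 2 ≠ -1) (hQ : ∀ i, P.Q i ≠ 0)

include hsep hq hq2 hQ in
/-- If `s_i t` is not standard, then the two entries lie in adjacent boxes, whose residues differ by
the factor `q^{±2}`. -/
lemma cf_eq_zero_of_not {t : lam.cells ≃ Fin n} (ht : IsStandard lam t) {i j : Fin n}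
    (hij : (j : ℕ) = i + 1) (h : ¬ IsStandard lam (t.trans (Equiv.swap i j))) :
    cf P.eps (uF P lam (ix t i)) (uF P lam (ix t j)) = 0 := by
  have hcons := qf_ne_of_consecutive hsep ht hij
  rw [isStandard_swap_iff ht hij, not_not] at h
  rw [uF_ix, uF_ix]
  by_contra hcf
  rw [← Ne, cf_ne_zero_iff P hq hq2 (boxRes_ne_zero P _ hq hQ) hcons] at hcf
  rcases h.adjacent ht hij with h1 | h1
  · rw [← boxRes_right P _ hq, ← h1] at hcf
    exact hcf.1 rfl
  · rw [← boxRes_down P _ hq, ← h1] at hcf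
    exact hcf.2 rfl

variable (hsqrt : ∀ a : K, P.sqrt a * P.sqrt a = a)

include hsep hq hq2 hQ hsqrt in
lemma om_eq_zero_of_not {t : lam.cells ≃ Fin n} (ht : IsStandard lam t) {i j : Fin n}
    (hij : (j : ℕ) = i + 1) (h : ¬ IsStandard lam (t.trans (Equiv.swap i j))) :
    om P lam (ix t i) (ix t j) = 0 :=
  mul_self_eq_zero.1 ((om_mul_self hsqrt _ _).trans
    (cf_eq_zero_of_not hsep hq hq2 hQ ht hij h))

include hsep hq hq2 hQ hsqrt in
/-- The formula for `T_i` may be used at `s_j t` even if this tableau is not standard, as the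
coefficient vanishes then. -/
lemma om_smul_ext0_lT {t : lam.cells ≃ Fin n} (ht : IsStandard lam t) {i j : Fin n}
    (hij : (j : ℕ) = i + 1) (i' j' : Fin n) (f : Ambient K lam) :
    om P lam (ix t i) (ix t j) • ext0 (lT P lam i' j' f) (t.trans (Equiv.swap i j)) =
      om P lam (ix t i) (ix t j) •
        (Xi P.eps (eigF P lam) (ix t (Equiv.swap i j i')) (ix t (Equiv.swap i j j'))
          (ext0 f (t.trans (Equiv.swap i j))) +
          om P lam (ix t (Equiv.swap i j i')) (ix t (Equiv.swap i j j')) •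
            ext0 f ((t.trans (Equiv.swap i j)).trans (Equiv.swap i' j'))) := by
  by_cases h : IsStandard lam (t.trans (Equiv.swap i j))
  · rw [ext0_lT _ _ _ h, ix_swap, ix_swap]
  · rw [om_eq_zero_of_not hsep hq hq2 hQ hsqrt ht hij h, zero_smul, zero_smul]

variable (h20 : (2 : K) ≠ 0)

include hsep hq hq2 hQ hsqrt h20 in
lemma lT_sq {i j : Fin n} (hij : (j : ℕ) = i + 1) (f : Ambient K lam) :
    lT P lam i j (lT P lam i j f) = P.eps • lT P lam i j f + f := by
  have hx := isEig hsqrt h20 lam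
  ext t : 1
  have hu := uF_ne hsep t.2 hij
  rw [lT_apply, om_smul_ext0_lT hsep hq hq2 hQ hsqrt t.2 hij, lT_apply, map_add, Xi_sq hx hu,
    Equiv.swap_apply_left, Equiv.swap_apply_right, Pi.add_apply, Pi.smul_apply, lT_apply, map_smul,
    om_comm (ix t.1 j)]
  have h1 : (t.1.trans (Equiv.swap i j)).trans (Equiv.swap i j) = t.1 := by
    ext a; simp
  have h2 := Xi_add_swap (ε := P.eps) hx hu (ext0 f (t.1.trans (Equiv.swap i j)))
  rw [h1, ext0_std, smul_add, smul_smul _ _ (f t), om_mul_self hsqrt, sub_smul, one_smul,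
    smul_add P.eps, smul_comm P.eps (om _ _ _ _), ← h2, smul_add]
  abel

end Sep

end Operators

end HeckeClifford

namespace HeckeClifford

/-! ### The relations of the affine algebra -/

section Relations

variable {K : Type*} [Field K] {k : Kind} {m n : ℕ} {P : Params K m} {lam : Shape k m n}

section NoT

variable (hsqrt : ∀ a : K, P.sqrt a * P.sqrt a = a) (h20 : (2 : K) ≠ 0)

lemma lX_lX (a b : Fin n) (f : Ambient K lam) :
    lX P lam a (lX P lam b f) = lX P lam b (lX P lam a f) := by
  ext t : 1
  simp only [lX_apply]
  exact mul_left_comm _ _ _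

include hsqrt h20 in
lemma lX_lXinv (a : Fin n) (f : Ambient K lam) : lX P lam a (lXinv P lam a f) = f := by
  ext t β
  exact mul_inv_cancel_left₀ ((isEig hsqrt h20 lam).ne_zero _ _) _

include hsqrt h20 in
lemma lXinv_lX (a : Fin n) (f : Ambient K lam) : lXinv P lam a (lX P lam a f) = f := by
  ext t β
  exact inv_mul_cancel_left₀ ((isEig hsqrt h20 lam).ne_zero _ _) _

lemma lC_lC_self (a : Fin n) (f : Ambient K lam) : lC K lam a (lC K lam a f) = f := by
  ext t : 1
  exact cl_cl_self _ _

lemma lC_lC {a b : Fin n} (h : a ≠ b) (f : Ambient K lam) :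
    lC K lam a (lC K lam b f) = -lC K lam b (lC K lam a f) := by
  ext t : 1
  exact cl_anticomm (ix_ne _ h) _

include hsqrt h20 in
lemma lX_lC_self (a : Fin n) (f : Ambient K lam) :
    lX P lam a (lC K lam a f) = lC K lam a (lXinv P lam a f) := by
  have hx := isEig hsqrt h20 lam
  ext t : 1
  rw [lX_apply, lC_apply, lC_apply, lXinv_apply, cl_mul]
  congr 1
  ext β
  simp [hx.flip]

include hsqrt h20 in
lemma lX_lC {a b : Fin n} (h : a ≠ b) (f : Ambient K lam) :
    lX P lam a (lC K lam b f) = lC K lam b (lX P lam a f) := by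
  ext t : 1
  rw [lX_apply, lC_apply, lC_apply, lX_apply, (isEig hsqrt h20 lam).comp_of_ne (ix_ne _ h)]

variable (hsep : ∀ mu : Shape k m (n + 1), P.IsSeparate mu)

include hsqrt h20 hsep

lemma lT_lX {i j : Fin n} (hij : (j : ℕ) = i + 1) (f : Ambient K lam) :
    lT P lam i j (lX P lam i f) = lX P lam j (lT P lam i j f) -
      P.eps • (lX P lam j f + lC K lam i (lC K lam j (lX P lam i f))) := by
  ext t : 1
  simp only [Pi.sub_apply, Pi.smul_apply, Pi.add_apply, lT_apply, lX_apply, lC_apply, ext0_lX,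
    Xi_X (isEig hsqrt h20 lam) (uF_ne hsep t.2 hij), ix_swap, Equiv.swap_apply_left, mul_add,
    mul_smul_comm]
  abel

lemma lT_lX_succ {i j : Fin n} (hij : (j : ℕ) = i + 1) (f : Ambient K lam) :
    lT P lam i j (lX P lam j f) = lX P lam i (lT P lam i j f) +
      P.eps • (lX P lam j f - lC K lam i (lC K lam j (lX P lam j f))) := by
  ext t : 1
  simp only [Pi.sub_apply, Pi.smul_apply, Pi.add_apply, lT_apply, lX_apply, lC_apply, ext0_lX,
    Xi_X_succ (isEig hsqrt h20 lam) (uF_ne hsep t.2 hij), ix_swap, Equiv.swap_apply_right, mul_add,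
    mul_smul_comm]
  abel

omit hsep in
lemma lT_lX_far {i j a : Fin n} (hi : a ≠ i) (hj : a ≠ j) (f : Ambient K lam) :
    lT P lam i j (lX P lam a f) = lX P lam a (lT P lam i j f) := by
  ext t : 1
  simp only [lT_apply, lX_apply, ext0_lX, Xi_X_far (isEig hsqrt h20 lam) (ix_ne _ hi) (ix_ne _ hj),
    ix_swap, Equiv.swap_apply_of_ne_of_ne hi hj, mul_add, mul_smul_comm]

omit hsep in
lemma lT_lC {i j : Fin n} (hij : i ≠ j) (f : Ambient K lam) :
    lT P lam i j (lC K lam i f) = lC K lam j (lT P lam i j f) := by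
  ext t : 1
  simp only [lT_apply, lC_apply, ext0_lC, Xi_cl (isEig hsqrt h20 lam) (ix_ne _ hij),
    ix_swap, Equiv.swap_apply_left, map_add, map_smul]

lemma lT_lC_succ {i j : Fin n} (hij : (j : ℕ) = i + 1) (f : Ambient K lam) :
    lT P lam i j (lC K lam j f) = lC K lam i (lT P lam i j f) -
      P.eps • (lC K lam i f - lC K lam j f) := by
  ext t : 1
  simp only [Pi.sub_apply, Pi.smul_apply, lT_apply, lC_apply, ext0_lC,
    Xi_cl_succ (isEig hsqrt h20 lam) (uF_ne hsep t.2 hij), ix_swap, Equiv.swap_apply_right,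
    map_add, map_smul]
  abel

omit hsep in
lemma lT_lC_far {i j a : Fin n} (hi : a ≠ i) (hj : a ≠ j) (f : Ambient K lam) :
    lT P lam i j (lC K lam a f) = lC K lam a (lT P lam i j f) := by
  ext t : 1
  simp only [lT_apply, lC_apply, ext0_lC, Xi_cl_far (isEig hsqrt h20 lam) (ix_ne _ hi) (ix_ne _ hj),
    ix_swap, Equiv.swap_apply_of_ne_of_ne hi hj, map_add, map_smul]

end NoT

/-- On the tensor factor of a diagonal box, `X` acts by the scalar `±1`. -/
lemma eigF_ix_of_isDiag (hq : P.q ≠ 0) (hq2 : P.q ^ 2 ≠ -1)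
    (hsqrt : ∀ a : K, P.sqrt a * P.sqrt a = a) (h20 : (2 : K) ≠ 0) {t : lam.cells ≃ Fin n}
    {a : Fin n} (ha : (bx t a).IsDiag) (β : Fin n → ZMod 2) :
    eigF P lam (ix t a) β = P.charge k (bx t a).comp := by
  have h4 := charge_strict P (bx t a).comp ha.1
  have h5 : P.qf (P.boxRes (bx t a)) = 2 * P.charge k (bx t a).comp := by
    rw [boxRes_diag P ha, qf_of_sq P hq hq2 h4]
  have h6 : P.sqrt (P.qf (P.boxRes (bx t a)) ^ 2 / 4 - 1) = 0 := by
    rw [← mul_self_eq_zero, hsqrt, h5]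
    have : (4 : K) = 2 * 2 := by norm_num
    rw [this, sub_eq_zero, div_eq_iff (mul_ne_zero h20 h20)]
    linear_combination 4 * h4
  rw [eigF, Params.eig, res_ix, Params.bPlus, Params.bMinus, h6, h5]
  simp [h20]

section Braid

variable (hsep : ∀ mu : Shape k m (n + 1), P.IsSeparate mu) (hq : P.q ≠ 0)
  (hq2 : P.q ^ 2 ≠ -1) (hQ : ∀ i, P.Q i ≠ 0) (hsqrt : ∀ a : K, P.sqrt a * P.sqrt a = a)
  (h20 : (2 : K) ≠ 0)

include hsep hq hq2 hQ hsqrt h20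

/-- The relation `T_i T_a = T_a T_i` for disjoint pairs of entries, with `j = i + 1` and
`b = a + 1`. -/
lemma lT_comm {i j a b : Fin n} (hij : (j : ℕ) = i + 1) (hab : (b : ℕ) = a + 1)
    (hia : i ≠ a) (hib : i ≠ b) (hja : j ≠ a) (hjb : j ≠ b) (f : Ambient K lam) :
    lT P lam i j (lT P lam a b f) = lT P lam a b (lT P lam i j f) := by
  have hx := isEig hsqrt h20 lam
  ext t : 1
  have h1 : (t.1.trans (Equiv.swap i j)).trans (Equiv.swap a b) =
      (t.1.trans (Equiv.swap a b)).trans (Equiv.swap i j) := by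
    ext c
    simp only [Equiv.trans_apply]
    congr 1
    simp only [Equiv.swap_apply_def]
    split_ifs <;> simp_all
  rw [lT_apply, lT_apply, om_smul_ext0_lT hsep hq hq2 hQ hsqrt t.2 hij, lT_apply a b _ t,
    om_smul_ext0_lT hsep hq hq2 hQ hsqrt t.2 hab, lT_apply i j, map_add, map_add,
    Equiv.swap_apply_of_ne_of_ne hia.symm hja.symm, Equiv.swap_apply_of_ne_of_ne hib.symm hjb.symm,
    Equiv.swap_apply_of_ne_of_ne hia hib, Equiv.swap_apply_of_ne_of_ne hja hjb, map_smul, map_smul,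
    h1, smul_add, smul_add, smul_comm (om P lam (ix t.1 a) (ix t.1 b)),
    Xi_comm hx (ix_ne _ hia) (ix_ne _ hib) (ix_ne _ hja) (ix_ne _ hjb)]
  abel

/-- The relation between the coefficients of the identity in the braid relation, when the three
boxes are connected. -/
lemma Xi_braid_of_blocked {t : lam.cells ≃ Fin n} (ht : IsStandard lam t) {i j l : Fin n}
    (hij : (j : ℕ) = i + 1) (hjl : (l : ℕ) = j + 1) (h : Blocked (bx t i) (bx t j))
    (h' : Blocked (bx t j) (bx t l)) (f : Tens K n) :
    Xi P.eps (eigF P lam) (ix t i) (ix t j) (Xi P.eps (eigF P lam) (ix t j) (ix t l)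
      (Xi P.eps (eigF P lam) (ix t i) (ix t j) f)) =
    Xi P.eps (eigF P lam) (ix t j) (ix t l) (Xi P.eps (eigF P lam) (ix t i) (ix t j)
      (Xi P.eps (eigF P lam) (ix t j) (ix t l) f)) := by
  refine Xi_braid_of_gf (isEig hsqrt h20 lam) (uF_ne hsep ht hij) (uF_ne hsep ht hjl)
    (ix_ne t (by rw [Ne, Fin.ext_iff]; omega)) ?_ f
  rw [uF_ix, uF_ix, uF_ix]
  have hqq : ∀ x : K, P.q ^ (-2 : ℤ) * (P.q ^ (2 : ℤ) * x) = x := fun x => by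
    rw [← mul_assoc, ← zpow_add₀ hq]; simp
  have hqq' : ∀ x : K, P.q ^ (2 : ℤ) * (P.q ^ (-2 : ℤ) * x) = x := fun x => by
    rw [← mul_assoc, ← zpow_add₀ hq]; simp
  have h0 := boxRes_ne_zero P (bx t j) hq hQ
  rcases blocked_chain ht hij hjl h h' with ⟨h1, h2⟩ | ⟨h1, h2⟩ | ⟨h1, h2, h3⟩
  · left
    have e1 := boxRes_right P (bx t i) hq
    have e2 := boxRes_right P (bx t j) hq
    rw [← h1] at e1
    have e3 : bx t l = ⟨(bx t j).comp, (bx t j).row, (bx t j).col + 1⟩ := by rw [h1, h2]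
    rw [← e3] at e2
    rw [gf_symm, e2, ← hqq (P.boxRes (bx t i)), ← e1]
    exact gf_eq_zero P hq hq2 h0
  · left
    have e1 := boxRes_down P (bx t i) hq
    have e2 := boxRes_down P (bx t j) hq
    rw [← h1] at e1
    have e3 : bx t l = ⟨(bx t j).comp, (bx t j).row + 1, (bx t j).col⟩ := by rw [h1, h2]
    rw [← e3] at e2
    rw [e2, ← hqq' (P.boxRes (bx t i)), ← e1]
    exact gf_eq_zero P hq hq2 h0
  · right
    intro β
    rw [eigF_ix_of_isDiag hq hq2 hsqrt h20 h1, eigF_ix_of_isDiag hq hq2 hsqrt h20 h2, ← h3]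
    exact ⟨eq_inv_of_mul_eq_one_left (charge_strict P _ h1.1), rfl⟩

/-- The braid relation. Each side, evaluated at `t`, is a sum over the eight paths that start at `t`
and at each step stay or exchange two entries; a path through a nonstandard tableau contributes
zero. -/
lemma lT_braid {i j l : Fin n} (hij : (j : ℕ) = i + 1) (hjl : (l : ℕ) = j + 1)
    (f : Ambient K lam) :
    lT P lam i j (lT P lam j l (lT P lam i j f)) =
      lT P lam j l (lT P lam i j (lT P lam j l f)) := by
  have hx := isEig hsqrt h20 lam
  have nij : i ≠ j := by rw [Ne, Fin.ext_iff]; omega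
  have njl : j ≠ l := by rw [Ne, Fin.ext_iff]; omega
  have nil : i ≠ l := by rw [Ne, Fin.ext_iff]; omega
  ext t : 1
  suffices h : ext0 (lT P lam i j (lT P lam j l (lT P lam i j f))) t.1 =
      ext0 (lT P lam j l (lT P lam i j (lT P lam j l f))) t.1 by
    rwa [ext0_std, ext0_std] at h
  have ht := t.2
  generalize t.1 = t at ht ⊢
  obtain ⟨s, hs⟩ : ∃ s, Equiv.swap i j = s := ⟨_, rfl⟩
  obtain ⟨r, hr⟩ : ∃ r, Equiv.swap j l = r := ⟨_, rfl⟩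
  have si : s i = j := hs ▸ Equiv.swap_apply_left _ _
  have sj : s j = i := hs ▸ Equiv.swap_apply_right _ _
  have sl : s l = l := hs ▸ Equiv.swap_apply_of_ne_of_ne nil.symm njl.symm
  have ri : r i = i := hr ▸ Equiv.swap_apply_of_ne_of_ne nij nil
  have rj : r j = l := hr ▸ Equiv.swap_apply_left _ _
  have rl : r l = j := hr ▸ Equiv.swap_apply_right _ _
  have hss : (t.trans s).trans s = t := by ext a; simp [← hs]
  have hrr : (t.trans r).trans r = t := by ext a; simp [← hr]
  have hbraid : ((t.trans s).trans r).trans s = ((t.trans r).trans s).trans r := by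
    ext a : 1
    simp only [Equiv.trans_apply]
    generalize t a = c
    by_cases h1 : c = i
    · rw [h1, si, rj, sl, ri, si, rj]
    by_cases h2 : c = j
    · rw [h2, sj, ri, si, rj, sl, rl]
    by_cases h3 : c = l
    · rw [h3, sl, rl, sj, ri]
    · have e1 : s c = c := hs ▸ Equiv.swap_apply_of_ne_of_ne h1 h2
      have e2 : r c = c := hr ▸ Equiv.swap_apply_of_ne_of_ne h2 h3
      rw [e1, e2, e1]
      exact e2.symm
  -- expansion of `T_i` and `T_j` along the paths that start at `t`
  have at_t1 (g) : ext0 (lT P lam i j g) t =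
      Xi P.eps (eigF P lam) (ix t i) (ix t j) (ext0 g t) +
        om P lam (ix t i) (ix t j) • ext0 g (t.trans s) := hs ▸ ext0_lT i j g ht
  have at_t2 (g) : ext0 (lT P lam j l g) t =
      Xi P.eps (eigF P lam) (ix t j) (ix t l) (ext0 g t) +
        om P lam (ix t j) (ix t l) • ext0 g (t.trans r) := hr ▸ ext0_lT j l g ht
  have at_s1 (g) : om P lam (ix t i) (ix t j) • ext0 (lT P lam i j g) (t.trans s) =
      om P lam (ix t i) (ix t j) • (Xi P.eps (eigF P lam) (ix t j) (ix t i) (ext0 g (t.trans s)) +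
        om P lam (ix t i) (ix t j) • ext0 g t) := by
    have := om_smul_ext0_lT hsep hq hq2 hQ hsqrt ht hij i j g
    rwa [hs, si, sj, om_comm (ix t j), hss] at this
  have at_s2 (g) : om P lam (ix t i) (ix t j) • ext0 (lT P lam j l g) (t.trans s) =
      om P lam (ix t i) (ix t j) • (Xi P.eps (eigF P lam) (ix t i) (ix t l) (ext0 g (t.trans s)) +
        om P lam (ix t i) (ix t l) • ext0 g ((t.trans s).trans r)) := by
    have := om_smul_ext0_lT hsep hq hq2 hQ hsqrt ht hij j l g
    rwa [hs, hr, sj, sl] at this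
  have at_r1 (g) : om P lam (ix t j) (ix t l) • ext0 (lT P lam i j g) (t.trans r) =
      om P lam (ix t j) (ix t l) • (Xi P.eps (eigF P lam) (ix t i) (ix t l) (ext0 g (t.trans r)) +
        om P lam (ix t i) (ix t l) • ext0 g ((t.trans r).trans s)) := by
    have := om_smul_ext0_lT hsep hq hq2 hQ hsqrt ht hjl i j g
    rwa [hs, hr, ri, rj] at this
  have at_r2 (g) : om P lam (ix t j) (ix t l) • ext0 (lT P lam j l g) (t.trans r) =
      om P lam (ix t j) (ix t l) • (Xi P.eps (eigF P lam) (ix t l) (ix t j) (ext0 g (t.trans r)) +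
        om P lam (ix t j) (ix t l) • ext0 g t) := by
    have := om_smul_ext0_lT hsep hq hq2 hQ hsqrt ht hjl j l g
    rwa [hr, rj, rl, om_comm (ix t l), hrr] at this
  have at_sr (g) : om P lam (ix t i) (ix t j) • om P lam (ix t i) (ix t l) •
      ext0 (lT P lam i j g) ((t.trans s).trans r) =
      om P lam (ix t i) (ix t j) • om P lam (ix t i) (ix t l) •
        (Xi P.eps (eigF P lam) (ix t j) (ix t l) (ext0 g ((t.trans s).trans r)) +
          om P lam (ix t j) (ix t l) • ext0 g (((t.trans s).trans r).trans s)) := by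
    by_cases h : IsStandard lam (t.trans (Equiv.swap i j))
    · have := om_smul_ext0_lT hsep hq hq2 hQ hsqrt h hjl i j g
      rw [ix_swap, ix_swap, ix_swap, ix_swap, hs, hr, sj, sl, ri, rj, si, sl] at this
      rw [this]
    · rw [om_eq_zero_of_not hsep hq hq2 hQ hsqrt ht hij h, zero_smul, zero_smul]
  have at_rs (g) : om P lam (ix t j) (ix t l) • om P lam (ix t i) (ix t l) •
      ext0 (lT P lam j l g) ((t.trans r).trans s) =
      om P lam (ix t j) (ix t l) • om P lam (ix t i) (ix t l) •
        (Xi P.eps (eigF P lam) (ix t i) (ix t j) (ext0 g ((t.trans r).trans s)) +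
          om P lam (ix t i) (ix t j) • ext0 g (((t.trans r).trans s).trans r)) := by
    by_cases h : IsStandard lam (t.trans (Equiv.swap j l))
    · have := om_smul_ext0_lT hsep hq hq2 hQ hsqrt h hij j l g
      rw [ix_swap, ix_swap, ix_swap, ix_swap, hs, hr, ri, rj, sj, sl, ri, rl] at this
      rw [this]
    · rw [om_eq_zero_of_not hsep hq hq2 hQ hsqrt ht hjl h, zero_smul, zero_smul]
  have lhs : ext0 (lT P lam i j (lT P lam j l (lT P lam i j f))) t =
      Xi P.eps (eigF P lam) (ix t i) (ix t j) (Xi P.eps (eigF P lam) (ix t j) (ix t l)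
        (Xi P.eps (eigF P lam) (ix t i) (ix t j) (ext0 f t))) +
      om P lam (ix t i) (ix t j) • Xi P.eps (eigF P lam) (ix t i) (ix t j)
        (Xi P.eps (eigF P lam) (ix t j) (ix t l) (ext0 f (t.trans s))) +
      om P lam (ix t j) (ix t l) • Xi P.eps (eigF P lam) (ix t i) (ix t j)
        (Xi P.eps (eigF P lam) (ix t i) (ix t l) (ext0 f (t.trans r))) +
      om P lam (ix t j) (ix t l) • om P lam (ix t i) (ix t l) •
        Xi P.eps (eigF P lam) (ix t i) (ix t j) (ext0 f ((t.trans r).trans s)) +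
      om P lam (ix t i) (ix t j) • Xi P.eps (eigF P lam) (ix t i) (ix t l)
        (Xi P.eps (eigF P lam) (ix t j) (ix t i) (ext0 f (t.trans s))) +
      om P lam (ix t i) (ix t j) • om P lam (ix t i) (ix t j) •
        Xi P.eps (eigF P lam) (ix t i) (ix t l) (ext0 f t) +
      om P lam (ix t i) (ix t j) • om P lam (ix t i) (ix t l) •
        Xi P.eps (eigF P lam) (ix t j) (ix t l) (ext0 f ((t.trans s).trans r)) +
      om P lam (ix t i) (ix t j) • om P lam (ix t i) (ix t l) • om P lam (ix t j) (ix t l) •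
        ext0 f (((t.trans s).trans r).trans s) := by
    rw [at_t1, at_s2, at_t2, at_t1, at_r1,
      smul_add (om P lam (ix t i) (ix t j)) (Xi P.eps (eigF P lam) (ix t i) (ix t l) _),
      ← (Xi P.eps (eigF P lam) (ix t i) (ix t l)).map_smul (om P lam (ix t i) (ix t j))
        (ext0 (lT P lam i j f) (t.trans s)), at_s1, at_sr]
    simp only [map_add, map_smul, smul_add]
    abel
  have rhs : ext0 (lT P lam j l (lT P lam i j (lT P lam j l f))) t =
      Xi P.eps (eigF P lam) (ix t j) (ix t l) (Xi P.eps (eigF P lam) (ix t i) (ix t j)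
        (Xi P.eps (eigF P lam) (ix t j) (ix t l) (ext0 f t))) +
      om P lam (ix t j) (ix t l) • Xi P.eps (eigF P lam) (ix t j) (ix t l)
        (Xi P.eps (eigF P lam) (ix t i) (ix t j) (ext0 f (t.trans r))) +
      om P lam (ix t i) (ix t j) • Xi P.eps (eigF P lam) (ix t j) (ix t l)
        (Xi P.eps (eigF P lam) (ix t i) (ix t l) (ext0 f (t.trans s))) +
      om P lam (ix t i) (ix t j) • om P lam (ix t i) (ix t l) •
        Xi P.eps (eigF P lam) (ix t j) (ix t l) (ext0 f ((t.trans s).trans r)) +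
      om P lam (ix t j) (ix t l) • Xi P.eps (eigF P lam) (ix t i) (ix t l)
        (Xi P.eps (eigF P lam) (ix t l) (ix t j) (ext0 f (t.trans r))) +
      om P lam (ix t j) (ix t l) • om P lam (ix t j) (ix t l) •
        Xi P.eps (eigF P lam) (ix t i) (ix t l) (ext0 f t) +
      om P lam (ix t j) (ix t l) • om P lam (ix t i) (ix t l) •
        Xi P.eps (eigF P lam) (ix t i) (ix t j) (ext0 f ((t.trans r).trans s)) +
      om P lam (ix t j) (ix t l) • om P lam (ix t i) (ix t l) • om P lam (ix t i) (ix t j) •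
        ext0 f (((t.trans r).trans s).trans r) := by
    rw [at_t2, at_r1, at_t1, at_t2, at_s2,
      smul_add (om P lam (ix t j) (ix t l)) (Xi P.eps (eigF P lam) (ix t i) (ix t l) _),
      ← (Xi P.eps (eigF P lam) (ix t i) (ix t l)).map_smul (om P lam (ix t j) (ix t l))
        (ext0 (lT P lam j l f) (t.trans r)), at_r2, at_rs]
    simp only [map_add, map_smul, smul_add]
    abel
  rw [lhs, rhs, hbraid]
  by_cases hac : uF P lam (ix t i) ≠ uF P lam (ix t l)
  · have hab := uF_ne hsep ht hij
    have hbc := uF_ne hsep ht hjl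
    have h1 := Xi_yangBaxter (ε := P.eps) hx hab hbc hac (ext0 f (t.trans s))
    have h2 := Xi_yangBaxter (ε := P.eps) hx hac hbc.symm hab (ext0 f (t.trans r))
    have h3 := Xi_braid_of_ne (ε := P.eps) hx hab hbc hac (ext0 f t)
    have h4 := Xi_add_swap (ε := P.eps) hx hbc
      (Xi P.eps (eigF P lam) (ix t i) (ix t j) (ext0 f (t.trans r)))
    have h5 := Xi_add_swap (ε := P.eps) hx hac (ext0 f (t.trans r))
    have h6 := congrArg (Xi P.eps (eigF P lam) (ix t i) (ix t j)) h5
    rw [map_add, map_smul] at h6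
    rw [← om_mul_self hsqrt, ← om_mul_self hsqrt] at h3
    linear_combination (norm := module) (1 : K) • h3 + om P lam (ix t i) (ix t j) • h1 +
      om P lam (ix t j) (ix t l) • (h6 - h4 - h2)
  · -- the entries cannot be swapped: otherwise the outer ones could be made consecutive
    have hs0 : ¬ IsStandard lam (t.trans (Equiv.swap i j)) := fun h => hac (by
      have := uF_ne hsep h hjl
      rwa [ix_swap, ix_swap, hs, sj, sl] at this)
    have hr0 : ¬ IsStandard lam (t.trans (Equiv.swap j l)) := fun h => hac (by
      have := uF_ne hsep h hij
      rwa [ix_swap, ix_swap, hr, ri, rj] at this)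
    rw [om_eq_zero_of_not hsep hq hq2 hQ hsqrt ht hij hs0,
      om_eq_zero_of_not hsep hq hq2 hQ hsqrt ht hjl hr0]
    rw [isStandard_swap_iff ht hij, not_not] at hs0
    rw [isStandard_swap_iff ht hjl, not_not] at hr0
    simp only [zero_smul, smul_zero, add_zero]
    exact Xi_braid_of_blocked hsep hq hq2 hQ hsqrt h20 ht hij hjl hs0 hr0 _

end Braid

end Relations

end HeckeClifford

namespace HeckeClifford

/-! ### The cyclotomic relation -/

section Cyclotomic

variable {K : Type*} [Field K] {k : Kind} {m n : ℕ} {P : Params K m} {lam : Shape k m (n + 1)}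

/-- The charge of a strict component is a zero of `g`. -/
lemma strictFactor_charge (l : Fin (k.numStrict + m)) (hl : (l : ℕ) < k.numStrict) :
    strictFactor (P.charge k l) k = 0 := by
  obtain ⟨l, rfl⟩ : ∃ i, l = Fin.castAdd m i := ⟨⟨l, hl⟩, rfl⟩
  rw [Params.charge, Fin.append_left]
  cases k with
  | zero => exact l.elim0
  | s => simp [strictFactor, Params.strictCharge]
  | ss =>
    have : ∀ l : Fin 2, l = 0 ∨ l = 1 := by decide
    have := this l
    rcases this with rfl | rfl <;> simp [strictFactor, Params.strictCharge]

lemma strictFactor_lX (a : Fin (n + 1)) (f : Ambient K lam) (t : Std lam)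
    (β : Fin (n + 1) → ZMod 2) :
    strictFactor (lX P lam a) k f t β =
      strictFactor (eigF P lam (ix t.1 a) β) k * f t β := by
  cases k <;> simp [strictFactor, lX_apply] <;> ring

lemma prod_map_apply {ι : Type*} (L : List ι) (g : ι → Module.End K (Ambient K lam)) (c : ι → K)
    (t : Std lam) (β : Fin (n + 1) → ZMod 2) (h : ∀ i f, g i f t β = c i * f t β)
    (f : Ambient K lam) : (L.map g).prod f t β = (L.map c).prod * f t β := by
  induction L with
  | nil => simp
  | cons i L ih => simp [h, ih, mul_assoc]

/-- The relation `f(X_1) = 0`: the first box of a standard tableau is in the corner of its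
component, so one of the factors vanishes. -/
lemma cyclotomic (hq : P.q ≠ 0) (hq2 : P.q ^ 2 ≠ -1)
    (hsqrt : ∀ a : K, P.sqrt a * P.sqrt a = a) (h20 : (2 : K) ≠ 0) :
    strictFactor (lX P lam 0) k * (List.ofFn fun i : Fin m => lX P lam 0 + lXinv P lam 0 -
      algebraMap K (Module.End K (Ambient K lam)) (P.qf (P.Q i))).prod = 0 := by
  refine LinearMap.ext fun f => ?_
  ext t β
  have hx := isEig hsqrt h20 lam
  rw [Module.End.mul_apply, strictFactor_lX, List.ofFn_eq_map,
    prod_map_apply _ _ (fun i => uF P lam (ix t.1 0) - P.qf (P.Q i)) t β]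
  · obtain ⟨hr, hc⟩ := bx_zero t.2 (0 : Fin (n + 1)) rfl
    by_cases hl : (bx t.1 0).IsStrict
    · rw [eigF_ix_of_isDiag hq hq2 hsqrt h20 ⟨hl, by rw [hr, hc]⟩, strictFactor_charge _ hl]
      simp
    · obtain ⟨i, hi⟩ : ∃ i, (bx t.1 0).comp = Fin.natAdd k.numStrict i :=
        ⟨⟨(bx t.1 0).comp - k.numStrict, by have := (bx t.1 0).comp.2; simp at hl; omega⟩, by
          ext; simp at hl ⊢; omega⟩
      rw [List.prod_eq_zero (List.mem_map.2 ⟨i, List.mem_finRange i, ?_⟩)]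
      · simp
      · rw [uF_ix, Params.boxRes, hr, hc, hi, Params.charge, Fin.append_right]
        simp
  · intro i f
    rw [← hx.add_inv _ β]
    simp [lX_apply, lXinv_apply]
    ring

end Cyclotomic

/-! ### Stability of `𝔻(λ)` -/

section Projection

lemma pairProd_induction {α M : Type*} [Monoid M] {F : α → α → M} {p : M → Prop} (one : p 1) :
    ∀ l : List α, (∀ a ∈ l, ∀ b ∈ l, ∀ x, p x → p (F a b * x)) → p (pairProd F l)
  | [], _ => one
  | [_], _ => one
  | a :: b :: l, h => h a (by simp) b (by simp) _ (pairProd_induction one l fun c hc d hd =>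
      h c (by simp [hc]) d (by simp [hd]))

variable {K : Type*} [Field K] {k : Kind} {m n : ℕ} {P : Params K m} {lam : Shape k m n}

lemma mem_diagList {a : Fin n} : a ∈ diagList lam ↔ a ∈ diag lam := by
  simp [diagList]

lemma proj_cl (a : Fin n) (f : Tens K n) : P.proj lam (cl a f) = cl a (P.proj lam f) := by
  rw [Params.proj, LinearMap.smul_apply, LinearMap.smul_apply, map_smul]
  congr 1
  revert f
  refine pairProd_induction (p := fun A : Module.End K (Tens K n) => ∀ f, A (cl a f) = cl a (A f))
    (fun f => rfl) _ fun b _ c _ A hA f => ?_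
  simp [hA, cl_rightCliff]

/-- The projection commutes with diagonal operators that do not depend on the tensor factors of
the diagonal boxes. -/
lemma proj_mul {φ : Tens K n} (hφ : ∀ c ∈ diag lam, ∀ β, φ (β + e c) = φ β) (f : Tens K n) :
    P.proj lam (φ * f) = φ * P.proj lam f := by
  rw [Params.proj, LinearMap.smul_apply, LinearMap.smul_apply, mul_smul_comm]
  congr 1
  revert f
  refine pairProd_induction (p := fun A : Module.End K (Tens K n) => ∀ f, A (φ * f) = φ * A f)
    (fun f => rfl) _ fun b hb c hc A hA f => ?_
  have h (c) (hc : c ∈ diagList lam) : (fun β => φ (β + e c)) = φ :=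
    funext (hφ c (mem_diagList.1 hc))
  simp [hA, rightCliff_mul, h b hb, h c hc, mul_sub]

lemma proj_parity (f : Tens K n) :
    P.proj lam ((fun β => sgn K (deg β)) * f) = (fun β => sgn K (deg β)) * P.proj lam f := by
  rw [Params.proj, LinearMap.smul_apply, LinearMap.smul_apply, mul_smul_comm]
  congr 1
  revert f
  refine pairProd_induction (p := fun A : Module.End K (Tens K n) => ∀ f : Tens K n,
    A ((fun β => sgn K (deg β)) * f) = (fun β => sgn K (deg β)) * A f)
    (fun f => rfl) _ fun b hb c hc A hA f => ?_
  have h (c : Fin n) : (fun β : Fin n → ZMod 2 => sgn K (deg (β + e c))) =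
      -fun β => sgn K (deg β) := by
    ext β; simp [deg_add, deg_e, sgn_add]
  simp [hA, rightCliff_mul, h, mul_sub]

lemma mem_D {f : Ambient K lam} : f ∈ P.D lam ↔ ∀ t, f t ∈ P.L lam := by
  simp [Params.D, Submodule.mem_pi]

lemma mul_mem_L {φ f : Tens K n} (hφ : ∀ c ∈ diag lam, ∀ β, φ (β + e c) = φ β)
    (hf : f ∈ P.L lam) : φ * f ∈ P.L lam := by
  obtain ⟨g, rfl⟩ := hf
  exact ⟨φ * g, proj_mul hφ g⟩

lemma cl_mem_L (a : Fin n) {f : Tens K n} (hf : f ∈ P.L lam) : cl a f ∈ P.L lam := by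
  obtain ⟨g, rfl⟩ := hf
  exact ⟨cl a g, proj_cl a g⟩

lemma lC_mem_D (a : Fin n) {f : Ambient K lam} (hf : f ∈ P.D lam) : lC K lam a f ∈ P.D lam :=
  mem_D.2 fun t => cl_mem_L _ (mem_D.1 hf t)

lemma ext0_mem_L {f : Ambient K lam} (hf : f ∈ P.D lam) (t : lam.cells ≃ Fin n) :
    ext0 f t ∈ P.L lam := by
  by_cases h : IsStandard lam t
  · rw [ext0_of f h]
    exact mem_D.1 hf _
  · rw [ext0_of_not f h]
    exact Submodule.zero_mem _

lemma parity_mem_D {f : Ambient K lam} (hf : f ∈ P.D lam) : parity f ∈ P.D lam :=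
  mem_D.2 fun t => by
    obtain ⟨g, hg⟩ := mem_D.1 hf t
    exact ⟨_, (proj_parity g).trans (by rw [hg]; rfl)⟩

variable (hq : P.q ≠ 0) (hq2 : P.q ^ 2 ≠ -1) (hsqrt : ∀ a : K, P.sqrt a * P.sqrt a = a)
  (h20 : (2 : K) ≠ 0)

include hq hq2 hsqrt h20

lemma eigF_add_e_diag {c : Fin n} (hc : c ∈ diag lam) (a : Fin n) (β : Fin n → ZMod 2) :
    eigF P lam a (β + e c) = eigF P lam a β := by
  by_cases h : a = c
  · subst h
    have h1 : ix (initial lam).1 a = a := Equiv.apply_symm_apply _ _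
    have h2 : (bx (initial lam).1 a).IsDiag := (Finset.mem_filter.1 hc).2
    have h3 := eigF_ix_of_isDiag (P := P) hq hq2 hsqrt h20 h2
    rw [h1] at h3
    rw [h3, h3]
  · exact (isEig hsqrt h20 lam).const a c β h

lemma lX_mem_D (a : Fin n) {f : Ambient K lam} (hf : f ∈ P.D lam) : lX P lam a f ∈ P.D lam :=
  mem_D.2 fun t => mul_mem_L (fun _ hc _ => eigF_add_e_diag hq hq2 hsqrt h20 hc _ _) (mem_D.1 hf t)

lemma lXinv_mem_D (a : Fin n) {f : Ambient K lam} (hf : f ∈ P.D lam) :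
    lXinv P lam a f ∈ P.D lam :=
  mem_D.2 fun t => mul_mem_L (fun _ hc _ =>
    by rw [Pi.inv_apply, Pi.inv_apply, eigF_add_e_diag hq hq2 hsqrt h20 hc]) (mem_D.1 hf t)

lemma lT_mem_D (i j : Fin n) {f : Ambient K lam} (hf : f ∈ P.D lam) : lT P lam i j f ∈ P.D lam :=
  mem_D.2 fun t => by
    have h {c} (hc) := eigF_add_e_diag (P := P) (lam := lam) (c := c) hq hq2 hsqrt h20 hc
    rw [lT_apply, Xi_apply]
    refine add_mem (add_mem (mul_mem_L (fun c hc β => ?_) (mem_D.1 hf t))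
      (mul_mem_L (fun c hc β => ?_) (cl_mem_L _ (cl_mem_L _ (mem_D.1 hf t)))))
      (Submodule.smul_mem _ _ (ext0_mem_L hf _))
    · simp only [h hc]
    · simp only [h hc]

end Projection

end HeckeClifford

namespace HeckeClifford

/-! ### The representation -/

section Representation

variable {K : Type*} [Field K] {k : Kind} {m N : ℕ} {P : Params K m} {lam : Shape k m (N + 1)}

variable (P lam) in
/-- The operators of the generators on the direct sum of twisted tensor products. -/
noncomputable def genOp : Gen N → Module.End K (Ambient K lam)
  | .T i => lT P lam i.castSucc i.succ
  | .X a => lX P lam a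
  | .Xinv a => lXinv P lam a
  | .C a => lC K lam a

variable (hsep : ∀ mu : Shape k m (N + 1 + 1), P.IsSeparate mu) (hq : P.q ≠ 0)
  (hq2 : P.q ^ 2 ≠ -1) (hQ : ∀ i, P.Q i ≠ 0) (hsqrt : ∀ a : K, P.sqrt a * P.sqrt a = a)
  (h20 : (2 : K) ≠ 0)

include hsep hq hq2 hQ hsqrt h20 in
lemma genOp_rel {x y : FreeAlgebra K (Gen N)} (h : AffineRel P.eps N x y) :
    FreeAlgebra.lift K (genOp P lam) x = FreeAlgebra.lift K (genOp P lam) y := by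
  have hsucc (i : Fin N) : ((i.succ : Fin (N + 1)) : ℕ) = (i.castSucc : Fin (N + 1)) + 1 := by simp
  refine LinearMap.ext fun f => ?_
  cases h with
  | quad i => simpa [genOp] using lT_sq hsep hq hq2 hQ hsqrt h20 (hsucc i) f
  | far i j h =>
    simpa [genOp] using lT_comm hsep hq hq2 hQ hsqrt h20 (hsucc i) (hsucc j)
      (by rw [Ne, Fin.ext_iff]; simp; omega) (by rw [Ne, Fin.ext_iff]; simp; omega)
      (by rw [Ne, Fin.ext_iff]; simp; omega) (by rw [Ne, Fin.ext_iff]; simp; omega) f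
  | braid i j h =>
    have h1 : j.castSucc = i.succ := by ext; simp [h]
    have h2 := lT_braid hsep hq hq2 hQ hsqrt h20 (hsucc i) (h1 ▸ hsucc j) f
    simpa [genOp, h1] using h2
  | XX i j => simpa [genOp] using lX_lX i j f
  | XXinv i => simpa [genOp] using lX_lXinv hsqrt h20 i f
  | XinvX i => simpa [genOp] using lXinv_lX hsqrt h20 i f
  | CC_self i => simpa [genOp] using lC_lC_self i f
  | CC i j h => simpa [genOp] using lC_lC h f
  | TX i => simpa [genOp] using lT_lX hsqrt h20 hsep (hsucc i) f
  | TX_succ i => simpa [genOp] using lT_lX_succ hsqrt h20 hsep (hsucc i) f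
  | TX_far i j h h' => simpa [genOp] using lT_lX_far hsqrt h20 h h' f
  | TC i => simpa [genOp] using lT_lC hsqrt h20 (Fin.castSucc_lt_succ (i := i)).ne f
  | TC_succ i => simpa [genOp] using lT_lC_succ hsqrt h20 hsep (hsucc i) f
  | TC_far i j h h' => simpa [genOp] using lT_lC_far hsqrt h20 h h' f
  | XC_self i => simpa [genOp] using lX_lC_self hsqrt h20 i f
  | XC i j h => simpa [genOp] using lX_lC hsqrt h20 h f

/-- The action of the affine algebra on the direct sum of twisted tensor products. -/
noncomputable def affineRep : Affine P N →ₐ[K] Module.End K (Ambient K lam) :=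
  RingQuot.liftAlgHom K ⟨FreeAlgebra.lift K (genOp P lam),
    fun _ _ h => genOp_rel hsep hq hq2 hQ hsqrt h20 h⟩

lemma affineRep_gen (g : Gen N) :
    affineRep hsep hq hq2 hQ hsqrt h20 (affineGen P g) = genOp P lam g := by
  rw [affineRep, affineGen, RingQuot.liftAlgHom_mkAlgHom_apply, FreeAlgebra.lift_ι_apply]

lemma affineRep_cycElement :
    affineRep (lam := lam) hsep hq hq2 hQ hsqrt h20 (cycElement P k N) = 0 := by
  rw [cycElement, map_mul, ← cyclotomic (P := P) (lam := lam) hq hq2 hsqrt h20, map_list_prod,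
    List.map_ofFn]
  congr 1
  · cases k <;> simp [strictFactor, affineRep_gen, genOp]
  · congr 2
    ext i : 1
    simp only [Function.comp_apply, map_sub, map_add, affineRep_gen, genOp, AlgHom.commutes]

/-- The action of the cyclotomic algebra on the direct sum of twisted tensor products. -/
noncomputable def cycRep : Cyc P k N →ₐ[K] Module.End K (Ambient K lam) :=
  RingQuot.liftAlgHom K ⟨affineRep hsep hq hq2 hQ hsqrt h20, fun _ _ h => by
    cases h
    rw [affineRep_cycElement, map_zero]⟩

lemma cycRep_gen (g : Gen N) :
    cycRep hsep hq hq2 hQ hsqrt h20 (gen P k g) = genOp P lam g := by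
  rw [cycRep, gen, RingQuot.liftAlgHom_mkAlgHom_apply, affineRep_gen]

include hq hq2 hsqrt h20 in
lemma genOp_mem_D (g : Gen N) {f : Ambient K lam} (hf : f ∈ P.D lam) :
    genOp P lam g f ∈ P.D lam := by
  cases g with
  | T i => exact lT_mem_D hq hq2 hsqrt h20 _ _ hf
  | X a => exact lX_mem_D hq hq2 hsqrt h20 _ hf
  | Xinv a => exact lXinv_mem_D hq hq2 hsqrt h20 _ hf
  | C a => exact lC_mem_D _ hf

/-- Every element of the cyclotomic algebra is a polynomial in the generators. -/
lemma cyc_induction {p : Cyc P k N → Prop} (scalar : ∀ r, p (algebraMap K _ r))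
    (generator : ∀ g, p (gen P k g)) (mul : ∀ a b, p a → p b → p (a * b))
    (add : ∀ a b, p a → p b → p (a + b)) (a : Cyc P k N) : p a := by
  obtain ⟨b, rfl⟩ := RingQuot.mkAlgHom_surjective K (CycRel P k N) a
  obtain ⟨c, rfl⟩ := RingQuot.mkAlgHom_surjective K (AffineRel P.eps N) b
  induction c using FreeAlgebra.induction with
  | grade0 r => simpa using scalar r
  | grade1 g => exact generator g
  | mul a b ha hb => simpa using mul _ _ ha hb
  | add a b ha hb => simpa using add _ _ ha hb

lemma cycRep_mem_D (a : Cyc P k N) {f : Ambient K lam} (hf : f ∈ P.D lam) :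
    cycRep hsep hq hq2 hQ hsqrt h20 a f ∈ P.D lam := by
  revert f
  refine cyc_induction (p := fun a => ∀ {f : Ambient K lam}, f ∈ P.D lam →
    cycRep hsep hq hq2 hQ hsqrt h20 a f ∈ P.D lam) ?_ ?_ ?_ ?_ a
  · intro r f hf
    rw [AlgHom.commutes]
    exact Submodule.smul_mem _ r hf
  · intro g f hf
    rw [cycRep_gen]
    exact genOp_mem_D hq hq2 hsqrt h20 g hf
  · intro a b ha hb f hf
    rw [map_mul]
    exact ha (hb hf)
  · intro a b ha hb f hf
    rw [map_add]
    exact add_mem (ha hf) (hb hf)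

/-- The action of the cyclotomic algebra on `𝔻(λ)`. -/
noncomputable def rep : Cyc P k N →ₐ[K] Module.End K (P.D lam) where
  toFun a := (cycRep hsep hq hq2 hQ hsqrt h20 a).restrict
    fun _ hf => cycRep_mem_D hsep hq hq2 hQ hsqrt h20 a hf
  map_one' := by
    refine LinearMap.ext fun x => Subtype.ext ?_
    rw [LinearMap.coe_restrict_apply, map_one]; rfl
  map_mul' a b := by
    refine LinearMap.ext fun x => Subtype.ext ?_
    rw [LinearMap.coe_restrict_apply, map_mul]; rfl
  map_zero' := by
    refine LinearMap.ext fun x => Subtype.ext ?_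
    rw [LinearMap.coe_restrict_apply, map_zero]; rfl
  map_add' a b := by
    refine LinearMap.ext fun x => Subtype.ext ?_
    rw [LinearMap.coe_restrict_apply, map_add]; rfl
  commutes' r := by
    refine LinearMap.ext fun x => Subtype.ext ?_
    rw [LinearMap.coe_restrict_apply, AlgHom.commutes]; rfl

lemma rep_gen (g : Gen N) (x : P.D lam) :
    (rep hsep hq hq2 hQ hsqrt h20 (gen P k g) x : Ambient K lam) =
      genOp P lam g (x : Ambient K lam) := by
  rw [← cycRep_gen hsep hq hq2 hQ hsqrt h20 g]
  rfl

end Representation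

end HeckeClifford

namespace HeckeClifford

/-! ### Words in Clifford generators -/

section Words

variable {n : ℕ}

lemma zmod_two_induction {p : (Fin n → ZMod 2) → Prop} (zero : p 0)
    (add_e : ∀ β a, p β → p (β + e a)) (β : Fin n → ZMod 2) : p β := by
  have h : β = ∑ a ∈ Finset.univ.filter (β · = 1), e a := by
    ext i
    rw [Finset.sum_apply]
    rcases zmod_two_cases (β i) with h | h <;> simp [e, Pi.single_apply, Finset.sum_ite_eq, h]
  rw [h]
  generalize Finset.univ.filter (β · = 1) = S
  induction S using Finset.induction with
  | empty => exact zero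
  | insert a S ha ih =>
    rw [Finset.sum_insert ha, add_comm]
    exact add_e _ _ ih

/-- The product `c_1^{β_1} ⋯ c_n^{β_n}`. -/
def cword {A : Type*} [Monoid A] (c : Fin n → A) (β : Fin n → ZMod 2) : A :=
  (List.ofFn fun j => c j ^ (β j).val).prod

lemma cword_zero {A : Type*} [Monoid A] (c : Fin n → A) : cword c 0 = 1 := by
  simp [cword]

lemma cword_succ {A : Type*} [Monoid A] (c : Fin (n + 1) → A) (β : Fin (n + 1) → ZMod 2) :
    cword c β = c 0 ^ (β 0).val * cword (c ∘ Fin.succ) (β ∘ Fin.succ) := by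
  simp [cword]

lemma degLT_succ (β : Fin (n + 1) → ZMod 2) (i : Fin n) :
    degLT β i.succ = β 0 + degLT (β ∘ Fin.succ) i := by
  have h (n : ℕ) (β : Fin n → ZMod 2) (i : Fin n) :
      degLT β i = ∑ j, if j < i then β j else 0 := by
    rw [degLT, ← Finset.sum_filter, Finset.filter_gt_eq_Iio]
  rw [h, h, Fin.sum_univ_succ]
  simp

/-- The elements `c_i` generate a Clifford algebra: their squares are `1`, and they anticommute. -/
structure IsClifford {A : Type*} [Ring A] (c : Fin n → A) : Prop where
  mul_self : ∀ i, c i * c i = 1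
  anticomm : ∀ i j, i ≠ j → c i * c j = -(c j * c i)

variable (K : Type*) [Field K] {A : Type*} [Ring A] [Algebra K A] {c : Fin n → A}

lemma IsClifford.comp (h : IsClifford c) {n' : ℕ} {τ : Fin n' → Fin n}
    (hτ : Function.Injective τ) : IsClifford (c ∘ τ) where
  mul_self _ := h.mul_self _
  anticomm _ _ hij := h.anticomm _ _ (hτ.ne hij)

lemma IsClifford.isUnit_cword (h : IsClifford c) (β : Fin n → ZMod 2) : IsUnit (cword c β) := by
  refine List.prod_isUnit fun x hx => ?_
  obtain ⟨i, rfl⟩ := (List.mem_ofFn' _ _).1 hx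
  exact IsUnit.pow _ ⟨⟨c i, c i, h.mul_self i, h.mul_self i⟩, rfl⟩

/-- The sign comes from moving `c_i` past the letters `c_j` with `j < i`. -/
lemma IsClifford.mul_cword (h : IsClifford c) (i : Fin n) (β : Fin n → ZMod 2) :
    c i * cword c β = sgn K (degLT β i) • cword c (β + e i) := by
  induction n with
  | zero => exact i.elim0
  | succ n ih =>
    rw [cword_succ, cword_succ c (β + e i)]
    have h11 : (1 : ZMod 2) + 1 = 0 := by decide
    refine Fin.cases ?_ (fun i => ?_) i
    · have h0 : (β + e 0) ∘ Fin.succ = β ∘ Fin.succ := by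
        ext j; exact add_e_of_ne β (Fin.succ_ne_zero j)
      have h1 : degLT β 0 = 0 := Finset.sum_eq_zero fun j hj => by simp at hj
      rw [h0, h1, add_e_self, sgn_zero, one_smul, ← mul_assoc]
      congr 1
      rcases zmod_two_cases (β 0) with hb | hb <;> simp [hb, h11, h.mul_self, ZMod.val_one]
    · have h0 : (β + e i.succ) ∘ Fin.succ = β ∘ Fin.succ + e i := by
        ext j; simp [e, Pi.single_apply]
      have h1 : c i.succ * c 0 ^ (β 0).val =
          sgn K (β 0) • (c 0 ^ (β 0).val * c i.succ) := by
        rcases zmod_two_cases (β 0) with hb | hb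
        · simp [hb]
        · simp [hb, ZMod.val_one, h.anticomm _ _ (Fin.succ_ne_zero i)]
      have h2 := ih (h.comp (Fin.succ_injective n)) i (β ∘ Fin.succ)
      rw [Function.comp_apply] at h2
      rw [h0, add_e_of_ne β (Fin.succ_ne_zero i).symm, ← mul_assoc, h1, smul_mul_assoc, mul_assoc,
        h2, degLT_succ, sgn_add, mul_smul_comm, smul_smul]

lemma IsClifford.cword_add_e (h : IsClifford c) (i : Fin n) (β : Fin n → ZMod 2) :
    cword c (β + e i) = sgn K (degLT β i) • (c i * cword c β) := by
  rw [h.mul_cword K, smul_smul, sgn_mul_self, one_smul]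

lemma IsClifford.cword_mul (h : IsClifford c) (i : Fin n) (β : Fin n → ZMod 2) :
    cword c β * c i = sgn K (degGT β i) • cword c (β + e i) := by
  induction β using zmod_two_induction with
  | zero =>
    have h1 := h.mul_cword K i 0
    rw [cword_zero, mul_one] at h1
    rw [cword_zero, one_mul, h1]
    simp [degLT, degGT]
  | add_e β a ih =>
    rw [h.cword_add_e K a β, smul_mul_assoc, mul_assoc, ih, mul_smul_comm, h.mul_cword K,
      add_right_comm, smul_smul, smul_smul, degLT_add, degLT_e, degGT_add, degGT_e, sgn_add,
      sgn_add]
    congr 1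
    linear_combination sgn K (degGT β i) * sgn K (if i < a then 1 else 0) *
      sgn_mul_self K (degLT β a)

lemma degLT_add_degGT {β : Fin n → ZMod 2} {i : Fin n} (h : β i = 0) :
    degLT β i + degGT β i = deg β := by
  have h1 : Finset.univ.erase i = Finset.Iio i ∪ Finset.Ioi i := by
    ext j; simp [lt_or_lt_iff_ne]
  rw [degLT, degGT, deg, ← Finset.sum_union, ← h1, Finset.sum_erase _ h]
  exact Finset.disjoint_left.2 fun j hj hj' => lt_asymm (Finset.mem_Iio.1 hj) (Finset.mem_Ioi.1 hj')

lemma degLE_add_degGT (β : Fin n → ZMod 2) (i : Fin n) : degLE β i + degGT β i = deg β := by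
  have h1 : Finset.univ = Finset.Iic i ∪ Finset.Ioi i := by
    ext j; simp [le_or_gt]
  rw [degLE, degGT, deg, ← Finset.sum_union, ← h1]
  exact Finset.disjoint_left.2 fun j hj hj' =>
    (Finset.mem_Iic.1 hj).not_gt (Finset.mem_Ioi.1 hj')

lemma degLT_add_degGE (β : Fin n → ZMod 2) (i : Fin n) : degLT β i + degGE β i = deg β := by
  have h1 : Finset.univ = Finset.Iio i ∪ Finset.Ici i := by
    ext j; simp [lt_or_ge]
  rw [degLT, degGE, deg, ← Finset.sum_union, ← h1]
  exact Finset.disjoint_left.2 fun j hj hj' =>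
    (Finset.mem_Iio.1 hj).not_ge (Finset.mem_Ici.1 hj')

/-- A generator that does not occur in the word anticommutes with all its letters. -/
lemma IsClifford.mul_cword_comm (h : IsClifford c) {i : Fin n} {β : Fin n → ZMod 2}
    (hi : β i = 0) : c i * cword c β = sgn K (deg β) • (cword c β * c i) := by
  rw [h.mul_cword K, h.cword_mul K, smul_smul, ← degLT_add_degGT hi, sgn_add, mul_assoc,
    sgn_mul_self, mul_one]

/-- Adding `e a` to `β` changes `β_i β_j` by the difference of the sign exponents that arise after
and before the exchange of `i` and `j`. -/
lemma degLT_comp_swap (β : Fin n → ZMod 2) {i j : Fin n} (hij : (j : ℕ) = i + 1) (a : Fin n) :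
    degLT (β ∘ Equiv.swap i j) (Equiv.swap i j a) + degLT β a =
      (β + e a) i * (β + e a) j + β i * β j := by
  have hne : i ≠ j := by rw [Ne, Fin.ext_iff]; omega
  have hlt : i < j := by rw [Fin.lt_def]; omega
  have key : degLT (β ∘ Equiv.swap i j) (Equiv.swap i j a) =
      ∑ b ∈ Finset.univ.filter (fun b => Equiv.swap i j b < Equiv.swap i j a), β b := by
    rw [degLT]
    refine Finset.sum_bij (fun b _ => Equiv.swap i j b) ?_ ?_ ?_ ?_
    · intro b hb; simpa using hb
    · intro b _ b' _ h; exact (Equiv.swap i j).injective h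
    · intro b hb; exact ⟨Equiv.swap i j b, by simpa using hb, by simp⟩
    · intro b _; rfl
  rw [key]
  by_cases hai : a = i
  · subst hai
    have h1 : Finset.univ.filter (fun b => Equiv.swap a j b < Equiv.swap a j a) =
        insert j (Finset.Iio a) := by
      ext b
      simp only [Finset.mem_filter, Finset.mem_univ, true_and, Equiv.swap_apply_left,
        Finset.mem_insert, Finset.mem_Iio, Equiv.swap_apply_def, Fin.lt_def, Fin.ext_iff]
      split_ifs <;> omega
    rw [h1, Finset.sum_insert (by simp [hlt.le]), add_e_self, add_e_of_ne β hne.symm, degLT]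
    linear_combination CharTwo.add_self_eq_zero (∑ b ∈ Finset.Iio a, β b) -
      CharTwo.add_self_eq_zero (β a * β j)
  by_cases haj : a = j
  · subst haj
    have h1 : Finset.Iio a = insert i (Finset.univ.filter
        (fun b => Equiv.swap i a b < Equiv.swap i a a)) := by
      ext b
      simp only [Finset.mem_filter, Finset.mem_univ, true_and, Equiv.swap_apply_right,
        Finset.mem_insert, Finset.mem_Iio, Equiv.swap_apply_def, Fin.lt_def, Fin.ext_iff]
      split_ifs <;> omega
    rw [degLT, h1, Finset.sum_insert (by simp [hlt.le]), add_e_self, add_e_of_ne β hne]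
    linear_combination CharTwo.add_self_eq_zero (∑ b ∈ Finset.univ.filter
        (fun b => Equiv.swap i a b < Equiv.swap i a a), β b) -
      CharTwo.add_self_eq_zero (β a * β i)
  · have h1 : Finset.univ.filter (fun b => Equiv.swap i j b < Equiv.swap i j a) =
        Finset.Iio a := by
      ext b
      rw [Fin.ext_iff] at hai haj
      simp only [Finset.mem_filter, Finset.mem_univ, true_and, Finset.mem_Iio,
        Equiv.swap_apply_def, Fin.lt_def, Fin.ext_iff]
      split_ifs <;> omega
    rw [h1, add_e_of_ne β (Ne.symm hai), add_e_of_ne β (Ne.symm haj), degLT]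
    linear_combination CharTwo.add_self_eq_zero (∑ b ∈ Finset.Iio a, β b) -
      CharTwo.add_self_eq_zero (β i * β j)

/-- Exchanging two adjacent generators changes the sign of the words that contain both. -/
lemma IsClifford.cword_swap (h : IsClifford c) {i j : Fin n} (hij : (j : ℕ) = i + 1)
    (β : Fin n → ZMod 2) :
    cword (c ∘ Equiv.swap i j) (β ∘ Equiv.swap i j) = sgn K (β i * β j) • cword c β := by
  induction β using zmod_two_induction with
  | zero =>
    rw [Pi.zero_comp, cword_zero, cword_zero]
    simp
  | add_e β a ih =>
    have h1 : (β + e a) ∘ Equiv.swap i j = β ∘ Equiv.swap i j + e (Equiv.swap i j a) := by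
      ext b
      simp only [Function.comp_apply, Pi.add_apply, e, Pi.single_apply]
      simp only [Equiv.swap_apply_eq_iff]
    have h2 : (β + e a) i * (β + e a) j =
        degLT (β ∘ Equiv.swap i j) (Equiv.swap i j a) + degLT β a + β i * β j := by
      rw [degLT_comp_swap β hij]
      linear_combination -CharTwo.add_self_eq_zero (β i * β j)
    rw [h1, (h.comp (Equiv.swap i j).injective).cword_add_e K, ih, Function.comp_apply,
      Equiv.swap_apply_self, mul_smul_comm, h.mul_cword K, smul_smul, smul_smul, h2, sgn_add,
      sgn_add]
    congr 1
    ring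

end Words

end HeckeClifford

namespace HeckeClifford

/-! ### The vacuum vector -/

section Pairs

/-- `a` and `b` are consecutive members of the list, `a` being at an even position (positions
are counted from `0`): the pairs to which `pairProd` refers. -/
inductive IsPair {α : Type*} : List α → α → α → Prop
  | head (a b : α) (l : List α) : IsPair (a :: b :: l) a b
  | tail {x y a b : α} {l : List α} (h : IsPair l a b) : IsPair (x :: y :: l) a b

variable {α : Type*}

lemma IsPair.mem_left {l : List α} {a b : α} (h : IsPair l a b) : a ∈ l := by
  induction h with
  | head => simp
  | tail _ ih => simp [ih]

lemma IsPair.mem_right {l : List α} {a b : α} (h : IsPair l a b) : b ∈ l := by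
  induction h with
  | head => simp
  | tail _ ih => simp [ih]

lemma isPair_getElem : ∀ (l : List α) (p : ℕ) (h : 2 * p + 1 < l.length),
    IsPair l (l[2 * p]'(by omega)) l[2 * p + 1]
  | a :: b :: l, 0, _ => IsPair.head a b l
  | a :: b :: l, p + 1, h => IsPair.tail (isPair_getElem l p (by simp at h; omega))

lemma IsPair.exists_getElem {l : List α} {a b : α} (h : IsPair l a b) :
    ∃ (p : ℕ) (h : 2 * p + 1 < l.length), l[2 * p]'(by omega) = a ∧ l[2 * p + 1] = b := by
  induction h with
  | head a b l => exact ⟨0, by simp, rfl, rfl⟩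
  | tail _ ih =>
    obtain ⟨p, hp, h1, h2⟩ := ih
    exact ⟨p + 1, by simp; omega, h1, h2⟩

variable {K V : Type*} [Field K] [AddCommGroup V] [Module K V]

lemma pairProd_eq_pow_smul {F : α → α → Module.End K V} {x : V} {r : K} :
    ∀ {l : List α}, (∀ a b, IsPair l a b → F a b x = r • x) →
      pairProd F l x = r ^ (l.length / 2) • x
  | [], _ => by simp [pairProd]
  | [_], _ => by simp [pairProd]
  | a :: b :: l, h => by
    rw [pairProd, Module.End.mul_apply, pairProd_eq_pow_smul fun a b h' => h a b (.tail h'),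
      map_smul, h a b (.head a b l), smul_smul, ← pow_succ]
    congr 2
    simp only [List.length_cons]
    omega

variable {n : ℕ} {I : K}

/-- The product of the operators `1 - I ρ_a ρ_b` over the pairs of a list. For `I = √-1` and
the list of the diagonal positions, this is the projection onto `𝕃` up to a power of `2`. -/
noncomputable def pairProj (I : K) (l : List (Fin n)) : Module.End K (Tens K n) :=
  pairProd (fun a b => 1 - I • (rightCliff a * rightCliff b)) l

lemma pairProj_cons_cons (I : K) (a b : Fin n) (l : List (Fin n)) (f : Tens K n) :
    pairProj I (a :: b :: l) f =
      pairProj I l f - I • rightCliff a (rightCliff b (pairProj I l f)) := rfl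

/-- Each factor `1 - I ρ_a ρ_b` absorbs `ρ_a ρ_b`, as `(ρ_a ρ_b)² = -1`. -/
lemma pairProj_rightCliff (hI : I * I = -1) (f : Tens K n) {l : List (Fin n)} (hl : l.Nodup)
    {a b : Fin n} (h : IsPair l a b) :
    pairProj I l (rightCliff a (rightCliff b f)) = I • pairProj I l f := by
  induction h with
  | head a b l =>
    simp only [List.nodup_cons, List.mem_cons, not_or] at hl
    obtain ⟨⟨hab, hal⟩, hbl, -⟩ := hl
    -- the product over the other pairs commutes with `ρ_a ρ_b`
    have h : ∀ g : Tens K n, pairProj I l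
        (rightCliff a (rightCliff b g)) = rightCliff a (rightCliff b
          (pairProj I l g)) := by
      refine pairProd_induction (p := fun A : Module.End K (Tens K n) => ∀ g,
        A (rightCliff a (rightCliff b g)) = rightCliff a (rightCliff b (A g))) (fun g => rfl) l ?_
      intro c hc d hd A hA g
      have e (x y : Fin n) (hx : x = a ∨ x = b) (hy : y ∈ l) (g : Tens K n) :
          rightCliff x (rightCliff y g) = -rightCliff y (rightCliff x g) := by
        refine rightCliff_anticomm ?_ g
        rintro rfl
        rcases hx with rfl | rfl <;> contradiction
      have e' : rightCliff a (rightCliff b (rightCliff c (rightCliff d (A g)))) =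
          rightCliff c (rightCliff d (rightCliff a (rightCliff b (A g)))) := by
        rw [e b c (.inr rfl) hc, map_neg, e a c (.inl rfl) hc, neg_neg, e b d (.inr rfl) hd,
          map_neg, map_neg, e a d (.inl rfl) hd, map_neg, neg_neg]
      simp [hA, map_sub, e']
    rw [pairProj_cons_cons, pairProj_cons_cons, h]
    generalize pairProj I l f = g
    have e1 : rightCliff a (rightCliff b (rightCliff a (rightCliff b g))) = -g := by
      rw [rightCliff_anticomm hab (rightCliff a (rightCliff b g)), rightCliff_self,
        rightCliff_self]
    rw [e1, smul_sub, smul_smul, hI]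
    module
  | tail h ih =>
    simp only [List.nodup_cons] at hl
    rw [pairProj_cons_cons, pairProj_cons_cons, ih hl.2.2, map_smul, map_smul, smul_sub,
      smul_comm I I]

/-- Only words in the letters of the list occur in the image of `v_1 ⊗ ⋯ ⊗ v_n`. -/
lemma pairProj_single_eq_zero {l : List (Fin n)} {c : Fin n} (hc : c ∉ l)
    {β : Fin n → ZMod 2} (hβ : β c ≠ 0) :
    pairProj I l (Pi.single 0 1 : Tens K n) β =
      0 := by
  revert β
  refine pairProd_induction (p := fun A : Module.End K (Tens K n) => ∀ {β}, β c ≠ 0 →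
        A (Pi.single 0 1) β = 0) ?_ l ?_
  · intro β hβ
    exact Pi.single_eq_of_ne (by rintro rfl; exact hβ rfl) _
  · intro a ha b hb A hA β hβ
    have hca : c ≠ a := by rintro rfl; contradiction
    have hcb : c ≠ b := by rintro rfl; contradiction
    have h1 : (β + e a + e b) c ≠ 0 := by rwa [add_e_of_ne _ hcb, add_e_of_ne _ hca]
    simp [rightCliff_apply, hA hβ, hA h1]

/-- Among the words that omit the second member of each pair, only the empty one occurs in the image
of `v_1 ⊗ ⋯ ⊗ v_n`. -/
lemma pairProj_single {β : Fin n → ZMod 2} :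
    ∀ {l : List (Fin n)}, l.Nodup → (∀ a b, IsPair l a b → β b = 0) →
    pairProj I l (Pi.single 0 1 : Tens K n) β =
      (Pi.single 0 1 : Tens K n) β
  | [], _, _ => rfl
  | [_], _, _ => rfl
  | a :: b :: l, hl, h => by
    simp only [List.nodup_cons, List.mem_cons, not_or] at hl
    obtain ⟨⟨hab, hal⟩, hbl, hl⟩ := hl
    have h1 : (β + e a + e b) b ≠ 0 := by
      rw [add_e_self, add_e_of_ne _ (Ne.symm hab), h a b (.head a b l)]
      decide
    have h2 := pairProj_single hl fun a b h' => h a b (.tail h')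
    have h3 := pairProj_single_eq_zero (K := K) (I := I) hbl h1
    rw [pairProj_cons_cons]
    simp [rightCliff_apply, h2, h3]

end Pairs

section Vacuum

variable {K : Type*} [Field K] {k : Kind} {m n : ℕ} {P : Params K m} {lam : Shape k m n}

lemma nodup_diagList : (diagList lam).Nodup := Finset.sort_nodup _ _

variable (P lam) in
/-- The generator `γ (v_1 ⊗ ⋯ ⊗ v_n)` of the module `𝕃`. -/
noncomputable def vac : Tens K n := P.proj lam (Pi.single 0 1)

lemma proj_eq : P.proj lam = (2 : K)⁻¹ ^ ((diagList lam).length / 2) •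
    pairProj (P.sqrt (-1)) (diagList lam) := rfl

lemma rightCliff_single (a : Fin n) :
    rightCliff a (Pi.single 0 1 : Tens K n) = cl a (Pi.single 0 1) := by
  ext β
  rw [rightCliff_apply, cl_apply]
  by_cases h : β + e a = 0
  · have h1 : β = e a := by rw [← add_e_add_e β a, h, zero_add]
    subst h1
    simp [degGT_e, degLT_e]
  · rw [Pi.single_eq_of_ne h, mul_zero, mul_zero]

/-- The members of a pair act on the vacuum vector in proportion: `C_b v = -√-1 C_a v`. -/
lemma cl_vac (hI : P.sqrt (-1) * P.sqrt (-1) = -1) {a b : Fin n} (h : IsPair (diagList lam) a b) :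
    cl b (vac P lam) = -P.sqrt (-1) • cl a (vac P lam) := by
  have hab : a ≠ b := by
    obtain ⟨p, hp, rfl, rfl⟩ := h.exists_getElem
    intro h
    have := (nodup_diagList (lam := lam)).getElem_inj_iff.1 h
    omega
  have h1 : P.proj lam (rightCliff a (rightCliff b (Pi.single 0 1))) =
      P.sqrt (-1) • vac P lam := by
    rw [vac, proj_eq, LinearMap.smul_apply, LinearMap.smul_apply,
      pairProj_rightCliff hI _ nodup_diagList h, smul_comm]
  have h2 : cl a (cl b (vac P lam)) = -P.sqrt (-1) • vac P lam := by
    rw [neg_smul, ← h1, vac, ← proj_cl, ← proj_cl, ← rightCliff_single b, cl_rightCliff,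
      ← rightCliff_single a, rightCliff_anticomm hab, map_neg, neg_neg]
  rw [← cl_cl_self a (cl b (vac P lam)), h2, map_smul]

lemma vac_eq_zero {c : Fin n} (hc : c ∉ diag lam) {β : Fin n → ZMod 2} (hβ : β c ≠ 0) :
    vac P lam β = 0 := by
  rw [vac, proj_eq, LinearMap.smul_apply, Pi.smul_apply,
    pairProj_single_eq_zero (fun h => hc (mem_diagList.1 h)) hβ, smul_zero]

lemma vac_apply {β : Fin n → ZMod 2} (h : ∀ a b, IsPair (diagList lam) a b → β b = 0) :
    vac P lam β = (2 : K)⁻¹ ^ ((diagList lam).length / 2) * (Pi.single 0 1 : Tens K n) β := by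
  rw [vac, proj_eq, LinearMap.smul_apply, Pi.smul_apply, pairProj_single nodup_diagList h,
    smul_eq_mul]

/-- The vacuum vector is even. -/
lemma sgn_mul_vac (β : Fin n → ZMod 2) : sgn K (deg β) * vac P lam β = vac P lam β := by
  have h := congrFun (proj_parity (P := P) (lam := lam) (Pi.single 0 1)) β
  have h1 : (fun β => sgn K (deg β)) * (Pi.single 0 1 : Tens K n) = Pi.single 0 1 := by
    ext β
    by_cases h : β = 0
    · subst h; simp [deg]
    · simp [h]
  rw [h1] at h
  exact h.symm

/-- `γ v = v`. -/
lemma pairProd_vac (hI : P.sqrt (-1) * P.sqrt (-1) = -1) (h20 : (2 : K) ≠ 0) :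
    (2 : K)⁻¹ ^ ((diagList lam).length / 2) •
      pairProd (M := Module.End K (Tens K n)) (fun a b => 1 + P.sqrt (-1) • (cl a * cl b))
        (diagList lam) (vac P lam) =
        vac P lam := by
  rw [pairProd_eq_pow_smul (r := (2 : K)), smul_smul, ← mul_pow, inv_mul_cancel₀ h20, one_pow,
    one_smul]
  intro a b h
  simp only [LinearMap.add_apply, Module.End.one_apply, LinearMap.smul_apply,
    Module.End.mul_apply, cl_vac hI h, map_smul, cl_cl_self, smul_smul]
  have : P.sqrt (-1) * -P.sqrt (-1) = 1 := by linear_combination -hI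
  rw [this, two_smul, one_smul]

end Vacuum

end HeckeClifford

namespace HeckeClifford

/-! ### The diagonal entries of a tableau -/

section DiagEntries

variable {k : Kind} {m n : ℕ} {lam : Shape k m n} (t : Std lam)

lemma mem_diagSet {i : Fin n} : i ∈ diagSet t ↔ ix t.1 i ∈ diag lam := by
  rw [diagSet, Finset.mem_map_equiv]
  rfl

lemma ix_dperm (a : Fin n) : ix t.1 (dperm t a) = a := (dperm t).symm_apply_apply a

lemma mem_oddDiagSet {i : Fin n} : i ∈ oddDiagSet t ↔ i ∈ diagSet t ∧ Odd (pos t i) := by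
  rw [oddDiagSet, Finset.mem_filter]

lemma IsPair.not_odd_pos {a b : Fin n} (h : IsPair (diagList lam) a b) :
    ¬ Odd (pos t (dperm t b)) := by
  obtain ⟨p, hp, rfl, rfl⟩ := h.exists_getElem
  rw [pos, Equiv.symm_apply_apply, nodup_diagList.idxOf_getElem]
  rw [Nat.not_odd_iff_even]
  exact ⟨p + 1, by ring⟩

lemma IsPair.odd_pos {a b : Fin n} (h : IsPair (diagList lam) a b) :
    Odd (pos t (dperm t a)) := by
  obtain ⟨p, hp, rfl, rfl⟩ := h.exists_getElem
  rw [pos, Equiv.symm_apply_apply, nodup_diagList.idxOf_getElem]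
  exact ⟨p, rfl⟩

variable {t}

/-- For an even diagonal entry `i`, the boxes of `i⁻` and `i` form a pair. -/
lemma isPair_prev {i : Fin n} (hi : i ∈ diagSet t) (hpos : ¬ Odd (pos t i)) :
    IsPair (diagList lam) (ix t.1 (prev t i)) (ix t.1 i) := by
  have h1 : ix t.1 i ∈ diagList lam := mem_diagList.2 ((mem_diagSet t).1 hi)
  have h2 := List.idxOf_lt_length_of_mem h1
  rw [Nat.not_odd_iff_even] at hpos
  obtain ⟨p, hp⟩ := hpos
  have h3 : (diagList lam).idxOf (ix t.1 i) + 1 = p + p := hp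
  have h4 : (diagList lam).idxOf (ix t.1 i) = 2 * (p - 1) + 1 := by omega
  have h5 : pos t i - 2 = 2 * (p - 1) := by omega
  have h6 := isPair_getElem (diagList lam) (p - 1) (by omega)
  rw [prev, ix_dperm, h5, List.getD_eq_getElem _ _ (by omega)]
  convert h6 using 1
  have h7 := List.getElem_idxOf h2
  rw [← h7]
  congr 1

lemma prev_mem_oddDiagSet {i : Fin n} (hi : i ∈ diagSet t) (hpos : ¬ Odd (pos t i)) :
    prev t i ∈ oddDiagSet t := by
  have h := isPair_prev hi hpos
  have h1 := h.odd_pos t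
  have h2 : dperm t (ix t.1 (prev t i)) = prev t i := (dperm t).apply_symm_apply _
  rw [h2] at h1
  exact (mem_oddDiagSet t).2 ⟨(mem_diagSet t).2 (mem_diagList.1 h.mem_left), h1⟩

end DiagEntries

end HeckeClifford

namespace HeckeClifford

/-! ### The vectors `C^β C^α v_t` -/

section ModuleVectors

variable {K : Type*} [Field K] {k : Kind} {m N : ℕ} {P : Params K m} {lam : Shape k m (N + 1)}

lemma gen_rel {x y : FreeAlgebra K (Gen N)} (h : AffineRel P.eps N x y) :
    RingQuot.mkAlgHom K (CycRel P k N) (RingQuot.mkAlgHom K (AffineRel P.eps N) x) =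
      RingQuot.mkAlgHom K (CycRel P k N) (RingQuot.mkAlgHom K (AffineRel P.eps N) y) :=
  congrArg _ (RingQuot.mkAlgHom_rel K h)

lemma isClifford_gen {m : ℕ} (P : Params K m) (k : Kind) (N : ℕ) :
    IsClifford fun j : Fin (N + 1) => gen P k (.C j) where
  mul_self i := by
    have h := gen_rel (k := k) (AffineRel.CC_self (ε := P.eps) i)
    rw [map_mul, map_mul, map_one, map_one] at h
    exact h
  anticomm i j hij := by
    have h := gen_rel (k := k) (AffineRel.CC (ε := P.eps) i j hij)
    rw [map_mul, map_mul, map_neg, map_neg, map_mul, map_mul] at h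
    exact h

variable (K) in
lemma isClifford_cl {n : ℕ} : IsClifford fun a : Fin n => (cl a : Module.End K (Tens K n)) where
  mul_self a := LinearMap.ext fun f => cl_cl_self a f
  anticomm _ _ h := LinearMap.ext fun f => cl_anticomm h f

/-- A word in the operators `C_a` translates the argument, up to signs. -/
lemma exists_cword_cl_apply {n : ℕ} (τ : Equiv.Perm (Fin n)) (β : Fin n → ZMod 2) :
    ∃ s : Tens K n, (∀ θ, s θ ≠ 0) ∧ ∀ f θ,
      cword (fun a => (cl (τ.symm a) : Module.End K (Tens K n))) β f θ = s θ * f (θ + β ∘ τ) := by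
  have hc : IsClifford (fun a => (cl (τ.symm a) : Module.End K (Tens K n))) :=
    (isClifford_cl K).comp τ.symm.injective
  induction β using zmod_two_induction with
  | zero => exact ⟨1, fun θ => one_ne_zero, fun f θ => by simp [cword_zero]⟩
  | add_e β a ih =>
    obtain ⟨s, hs, h⟩ := ih
    refine ⟨fun θ => sgn K (degLT β a) * (sgn K (degLT θ (τ.symm a)) * s (θ + e (τ.symm a))),
      fun θ => mul_ne_zero (sgn_ne_zero K _) (mul_ne_zero (sgn_ne_zero K _) (hs _)), fun f θ => ?_⟩
    have h1 : (β + e a) ∘ τ = e (τ.symm a) + β ∘ τ := by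
      ext i
      simp only [Function.comp_apply, Pi.add_apply, e, Pi.single_apply, Equiv.eq_symm_apply]
      ring
    rw [hc.cword_add_e K, LinearMap.smul_apply, Pi.smul_apply, Module.End.mul_apply, cl_apply, h,
      h1, add_assoc, smul_eq_mul, mul_assoc, mul_assoc]

lemma pairProd_map {α β M : Type*} [Monoid M] (F : β → β → M) (g : α → β) :
    ∀ l : List α, pairProd F (l.map g) = pairProd (fun a b => F (g a) (g b)) l
  | [] => rfl
  | [_] => rfl
  | a :: b :: l => by
    rw [List.map_cons, List.map_cons, pairProd, pairProd, pairProd_map F g l]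

variable {ρ : Cyc P k N →ₐ[K] Module.End K (P.D lam)}
  (hρ : ∀ g x, (ρ (gen P k g) x : Ambient K lam) = genOp P lam g (x : Ambient K lam))

include hρ

lemma coe_C_apply (a : Fin (N + 1)) (x : P.D lam) (t : Std lam) :
    (ρ (gen P k (.C a)) x : Ambient K lam) t = cl (ix t.1 a) ((x : Ambient K lam) t) := by
  rw [hρ]; rfl

lemma coe_Cpow_apply (β : Fin (N + 1) → ZMod 2) (x : P.D lam) (t : Std lam) :
    (ρ (Cpow P k β) x : Ambient K lam) t =
      cword (fun a => (cl (ix t.1 a) : Module.End K _)) β ((x : Ambient K lam) t) := by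
  change (ρ (cword _ β) x : Ambient K lam) t = _
  have hc : IsClifford (fun a => (cl (ix t.1 a) : Module.End K (Tens K (N + 1)))) :=
    (isClifford_cl K).comp (ix_injective t.1)
  induction β using zmod_two_induction with
  | zero => simp [cword_zero]
  | add_e β a ih =>
    rw [(isClifford_gen P k N).cword_add_e K, hc.cword_add_e K, map_smul, map_mul,
      LinearMap.smul_apply, LinearMap.smul_apply, Module.End.mul_apply, Module.End.mul_apply, ← ih,
      ← coe_C_apply hρ]
    rfl

omit hρ in
lemma coe_v_self (t : Std lam) : (P.v t : Ambient K lam) t = vac P lam := if_pos rfl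

omit hρ in
lemma coe_v_of_ne {t u : Std lam} (h : u ≠ t) : (P.v t : Ambient K lam) u = 0 := if_neg h

lemma coe_vec_self (t : Std lam) (β α : Fin (N + 1) → ZMod 2) :
    (P.vec ρ t β α : Ambient K lam) t =
      cword (fun a => (cl (ix t.1 a) : Module.End K _)) β
        (cword (fun a => (cl (ix t.1 a) : Module.End K _)) α (vac P lam)) := by
  rw [Params.vec, map_mul, Module.End.mul_apply, coe_Cpow_apply hρ, coe_Cpow_apply hρ,
    coe_v_self]

lemma coe_vec_of_ne {t u : Std lam} (h : u ≠ t) (β α : Fin (N + 1) → ZMod 2) :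
    (P.vec ρ t β α : Ambient K lam) u = 0 := by
  rw [Params.vec, map_mul, Module.End.mul_apply, coe_Cpow_apply hρ, coe_Cpow_apply hρ,
    coe_v_of_ne h, map_zero, map_zero]

/-- The vector `C^β C^α v_t` is the translate of the vacuum vector by `β + α`, up to signs. -/
lemma exists_coe_vec (t : Std lam) (β α : Fin (N + 1) → ZMod 2) :
    ∃ s : Tens K (N + 1), (∀ θ, s θ ≠ 0) ∧
      ∀ θ, (P.vec ρ t β α : Ambient K lam) t θ = s θ * vac P lam (θ + (β + α) ∘ dperm t) := by
  obtain ⟨s, hs, h⟩ := exists_cword_cl_apply (K := K) (dperm t) β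
  obtain ⟨s', hs', h'⟩ := exists_cword_cl_apply (K := K) (dperm t) α
  refine ⟨fun θ => s θ * s' (θ + β ∘ dperm t), fun θ => mul_ne_zero (hs _) (hs' _), fun θ => ?_⟩
  rw [coe_vec_self hρ]
  refine (h _ θ).trans ?_
  rw [mul_assoc]
  exact congrArg _ ((h' _ _).trans (by rw [add_assoc]; rfl))

omit hρ

lemma vec_eq (t : Std lam) (β α : Fin (N + 1) → ZMod 2) :
    P.vec ρ t β α = ρ (Cpow P k β) (ρ (Cpow P k α) (P.v t)) := by
  rw [Params.vec, map_mul, Module.End.mul_apply]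

lemma C_vec (t : Std lam) (i : Fin (N + 1)) (β α : Fin (N + 1) → ZMod 2) :
    ρ (gen P k (.C i)) (P.vec ρ t β α) = sgn K (degLT β i) • P.vec ρ t (β + e i) α := by
  rw [Params.vec, Params.vec, ← Module.End.mul_apply, ← map_mul, ← mul_assoc]
  rw [show gen P k (.C i) * Cpow P k β = _ from (isClifford_gen P k N).mul_cword K i β,
    smul_mul_assoc, map_smul]
  rfl

/-- For a diagonal entry `i`, one moves `C_i` past `C^β` into `C^α`. -/
lemma C_vec_of_eq_zero (t : Std lam) {i : Fin (N + 1)} {β : Fin (N + 1) → ZMod 2} (hi : β i = 0)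
    (α : Fin (N + 1) → ZMod 2) :
    ρ (gen P k (.C i)) (P.vec ρ t β α) =
      sgn K (deg β + degLT α i) • P.vec ρ t β (α + e i) := by
  rw [Params.vec, Params.vec, ← Module.End.mul_apply, ← map_mul, ← mul_assoc]
  rw [show gen P k (.C i) * Cpow P k β = _ from (isClifford_gen P k N).mul_cword_comm K hi,
    smul_mul_assoc, mul_assoc, show gen P k (.C i) * Cpow P k α = _ from
      (isClifford_gen P k N).mul_cword K i α, mul_smul_comm, smul_smul, ← sgn_add, map_smul]
  rfl

include hρ

/-- The relation `C_i v = -√-1 C_{i⁻} v` between the two members of a pair of diagonal entries. -/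
lemma C_v_of_even (hI : P.sqrt (-1) * P.sqrt (-1) = -1) {t : Std lam} {i : Fin (N + 1)}
    (hi : i ∈ diagSet t) (hpos : ¬ Odd (pos t i)) :
    ρ (gen P k (.C i)) (P.v t) = -P.sqrt (-1) • ρ (gen P k (.C (prev t i))) (P.v t) := by
  ext u : 2
  rw [coe_C_apply hρ, Submodule.coe_smul, Pi.smul_apply, coe_C_apply hρ]
  by_cases h : u = t
  · subst h
    rw [coe_v_self, cl_vac hI (isPair_prev hi hpos)]
  · rw [coe_v_of_ne h, map_zero, map_zero, smul_zero]

/-- One moves `C_i` past both words to `v_t`, replaces it by `C_{i⁻}`, and moves this back into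
`C^α`. -/
lemma C_vec_of_even (hI : P.sqrt (-1) * P.sqrt (-1) = -1) {t : Std lam} {i : Fin (N + 1)}
    (hi : i ∈ diagSet t) (hpos : ¬ Odd (pos t i)) {β α : Fin (N + 1) → ZMod 2} (hβ : β i = 0)
    (hα : α i = 0) :
    ρ (gen P k (.C i)) (P.vec ρ t β α) =
      (-P.sqrt (-1) * sgn K (deg β + degLE α (prev t i))) •
        P.vec ρ t β (α + e (prev t i)) := by
  rw [Params.vec, ← Module.End.mul_apply, ← map_mul, ← mul_assoc]
  rw [show gen P k (.C i) * Cpow P k β = _ from (isClifford_gen P k N).mul_cword_comm K hβ,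
    smul_mul_assoc, mul_assoc, show gen P k (.C i) * Cpow P k α = _ from
      (isClifford_gen P k N).mul_cword_comm K hα, mul_smul_comm, smul_smul, ← sgn_add, map_smul,
    LinearMap.smul_apply, map_mul, Module.End.mul_apply, map_mul, Module.End.mul_apply,
    C_v_of_even hρ hI hi hpos, map_smul, map_smul, smul_smul,
    ← Module.End.mul_apply (ρ (cword _ α)), ← map_mul ρ (cword _ α)]
  have h : cword (fun j => gen P k (.C j)) α * gen P k (.C (prev t i)) = _ :=
    (isClifford_gen P k N).cword_mul K (prev t i) α
  rw [h, map_smul, LinearMap.smul_apply, map_smul, smul_smul, vec_eq,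
    ← degLE_add_degGT α (prev t i), sgn_add, sgn_add, sgn_add]
  change _ = _ • ρ (cword (fun j => gen P k (.C j)) β) (ρ (cword (fun j => gen P k (.C j)) _) _)
  congr 1
  linear_combination (-P.sqrt (-1) * sgn K (deg β) * sgn K (degLE α (prev t i))) *
    sgn_mul_self K (degGT α (prev t i))

lemma coe_pairProd_apply (r : K) (u : Std lam) (x : P.D lam) : ∀ l : List (Fin (N + 1)),
    (ρ (pairProd (fun a b => 1 + r • (gen P k (.C a) * gen P k (.C b))) l) x : Ambient K lam) u =
      pairProd (M := Module.End K (Tens K (N + 1)))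
        (fun a b => 1 + r • (cl (ix u.1 a) * cl (ix u.1 b))) l ((x : Ambient K lam) u)
  | [] => by simp [pairProd]
  | [_] => by simp [pairProd]
  | a :: b :: l => by
    rw [pairProd, pairProd, map_mul, Module.End.mul_apply, Module.End.mul_apply,
      ← coe_pairProd_apply r u x l]
    generalize ρ (pairProd _ l) x = y
    rw [map_add, map_one, map_smul, map_mul]
    simp only [LinearMap.add_apply, LinearMap.smul_apply, Module.End.one_apply,
      Module.End.mul_apply, ← coe_C_apply hρ]
    rfl

/-- `γ_t v_t = v_t`. -/
lemma gamma_v (hI : P.sqrt (-1) * P.sqrt (-1) = -1) (h20 : (2 : K) ≠ 0) (t : Std lam) :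
    ρ (gammaElt P t) (P.v t) = P.v t := by
  ext u : 2
  rw [gammaElt, map_smul, LinearMap.smul_apply, Submodule.coe_smul, Pi.smul_apply,
    coe_pairProd_apply hρ]
  by_cases h : u = t
  · subst h
    rw [coe_v_self, pairProd_map]
    simp only [ix_dperm]
    exact pairProd_vac hI h20
  · rw [coe_v_of_ne h, map_zero, smul_zero]

end ModuleVectors

end HeckeClifford

namespace HeckeClifford

/-! ### The action of the generators on the basis -/

section Action

variable {K : Type*} [Field K] {k : Kind} {m N : ℕ} {P : Params K m} {lam : Shape k m (N + 1)}

lemma eigF_congr {a : Fin (N + 1)} {θ θ' : Fin (N + 1) → ZMod 2} (h : θ a = θ' a) :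
    eigF P lam a θ = eigF P lam a θ' := by
  simp only [eigF, Params.eig, h]

lemma degLT_succ_eq {n : ℕ} (β : Fin n → ZMod 2) {i j : Fin n} (hij : (j : ℕ) = i + 1) :
    degLT β j = degLE β i := by
  rw [degLT, degLE]
  congr 1
  ext a
  simp only [Finset.mem_Iio, Finset.mem_Iic, Fin.lt_def, Fin.le_def]
  omega

lemma degLE_eq_degLT_add {n : ℕ} (β : Fin n → ZMod 2) (i : Fin n) :
    degLE β i = degLT β i + β i := by
  rw [degLT, degLE, ← Finset.Iio_insert, Finset.sum_insert (by simp), add_comm]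

/-- On a vector on which `X_a` and `X_b` act by scalars, so do the coefficients of `Ξ`. The
operator `C_a C_b` inverts the two scalars. -/
lemma Xi_apply_of_eig {n : ℕ} {x : Fin n → Tens K n} {u : Fin n → K} (hx : IsEig x u) {ε : K}
    {a b : Fin n} (hab : a ≠ b) {f : Tens K n} {r s : K} (hr : x a * f = r • f)
    (hs : x b * f = s • f) :
    Xi ε x a b f = pf ε r s • f + rf ε r⁻¹ s⁻¹ • cl a (cl b f) := by
  have h (θ) (hθ : f θ ≠ 0) : x a θ = r ∧ x b θ = s :=
    ⟨mul_right_cancel₀ hθ (congrFun hr θ), mul_right_cancel₀ hθ (congrFun hs θ)⟩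
  ext θ
  rw [Xi_apply_apply, Pi.add_apply, Pi.smul_apply, Pi.smul_apply, smul_eq_mul, smul_eq_mul]
  congr 1
  · by_cases h0 : f θ = 0
    · rw [h0, mul_zero, mul_zero]
    · rw [(h θ h0).1, (h θ h0).2]
  · rw [cl_apply, cl_apply]
    by_cases h0 : f (θ + e a + e b) = 0
    · rw [h0, mul_zero, mul_zero, mul_zero, mul_zero]
    · have h1 := (h _ h0).1
      have h2 := (h _ h0).2
      rw [hx.const a b _ hab, hx.flip] at h1
      rw [hx.flip, hx.const b a _ hab.symm] at h2
      rw [← h1, ← h2, inv_inv, inv_inv]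

lemma res_eq (t : Std lam) (i : Fin (N + 1)) :
    P.res t i = P.res (initial lam) (ix t.1 i) := by
  rw [res_ix]; rfl

variable (hsqrt : ∀ a : K, P.sqrt a * P.sqrt a = a) (h20 : (2 : K) ≠ 0)

include hsqrt h20 in
/-- The eigenvalue of `X_i` on `C^β v_t` in terms of `b_{t,i} = b_-`: without `C_i` it is
`b_+ = b_-⁻¹`, with `C_i` it is `b_-`. -/
lemma b_zpow (t : Std lam) (i : Fin (N + 1)) (β : Fin (N + 1) → ZMod 2) :
    P.b t i ^ (-nu β i) = eigF P lam (ix t.1 i) (β ∘ dperm t) := by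
  have h : dperm t (ix t.1 i) = i := (dperm t).apply_symm_apply i
  rw [eigF, Params.eig, Function.comp_apply, h, Params.b, res_eq, nu]
  rcases zmod_two_cases (β i) with h | h
  · simp [h, bPlus_eq_inv hsqrt h20]
  · simp [h]

include hsqrt h20 in
lemma b_add_inv (t : Std lam) (i : Fin (N + 1)) :
    P.b t i + (P.b t i)⁻¹ = uF P lam (ix t.1 i) := by
  rw [Params.b, ← bPlus_eq_inv hsqrt h20, add_comm, bPlus_add_bMinus h20, uF, res_eq]

include hsqrt h20 in
lemma b_ne_zero (t : Std lam) (i : Fin (N + 1)) : P.b t i ≠ 0 :=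
  right_ne_zero_of_mul_eq_one (bPlus_mul_bMinus hsqrt h20 (P.res t i))

variable (hsep : ∀ mu : Shape k m (N + 1 + 1), P.IsSeparate mu)

include hsqrt h20 hsep in
lemma c_eq (t : Std lam) {i j : Fin (N + 1)} (hij : (j : ℕ) = i + 1) :
    P.c t i j = cf P.eps (uF P lam (ix t.1 i)) (uF P lam (ix t.1 j)) := by
  have hi := b_ne_zero (P := P) hsqrt h20 t i
  have hj := b_ne_zero (P := P) hsqrt h20 t j
  have hu := uF_ne hsep t.2 hij
  rw [← b_add_inv hsqrt h20, ← b_add_inv hsqrt h20] at hu ⊢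
  have h1 : P.b t i ≠ (P.b t j)⁻¹ := fun h => hu (by rw [h, inv_inv, add_comm])
  have h2 : P.b t i * (P.b t j)⁻¹ ≠ 1 := fun h => hu (by rw [(mul_inv_eq_one₀ hj).1 h])
  have h3 := omega_sq_eq P.eps hi (inv_ne_zero hj) h1 h2
  rw [inv_inv, add_comm (P.b t j)⁻¹] at h3
  rw [← h3, Params.c, add_comm (P.b t i * P.b t j / _)]

variable (hq : P.q ≠ 0) (hq2 : P.q ^ 2 ≠ -1) {ρ : Cyc P k N →ₐ[K] Module.End K (P.D lam)}
  (hρ : ∀ g x, (ρ (gen P k g) x : Ambient K lam) = genOp P lam g (x : Ambient K lam))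

include hsqrt h20 hq hq2 hρ

/-- Off the diagonal boxes the vacuum vector is concentrated at one value of the coordinate. -/
lemma eigF_mul_vec (t : Std lam) (i : Fin (N + 1)) {β α : Fin (N + 1) → ZMod 2}
    (hα : ∀ i ∉ diagSet t, α i = 0) :
    eigF P lam (ix t.1 i) * (P.vec ρ t β α : Ambient K lam) t =
      (P.b t i ^ (-nu β i)) • (P.vec ρ t β α : Ambient K lam) t := by
  obtain ⟨s, -, hs⟩ := exists_coe_vec hρ t β α
  ext θ
  rw [Pi.mul_apply, Pi.smul_apply, smul_eq_mul, b_zpow hsqrt h20]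
  by_cases hi : i ∈ diagSet t
  · -- the eigenvalue does not depend on the coordinate of a diagonal box
    congr 1
    rw [mem_diagSet] at hi
    by_cases h : θ (ix t.1 i) = (β ∘ dperm t) (ix t.1 i)
    · exact eigF_congr h
    · rw [← eigF_add_e_diag hq hq2 hsqrt h20 hi]
      refine eigF_congr ?_
      rw [add_e_self]
      revert h
      generalize θ (ix t.1 i) = x
      generalize (β ∘ dperm t) (ix t.1 i) = y
      revert x y
      decide
  · by_cases h : θ (ix t.1 i) = (β ∘ dperm t) (ix t.1 i)
    · rw [eigF_congr h]
    · rw [hs, vac_eq_zero (c := ix t.1 i) (fun h' => hi ((mem_diagSet t).2 h')), mul_zero, mul_zero,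
        mul_zero]
      have h1 : dperm t (ix t.1 i) = i := (dperm t).apply_symm_apply i
      rw [Function.comp_apply, h1] at h
      rw [Pi.add_apply, Function.comp_apply, h1, Pi.add_apply, hα i hi, add_zero]
      revert h
      generalize θ (ix t.1 i) = x
      generalize β i = y
      revert x y
      decide

lemma X_vec (t : Std lam) (i : Fin (N + 1)) {β α : Fin (N + 1) → ZMod 2}
    (hα : ∀ i ∉ diagSet t, α i = 0) :
    ρ (gen P k (.X i)) (P.vec ρ t β α) = (P.b t i ^ (-nu β i)) • P.vec ρ t β α := by
  ext u : 2
  rw [hρ, genOp, lX_apply, Submodule.coe_smul, Pi.smul_apply]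
  by_cases h : u = t
  · subst h
    exact eigF_mul_vec hsqrt h20 hq hq2 hρ u i hα
  · rw [coe_vec_of_ne hρ h, mul_zero, smul_zero]

omit hsqrt h20 hq hq2 in
lemma ext0_vec_of_ne {t : Std lam} {e : lam.cells ≃ Fin (N + 1)} (h : e ≠ t.1)
    (β α : Fin (N + 1) → ZMod 2) : ext0 (P.vec ρ t β α : Ambient K lam) e = 0 := by
  by_cases he : IsStandard lam e
  · exact (ext0_of _ he).trans (coe_vec_of_ne hρ (fun h' => h (congrArg Subtype.val h')) β α)
  · exact ext0_of_not _ he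

omit hsqrt h20 hq hq2 in
lemma coe_smul_vec_mk_of_ne {u : Std lam} {e : lam.cells ≃ Fin (N + 1)} (he : IsStandard lam e)
    (h : u.1 ≠ e) (r : K) (β α : Fin (N + 1) → ZMod 2) :
    (r • P.vec ρ (⟨e, he⟩ : Std lam) β α : P.D lam).1 u = 0 := by
  rw [Submodule.coe_smul, Pi.smul_apply,
    coe_vec_of_ne hρ (t := (⟨e, he⟩ : Std lam)) (fun h' => h (congrArg Subtype.val h')), smul_zero]

include hsep

/-- The action of `T_i`, with the element `R` in the form `C_i C_j C^β C^α v_t`. -/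
lemma T_vec (t : Std lam) (i : Fin N) {β α : Fin (N + 1) → ZMod 2}
    (hα : ∀ i ∉ diagSet t, α i = 0) [Decidable (IsStandard lam (swapped t i.castSucc i.succ))] :
    ρ (gen P k (.T i)) (P.vec ρ t β α) =
      -(P.eps / (P.b t i.castSucc ^ (-nu β i.castSucc) * P.b t i.succ ^ (nu β i.succ) - 1)) •
          P.vec ρ t β α
        + (P.eps / (P.b t i.castSucc ^ (nu β i.castSucc) * P.b t i.succ ^ (nu β i.succ) - 1)) •
            ρ (gen P k (.C i.castSucc)) (ρ (gen P k (.C i.succ)) (P.vec ρ t β α))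
        + if h : IsStandard lam (swapped t i.castSucc i.succ) then
            (sgn K (β i.castSucc * β i.succ + α i.castSucc * α i.succ)
                * P.sqrt (P.c t i.castSucc i.succ)) •
              P.vec ρ ⟨swapped t i.castSucc i.succ, h⟩
                (β ∘ Equiv.swap i.castSucc i.succ) (α ∘ Equiv.swap i.castSucc i.succ)
          else 0 := by
  have hij : ((i.succ : Fin (N + 1)) : ℕ) = (i.castSucc : Fin (N + 1)) + 1 := by simp
  have hne : (i.castSucc : Fin (N + 1)) ≠ i.succ := (Fin.castSucc_lt_succ (i := i)).ne
  have hT (x : P.D lam) (u : Std lam) : (ρ (gen P k (.T i)) x : Ambient K lam) u =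
      Xi P.eps (eigF P lam) (ix u.1 i.castSucc) (ix u.1 i.succ) ((x : Ambient K lam) u) +
      om P lam (ix u.1 i.castSucc) (ix u.1 i.succ) •
        ext0 (x : Ambient K lam) (u.1.trans (Equiv.swap i.castSucc i.succ)) := by
    rw [hρ]; rfl
  generalize ρ (gen P k (.T i)) = T at hT ⊢
  generalize (i.succ : Fin (N + 1)) = j at *
  generalize (i.castSucc : Fin (N + 1)) = i at *
  have hss (e : lam.cells ≃ Fin (N + 1)) :
      (e.trans (Equiv.swap i j)).trans (Equiv.swap i j) = e := by ext a; simp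
  have hsw (e : lam.cells ≃ Fin (N + 1)) : e.trans (Equiv.swap i j) ≠ e := fun h => by
    have h1 : (e.trans (Equiv.swap i j)) (e.symm i) = e (e.symm i) := by rw [h]
    simp [hne.symm] at h1
  ext u : 2
  rw [hT, Submodule.coe_add, Submodule.coe_add, Pi.add_apply, Pi.add_apply, Submodule.coe_smul,
    Submodule.coe_smul, Pi.smul_apply, Pi.smul_apply, coe_C_apply hρ, coe_C_apply hρ]
  by_cases hu : u = t
  · subst hu
    rw [Xi_apply_of_eig (isEig hsqrt h20 lam) (ix_ne _ hne)
      (eigF_mul_vec hsqrt h20 hq hq2 hρ u i hα) (eigF_mul_vec hsqrt h20 hq hq2 hρ u j hα)]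
    rw [ext0_vec_of_ne hρ (hsw u.1), smul_zero, pf, rf, zpow_neg, zpow_neg, inv_inv, inv_inv]
    congr 1
    split_ifs with h
    · exact (coe_smul_vec_mk_of_ne hρ h (hsw u.1).symm _ _ _).symm
    · rfl
  · rw [coe_vec_of_ne hρ hu, map_zero, map_zero, map_zero, smul_zero, smul_zero, zero_add,
      zero_add, zero_add]
    by_cases hut : u.1.trans (Equiv.swap i j) = t.1
    · have hts : swapped t i j = u.1 := by rw [swapped, ← hut, hss]
      have hstd : IsStandard lam (swapped t i j) := hts ▸ u.2
      have huu : (⟨swapped t i j, hstd⟩ : Std lam) = u := Subtype.ext hts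
      have hix (a : Fin (N + 1)) : ix u.1 a = ix t.1 (Equiv.swap i j a) := by
        rw [← hts]; exact ix_swap t.1 i j a
      have hword (γ : Fin (N + 1) → ZMod 2) :
          cword (fun a => (cl (ix u.1 a) : Module.End K (Tens K (N + 1)))) (γ ∘ Equiv.swap i j) =
            sgn K (γ i * γ j) • cword (fun a => (cl (ix t.1 a) : Module.End K _)) γ := by
        refine Eq.trans ?_ (((isClifford_cl K).comp (ix_injective t.1)).cword_swap K hij γ)
        refine congrArg (fun c => cword c (γ ∘ Equiv.swap i j)) (funext fun a => ?_)
        exact congrArg cl (hix a)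
      rw [dif_pos hstd, huu, Submodule.coe_smul, Pi.smul_apply, hut, ext0_std, coe_vec_self hρ,
        coe_vec_self hρ, hword, hword, hix, hix, Equiv.swap_apply_left, Equiv.swap_apply_right,
        om_comm, om, ← c_eq hsqrt h20 hsep t hij, LinearMap.smul_apply, LinearMap.smul_apply,
        map_smul, smul_smul, smul_smul, sgn_add]
      congr 1
      linear_combination (-P.sqrt (P.c t i j) * sgn K (α i * α j) * sgn K (α i * α j)) *
        sgn_mul_self K (β i * β j) - P.sqrt (P.c t i j) * sgn_mul_self K (α i * α j)
    · rw [ext0_vec_of_ne hρ hut, smul_zero]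
      split_ifs with h
      · refine (coe_smul_vec_mk_of_ne hρ h (fun h' => hut ?_) _ _ _).symm
        rw [h']
        exact hss t.1
      · rfl

end Action

section CliffordPair

variable {K : Type*} [Field K] {k : Kind} {m N : ℕ} {P : Params K m} {lam : Shape k m (N + 1)}
  {ρ : Cyc P k N →ₐ[K] Module.End K (P.D lam)}
  (hρ : ∀ g x, (ρ (gen P k g) x : Ambient K lam) = genOp P lam g (x : Ambient K lam))
  (hI : P.sqrt (-1) * P.sqrt (-1) = -1)

include hρ hI

/-- The element `R` in the formula for `T_i` is `C_i C_j` applied to the basis vector. -/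
lemma C_C_vec {t : Std lam} {i j : Fin (N + 1)} (hij : (j : ℕ) = i + 1)
    {β α : Fin (N + 1) → ZMod 2} (hβ : ∀ a ∈ diagSet t, β a = 0)
    (hα : ∀ a ∉ oddDiagSet t, α a = 0) :
    ρ (gen P k (.C i)) (ρ (gen P k (.C j)) (P.vec ρ t β α)) =
      P.R t (P.vec ρ t) i j β α := by
  have hne : i ≠ j := by rw [Ne, Fin.ext_iff]; omega
  have hlt : ¬ j < i := by rw [Fin.lt_def]; omega
  have hα' {a} (h : ¬ Odd (pos t a)) : α a = 0 := hα a fun h' => h ((mem_oddDiagSet t).1 h').2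
  have hprev {a b : Fin (N + 1)} (hb : b ∈ diagSet t) (hpb : ¬ Odd (pos t b))
      (ha : ¬ Odd (pos t a)) : a ≠ prev t b := by
    rintro rfl
    exact ha ((mem_oddDiagSet t).1 (prev_mem_oddDiagSet hb hpb)).2
  have h2 (x : ZMod 2) : x + x = 0 := CharTwo.add_self_eq_zero x
  have hn1 : (-P.sqrt (-1)) * (-P.sqrt (-1)) = sgn K 1 := by
    rw [sgn_one]; linear_combination hI
  rw [Params.R]
  split_ifs with hi hj hpi hpj hpj hpi hj hpj
  · rw [C_vec_of_eq_zero t (hβ j hj), map_smul, C_vec_of_eq_zero t (hβ i hi), smul_smul, ← sgn_add,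
      add_right_comm α (e j), degLT_succ_eq α hij, degLE_eq_degLT_add, degLT_add, degLT_e,
      if_neg hlt]
    congr 2
    linear_combination h2 (deg β) + h2 (degLT α i)
  · rw [C_vec_of_even hρ hI hj hpj (hβ j hj) (hα' hpj), map_smul, C_vec_of_eq_zero t (hβ i hi),
      smul_smul, mul_assoc, ← sgn_add, add_right_comm α]
    congr 3
    linear_combination h2 (deg β)
  · rw [C_vec_of_eq_zero t (hβ j hj), map_smul,
      C_vec_of_even hρ hI hi hpi (hβ i hi) (by rw [add_e_of_ne _ hne, hα' hpi]), smul_smul,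
      mul_left_comm, ← sgn_add, add_right_comm α]
    congr 3
    linear_combination h2 (deg β)
  · rw [C_vec_of_even hρ hI hj hpj (hβ j hj) (hα' hpj), map_smul,
      C_vec_of_even hρ hI hi hpi (hβ i hi) (by rw [add_e_of_ne _ (hprev hj hpj hpi), hα' hpi]),
      smul_smul, mul_mul_mul_comm, hn1, ← sgn_add, ← sgn_add, add_right_comm α]
    congr 2
    linear_combination h2 (deg β)
  · rw [C_vec, map_smul, C_vec_of_eq_zero t (by rw [add_e_of_ne _ hne, hβ i hi]), smul_smul,
      ← sgn_add, degLT_succ_eq β hij, deg_add, deg_e, ← degLE_add_degGT β i]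
    congr 2
    linear_combination h2 (degLE β i)
  · rw [C_vec, map_smul, C_vec_of_even hρ hI hi hpi (by rw [add_e_of_ne _ hne, hβ i hi]) (hα' hpi),
      smul_smul, mul_left_comm, ← sgn_add, degLT_succ_eq β hij, deg_add, deg_e,
      ← degLE_add_degGT β i]
    congr 3
    linear_combination h2 (degLE β i)
  · rw [C_vec_of_eq_zero t (hβ j hj), map_smul, C_vec, smul_smul, ← sgn_add,
      ← degLT_add_degGE β i]
    congr 2
    linear_combination h2 (degLT β i)
  · rw [C_vec_of_even hρ hI hj hpj (hβ j hj) (hα' hpj), map_smul, C_vec, smul_smul, mul_assoc,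
      ← sgn_add, ← degLT_add_degGE β i]
    congr 3
    linear_combination h2 (degLT β i)
  · rw [C_vec, map_smul, C_vec, smul_smul, ← sgn_add, degLT_succ_eq β hij, degLE_eq_degLT_add,
      degLT_add, degLT_e, if_neg hlt, add_right_comm β]
    congr 2
    linear_combination h2 (degLT β i)

end CliffordPair

end HeckeClifford

namespace HeckeClifford

/-! ### The basis -/

section BasisVectors

variable {K : Type*} [Field K] {k : Kind} {m N : ℕ} {P : Params K m} {lam : Shape k m (N + 1)}

/-- The index set of the part of the basis that belongs to `t`. -/
abbrev BasisIdx (t : Std lam) : Type :=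
  Z2 ((diagSet t : Set (Fin (N + 1)))ᶜ) × Z2 (oddDiagSet t : Set (Fin (N + 1)))

section Z2Lemmas

variable {n : ℕ} {S : Set (Fin n)}

lemma Z2.eq_zero (β : Z2 S) {i : Fin n} (hi : i ∉ S) : β.1 i = 0 :=
  not_not.1 fun h => hi (β.2 i h)

lemma Z2.exists_mk {β : Fin n → ZMod 2} (h : ∀ i ∉ S, β i = 0) : ∃ γ : Z2 S, γ.1 = β :=
  ⟨⟨β, fun i hi => not_not.1 fun h' => hi (h i h')⟩, rfl⟩

end Z2Lemmas

variable {t : Std lam}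

lemma Z2.apply_diag (β : Z2 ((diagSet t : Set (Fin (N + 1)))ᶜ)) {i : Fin (N + 1)}
    (hi : i ∈ diagSet t) : β.1 i = 0 :=
  β.eq_zero fun h => h hi

lemma Z2.apply_notMem (α : Z2 (oddDiagSet t : Set (Fin (N + 1)))) {i : Fin (N + 1)}
    (hi : i ∉ oddDiagSet t) : α.1 i = 0 :=
  α.eq_zero hi

lemma Z2.apply_not_diag (α : Z2 (oddDiagSet t : Set (Fin (N + 1)))) {i : Fin (N + 1)}
    (hi : i ∉ diagSet t) : α.1 i = 0 :=
  α.eq_zero fun h => hi ((mem_oddDiagSet t).1 h).1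

variable {ρ : Cyc P k N →ₐ[K] Module.End K (P.D lam)}
  (hρ : ∀ g x, (ρ (gen P k g) x : Ambient K lam) = genOp P lam g (x : Ambient K lam))
  (h20 : (2 : K) ≠ 0)

include hρ h20

/-- The value of a basis vector at `β + α`, up to the permutation: it detects the index. -/
lemma coe_vec_apply_eq_zero_iff (p p' : BasisIdx t) :
    (P.vec ρ t p'.1.1 p'.2.1 : Ambient K lam) t ((p.1.1 + p.2.1) ∘ dperm t) = 0 ↔ p ≠ p' := by
  obtain ⟨s, hs, h⟩ := exists_coe_vec hρ t p'.1.1 p'.2.1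
  have hpow : (2 : K)⁻¹ ^ ((diagList lam).length / 2) ≠ 0 := pow_ne_zero _ (inv_ne_zero h20)
  rw [h, mul_eq_zero, or_iff_right (hs _), vac_apply, mul_eq_zero, or_iff_right hpow]
  · rw [Pi.single_apply, ite_eq_right_iff, imp_iff_not one_ne_zero, not_iff_not]
    constructor
    · intro h0
      have h1 (i : Fin (N + 1)) : p.1.1 i + p.2.1 i + (p'.1.1 i + p'.2.1 i) = 0 := by
        have := congrFun h0 ((dperm t).symm i)
        simpa using this
      have h2 (x y : ZMod 2) (h : x + y = 0) : x = y := by revert x y; decide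
      refine Prod.ext (Subtype.ext (funext fun i => ?_)) (Subtype.ext (funext fun i => ?_))
      · by_cases hi : i ∈ diagSet t
        · rw [p.1.apply_diag hi, p'.1.apply_diag hi]
        · have := h1 i
          rw [p.2.apply_not_diag hi, p'.2.apply_not_diag hi, add_zero, add_zero] at this
          exact h2 _ _ this
      · by_cases hi : i ∈ diagSet t
        · have := h1 i
          rw [p.1.apply_diag hi, p'.1.apply_diag hi, zero_add, zero_add] at this
          exact h2 _ _ this
        · rw [p.2.apply_not_diag hi, p'.2.apply_not_diag hi]
    · rintro rfl
      exact add_self_zero _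
  · intro a b hab
    have h1 : dperm t b ∈ diagSet t := by
      rw [mem_diagSet, ix_dperm]
      exact mem_diagList.1 hab.mem_right
    have h2 : dperm t b ∉ oddDiagSet t := fun h => hab.not_odd_pos t ((mem_oddDiagSet t).1 h).2
    simp [p.1.apply_diag h1, p'.1.apply_diag h1, p.2.apply_notMem h2, p'.2.apply_notMem h2]

variable (lam) in
/-- The coordinates at `β + α` form a system dual to the vectors, up to nonzero factors. -/
lemma linearIndependent_vec : LinearIndependent K fun p : Σ t : Std lam, BasisIdx t =>
    P.vec ρ p.1 p.2.1.1 p.2.2.1 := by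
  let φ (p : Σ t : Std lam, BasisIdx t) : P.D lam →ₗ[K] K :=
    LinearMap.proj ((p.2.1.1 + p.2.2.1) ∘ dperm p.1) ∘ₗ LinearMap.proj p.1 ∘ₗ (P.D lam).subtype
  have hφ (p x) : φ p x = (x : Ambient K lam) p.1 ((p.2.1.1 + p.2.2.1) ∘ dperm p.1) := rfl
  refine LinearIndependent.of_pairwise_dual_eq_zero_one _
    (fun p => (φ p (P.vec ρ p.1 p.2.1.1 p.2.2.1))⁻¹ • φ p) ?_ ?_
  · rintro ⟨t, p⟩ ⟨u, p'⟩ hne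
    rw [LinearMap.smul_apply, hφ, smul_eq_zero]
    right
    by_cases h : t = u
    · subst h
      exact (coe_vec_apply_eq_zero_iff hρ h20 p p').2 fun h => hne (by rw [h])
    · exact congrFun (coe_vec_of_ne hρ h _ _) _
  · rintro ⟨t, p⟩
    rw [LinearMap.smul_apply, hφ, smul_eq_mul]
    exact inv_mul_cancel₀ fun h => (coe_vec_apply_eq_zero_iff hρ h20 p p).1 h rfl

end BasisVectors

section Span

variable {K : Type*} [Field K] {k : Kind} {m N : ℕ} {P : Params K m} {lam : Shape k m (N + 1)}

open Classical in
variable (P) in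
/-- The inclusion of the summand of `𝔻(λ)` that belongs to `t`, composed with the projection from
the tensor product. -/
noncomputable def inclD (t : Std lam) : Tens K (N + 1) →ₗ[K] P.D lam where
  toFun g := ⟨fun u => if u = t then P.proj lam g else 0, mem_D.2 fun u => by
    split_ifs
    · exact ⟨_, rfl⟩
    · exact Submodule.zero_mem _⟩
  map_add' f g := by
    ext u : 2
    by_cases h : u = t <;> simp [h]
  map_smul' r f := by
    ext u : 2
    by_cases h : u = t <;> simp [h]

lemma inclD_self (t : Std lam) (g : Tens K (N + 1)) :
    (inclD P t g : Ambient K lam) t = P.proj lam g := if_pos rfl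

lemma inclD_of_ne {t u : Std lam} (h : u ≠ t) (g : Tens K (N + 1)) :
    (inclD P t g : Ambient K lam) u = 0 := if_neg h

variable {ρ : Cyc P k N →ₐ[K] Module.End K (P.D lam)}
  (hρ : ∀ g x, (ρ (gen P k g) x : Ambient K lam) = genOp P lam g (x : Ambient K lam))
  (hI : P.sqrt (-1) * P.sqrt (-1) = -1)

lemma Cpow_zero : Cpow P k (0 : Fin (N + 1) → ZMod 2) = 1 := cword_zero _

lemma vec_zero_zero (t : Std lam) : P.vec ρ t 0 0 = P.v t := by
  rw [Params.vec, Cpow_zero, mul_one, map_one, Module.End.one_apply]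

include hρ

lemma C_inclD (t : Std lam) (a : Fin (N + 1)) (g : Tens K (N + 1)) :
    ρ (gen P k (.C (dperm t a))) (inclD P t g) = inclD P t (cl a g) := by
  ext u : 2
  rw [coe_C_apply hρ]
  by_cases h : u = t
  · subst h
    rw [inclD_self, inclD_self, ix_dperm, proj_cl]
  · rw [inclD_of_ne h, inclD_of_ne h, map_zero]

include hI

/-- The action of `C_i` on the basis. -/
lemma C_vec_basis (t : Std lam) (p : BasisIdx t) (i : Fin (N + 1)) [Decidable (i ∈ diagSet t)]
    [Decidable (Odd (pos t i))] :
    ρ (gen P k (.C i)) (P.vec ρ t p.1.1 p.2.1) =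
      if i ∈ diagSet t then
        if Odd (pos t i) then
          sgn K (deg p.1.1 + degLT p.2.1 i) • P.vec ρ t p.1.1 (p.2.1 + e i)
        else
          (-P.sqrt (-1) * sgn K (deg p.1.1 + degLE p.2.1 (prev t i))) •
            P.vec ρ t p.1.1 (p.2.1 + e (prev t i))
      else sgn K (degLT p.1.1 i) • P.vec ρ t (p.1.1 + e i) p.2.1 := by
  split_ifs with h h'
  · exact C_vec_of_eq_zero t (p.1.apply_diag h) _
  · exact C_vec_of_even hρ hI h h' (p.1.apply_diag h)
      (p.2.apply_notMem fun h1 => h' ((mem_oddDiagSet t).1 h1).2)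
  · exact C_vec t i _ _

/-- The part of the basis that belongs to `t` spans a subspace stable under the `C_i`. -/
lemma C_mem_span (t : Std lam) (i : Fin (N + 1)) {x : P.D lam}
    (hx : x ∈ Submodule.span K (Set.range fun p : BasisIdx t => P.vec ρ t p.1.1 p.2.1)) :
    ρ (gen P k (.C i)) x ∈
      Submodule.span K (Set.range fun p : BasisIdx t => P.vec ρ t p.1.1 p.2.1) := by
  classical
  have key {β α : Fin (N + 1) → ZMod 2} (hβ : ∀ i ∈ diagSet t, β i = 0)
      (hα : ∀ i ∉ oddDiagSet t, α i = 0) (r : K) : r • P.vec ρ t β α ∈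
      Submodule.span K (Set.range fun p : BasisIdx t => P.vec ρ t p.1.1 p.2.1) := by
    obtain ⟨β, rfl⟩ := Z2.exists_mk (S := ((diagSet t : Set (Fin (N + 1)))ᶜ)) (β := β)
      fun i hi => hβ i (not_not.1 hi)
    obtain ⟨α, rfl⟩ := Z2.exists_mk (S := (oddDiagSet t : Set (Fin (N + 1)))) hα
    exact Submodule.smul_mem _ _ (Submodule.subset_span ⟨(β, α), rfl⟩)
  have hadd {α : Fin (N + 1) → ZMod 2} (hα : ∀ i ∉ oddDiagSet t, α i = 0) {j : Fin (N + 1)}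
      (hj : j ∈ oddDiagSet t) (i) (hi : i ∉ oddDiagSet t) : (α + e j) i = 0 := by
    rw [add_e_of_ne _ (by rintro rfl; contradiction), hα i hi]
  refine Submodule.span_induction (p := fun x _ => ρ (gen P k (.C i)) x ∈ _) ?_ ?_ ?_ ?_ hx
  · rintro _ ⟨p, rfl⟩
    have hp1 : ∀ i ∈ diagSet t, p.1.1 i = 0 := fun i hi => p.1.apply_diag hi
    have hp2 : ∀ i ∉ oddDiagSet t, p.2.1 i = 0 := fun i hi => p.2.apply_notMem hi
    rw [C_vec_basis hρ hI]
    split_ifs with h h'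
    · exact key hp1 (hadd hp2 ((mem_oddDiagSet t).2 ⟨h, h'⟩)) _
    · exact key hp1 (hadd hp2 (prev_mem_oddDiagSet h h')) _
    · refine key (fun j hj => ?_) hp2 _
      rw [add_e_of_ne _ (by rintro rfl; contradiction), hp1 j hj]
  · rw [map_zero]
    exact Submodule.zero_mem _
  · intro x y _ _ hx hy
    rw [map_add]
    exact add_mem hx hy
  · intro r x _ hx
    rw [map_smul]
    exact Submodule.smul_mem _ _ hx

/-- The summand of `t` is generated by `v_t` under the `C_i`. -/
lemma inclD_mem_span (t : Std lam) (g : Tens K (N + 1)) : inclD P t g ∈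
    Submodule.span K (Set.range fun p : BasisIdx t => P.vec ρ t p.1.1 p.2.1) := by
  have h (γ : Fin (N + 1) → ZMod 2) : inclD P t (Pi.single γ 1) ∈
      Submodule.span K (Set.range fun p : BasisIdx t => P.vec ρ t p.1.1 p.2.1) := by
    induction γ using zmod_two_induction with
    | zero =>
      refine Submodule.subset_span ⟨(⟨0, fun i h => (h rfl).elim⟩, ⟨0, fun i h => (h rfl).elim⟩), ?_⟩
      exact vec_zero_zero t
    | add_e γ a ih =>
      have h1 : (Pi.single (γ + e a) 1 : Tens K (N + 1)) =
          sgn K (degLT (γ + e a) a) • cl a (Pi.single γ 1) := by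
        ext θ
        rw [Pi.smul_apply, cl_apply, smul_eq_mul]
        by_cases h : θ = γ + e a
        · subst h
          rw [add_e_add_e, Pi.single_eq_same, Pi.single_eq_same, mul_one, sgn_mul_self]
        · rw [Pi.single_eq_of_ne h, Pi.single_eq_of_ne, mul_zero, mul_zero]
          rintro rfl
          exact h (add_e_add_e θ a).symm
      rw [h1, map_smul, ← C_inclD hρ]
      exact Submodule.smul_mem _ _ (C_mem_span hρ hI t _ ih)
  rw [pi_eq_sum_univ' g, map_sum]
  refine Submodule.sum_mem _ fun γ _ => ?_
  rw [map_smul]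
  exact Submodule.smul_mem _ _ (h γ)

lemma span_vec (t : Std lam) :
    (Submodule.span K (Set.range fun p : BasisIdx t => P.vec ρ t p.1.1 p.2.1) : Set (P.D lam)) =
      {x : P.D lam | ∀ u, u ≠ t → (x : Ambient K lam) u = 0} := by
  ext x
  constructor
  · intro hx u hu
    refine Submodule.span_induction (p := fun (x : P.D lam) _ => (x : Ambient K lam) u = 0)
      ?_ ?_ ?_ ?_ hx
    · rintro _ ⟨p, rfl⟩
      exact coe_vec_of_ne hρ hu _ _
    · rfl
    · intro x y _ _ hx hy
      rw [Submodule.coe_add, Pi.add_apply, hx, hy, add_zero]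
    · intro r x _ hx
      rw [Submodule.coe_smul, Pi.smul_apply, hx, smul_zero]
  · intro hx
    obtain ⟨g, hg⟩ := mem_D.1 x.2 t
    have h1 : x = inclD P t g := by
      ext u : 2
      by_cases h : u = t
      · subst h
        rw [inclD_self, hg]
      · rw [inclD_of_ne h, hx u h]
    rw [h1]
    exact inclD_mem_span hρ hI t g

instance : Finite (Std lam) := Subtype.finite

lemma top_le_span_vec : ⊤ ≤ Submodule.span K (Set.range fun p : Σ t : Std lam, BasisIdx t =>
    P.vec ρ p.1 p.2.1.1 p.2.2.1) := by
  classical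
  intro x _
  have := Fintype.ofFinite (Std lam)
  choose g hg using fun t => mem_D.1 x.2 t
  have h1 : x = ∑ t, inclD P t (g t) := by
    ext u : 2
    rw [Submodule.coe_sum, Finset.sum_apply, Finset.sum_eq_single u, inclD_self, hg]
    · intro t _ ht
      exact inclD_of_ne ht.symm _
    · intro h
      exact (h (Finset.mem_univ u)).elim
  rw [h1]
  refine Submodule.sum_mem _ fun t _ => ?_
  refine Submodule.span_mono ?_ (inclD_mem_span hρ hI t (g t))
  rintro _ ⟨p, rfl⟩
  exact ⟨⟨t, p⟩, rfl⟩

variable (lam) in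
/-- The basis `C^β C^α v_t` of `𝔻(λ)`. -/
noncomputable def basisD (h20 : (2 : K) ≠ 0) :
    Module.Basis (Σ t : Std lam, BasisIdx t) K (P.D lam) :=
  Module.Basis.mk (linearIndependent_vec lam hρ h20) (top_le_span_vec hρ hI)

lemma basisD_apply (h20 : (2 : K) ≠ 0) (t : Std lam) (p : BasisIdx t) :
    basisD lam hρ hI h20 ⟨t, p⟩ = P.vec ρ t p.1.1 p.2.1 := by
  rw [basisD, Module.Basis.mk_apply]

end Span

end HeckeClifford

namespace HeckeClifford

/-! ### Connectedness of the set of standard tableaux -/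

section Connected

variable {k : Kind} {m n : ℕ} {lam : Shape k m n}

lemma ix_lt_ix {t : lam.cells ≃ Fin n} {i j : Fin n} : ix t i < ix t j ↔ bx t i < bx t j :=
  (lam.cells.orderIsoOfFin lam.card_cells).symm.lt_iff_lt

/-- If the reading order of the boxes of two consecutive entries is reversed, the entries may be
exchanged. -/
lemma isStandard_swap_of_lt {t : lam.cells ≃ Fin n} (ht : IsStandard lam t) {i j : Fin n}
    (hij : (j : ℕ) = i + 1) (h : ix t j < ix t i) :
    IsStandard lam (t.trans (Equiv.swap i j)) := by
  rw [isStandard_swap_iff ht hij]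
  intro hb
  rw [ix_lt_ix, Box.lt_iff] at h
  rcases hb.adjacent ht hij with h' | h' <;> rw [h'] at h <;> simp at h

/-- Every standard tableau is connected to the initial one by exchanges of consecutive entries. -/
lemma std_induction {p : Std lam → Prop} (init : p (initial lam))
    (swap : ∀ (t : Std lam) (i j : Fin n), (j : ℕ) = i + 1 →
      ∀ h : IsStandard lam (swapped t i j), p ⟨swapped t i j, h⟩ → p t) (t : Std lam) : p t := by
  -- the exchange of two entries in the wrong reading order decreases this sum
  induction hM : ∑ a : Fin n, (n - (a : ℕ)) * (ix t.1 a : ℕ) using Nat.strong_induction_on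
    generalizing t with
  | _ M ih =>
  by_cases hmono : ∃ i j : Fin n, (j : ℕ) = i + 1 ∧ ix t.1 j < ix t.1 i
  · obtain ⟨i, j, hij, hlt⟩ := hmono
    have hst := isStandard_swap_of_lt t.2 hij hlt
    refine swap t i j hij hst (ih _ ?_ ⟨swapped t i j, hst⟩ rfl)
    have hne : i ≠ j := by rw [Ne, Fin.ext_iff]; omega
    have key (f : Fin n → ℕ) : ∑ a : Fin n, (n - (a : ℕ)) * f a =
        (n - (i : ℕ)) * f i + ((n - (j : ℕ)) * f j +
          ∑ a ∈ (Finset.univ.erase i).erase j, (n - (a : ℕ)) * f a) := by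
      rw [← Finset.add_sum_erase _ _ (Finset.mem_univ i),
        ← Finset.add_sum_erase (Finset.univ.erase i) _ (Finset.mem_erase.2 ⟨hne.symm,
          Finset.mem_univ j⟩)]
    have hrest : ∑ a ∈ (Finset.univ.erase i).erase j,
        (n - (a : ℕ)) * (ix (t.1.trans (Equiv.swap i j)) a : ℕ) =
        ∑ a ∈ (Finset.univ.erase i).erase j, (n - (a : ℕ)) * (ix t.1 a : ℕ) := by
      refine Finset.sum_congr rfl fun a ha => ?_
      simp only [Finset.mem_erase] at ha
      rw [ix_swap, Equiv.swap_apply_of_ne_of_ne ha.2.1 ha.1]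
    change ∑ a : Fin n, (n - (a : ℕ)) * (ix (t.1.trans (Equiv.swap i j)) a : ℕ) < M
    rw [← hM, key, key, hrest, ix_swap, ix_swap, Equiv.swap_apply_left, Equiv.swap_apply_right]
    have hj := j.2
    obtain ⟨d, hd⟩ : ∃ d, n - (j : ℕ) = d ∧ n - (i : ℕ) = d + 1 := ⟨_, rfl, by omega⟩
    rw [hd.1, hd.2]
    rw [Fin.lt_def] at hlt
    nlinarith
  · push Not at hmono
    have hsm : StrictMono (ix t.1) := by
      cases n with
      | zero => exact fun a => a.elim0
      | succ n =>
        refine Fin.strictMono_iff_lt_succ.2 fun a => ?_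
        refine lt_of_le_of_ne (hmono _ _ (by simp)) ?_
        exact ix_ne t.1 (Fin.castSucc_lt_succ (i := a)).ne
    have hid : ix t.1 = id := by
      have h1 : Function.Surjective (ix t.1) := Finite.surjective_of_injective hsm.injective
      have h2 := Subsingleton.elim (hsm.orderIsoOfSurjective _ h1) (OrderIso.refl (Fin n))
      funext a
      exact congrArg (fun f : Fin n ≃o Fin n => f a) h2
    have ht : t = initial lam := by
      refine Subtype.ext (Equiv.ext fun x => ?_)
      have h1 := congrFun hid (t.1 x)
      rw [ix, Equiv.symm_apply_apply] at h1
      exact h1.symm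
    rw [ht]
    exact init

end Connected

/-! ### Minimal vectors of a stable subspace -/

section Minimal

variable {K V ι : Type*} [Field K] [AddCommGroup V] [Module K V]

/-- A nonzero vector with as few coordinates as possible in a stable subspace `S`: an operator that
preserves `S` and acts diagonally on the basis vectors that occur acts by a scalar. -/
lemma exists_minimal_vector (B : Module.Basis ι K V) {S : Submodule K V} (hS : S ≠ ⊥) :
    ∃ x ∈ S, x ≠ 0 ∧ ∀ (Z : Module.End K V) (z : ι → K), (∀ y ∈ S, Z y ∈ S) →
      (∀ i ∈ (B.repr x).support, Z (B i) = z i • B i) →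
        ∀ i ∈ (B.repr x).support, ∀ j ∈ (B.repr x).support, z i = z j := by
  classical
  obtain ⟨x₀, hx₀, h0⟩ := S.ne_bot_iff.1 hS
  have hex : ∃ d, ∃ x ∈ S, x ≠ 0 ∧ (B.repr x).support.card = d := ⟨_, x₀, hx₀, h0, rfl⟩
  obtain ⟨x, hx, hx0, hd⟩ := Nat.find_spec hex
  refine ⟨x, hx, hx0, fun Z z hZ hz i hi j hj => ?_⟩
  by_contra hij
  have hrepr : B.repr (Z x - z j • x) = Finsupp.onFinset (B.repr x).support
      (fun l => (z l - z j) * B.repr x l) (fun l h => by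
        rw [Finsupp.mem_support_iff]; exact right_ne_zero_of_mul h) := by
    have h1 : Z x = ∑ l ∈ (B.repr x).support, (B.repr x l * z l) • B l := by
      conv_lhs => rw [← B.linearCombination_repr x, Finsupp.linearCombination_apply, Finsupp.sum,
        map_sum]
      refine Finset.sum_congr rfl fun l hl => ?_
      rw [map_smul, hz l hl, smul_smul]
    have h2 : x = ∑ l ∈ (B.repr x).support, B.repr x l • B l := by
      conv_lhs => rw [← B.linearCombination_repr x, Finsupp.linearCombination_apply, Finsupp.sum]
    have h3 : Z x - z j • x = ∑ l ∈ (B.repr x).support, ((z l - z j) * B.repr x l) • B l := by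
      rw [h1]
      conv_lhs => rw [h2]
      rw [Finset.smul_sum]
      have h4 : (B.repr (∑ l ∈ (B.repr x).support, B.repr x l • B l)).support =
        (B.repr x).support := by rw [← h2]
      rw [h4, ← Finset.sum_sub_distrib]
      refine Finset.sum_congr rfl fun l _ => ?_
      rw [← h2]
      module
    rw [h3]
    ext l
    rw [map_sum, Finsupp.finsetSum_apply]
    simp only [map_smul, B.repr_self, Finsupp.smul_apply, Finsupp.single_apply, smul_eq_mul,
      mul_ite, mul_one, mul_zero, Finset.sum_ite_eq', Finsupp.onFinset_apply]
    split_ifs with h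
    · rfl
    · rw [Finsupp.notMem_support_iff.1 h, mul_zero]
  have hlt : (B.repr (Z x - z j • x)).support.card < Nat.find hex := by
    rw [← hd]
    refine Finset.card_lt_card ⟨?_, fun h => ?_⟩
    · rw [hrepr]
      exact Finsupp.support_onFinset_subset
    · have := h hj
      rw [Finsupp.mem_support_iff, hrepr, Finsupp.onFinset_apply, sub_self, zero_mul] at this
      exact this rfl
  refine Nat.find_min hex hlt ⟨_, sub_mem (hZ x hx) (S.smul_mem _ hx), fun h => ?_, rfl⟩
  have := congrArg (fun y => B.repr y i) h
  simp only [hrepr, Finsupp.onFinset_apply, map_zero, Finsupp.zero_apply] at this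
  exact (mul_ne_zero (sub_ne_zero.2 hij) (Finsupp.mem_support_iff.1 hi)) this

end Minimal

end HeckeClifford

namespace HeckeClifford

/-! ### Simplicity -/

section Simplicity

variable {K : Type*} [Field K] {k : Kind} {m N : ℕ} {P : Params K m} {lam : Shape k m (N + 1)}

variable (P lam) in
/-- The parity operator of `𝔻(λ)`. -/
def parityD : Module.End K (P.D lam) where
  toFun x := ⟨parity (x : Ambient K lam), parity_mem_D x.2⟩
  map_add' x y := Subtype.ext (by ext t θ; exact mul_add _ _ _)
  map_smul' r x := Subtype.ext (by ext t θ; exact mul_left_comm _ _ _)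

lemma coe_parityD (x : P.D lam) : (parityD P lam x : Ambient K lam) = parity x.1 := rfl

lemma deg_comp {n : ℕ} (β : Fin n → ZMod 2) (τ : Equiv.Perm (Fin n)) : deg (β ∘ τ) = deg β :=
  Equiv.sum_comp τ β

section Rho

variable {ρ : Cyc P k N →ₐ[K] Module.End K (P.D lam)}
  (hρ : ∀ g x, (ρ (gen P k g) x : Ambient K lam) = genOp P lam g (x : Ambient K lam))

include hρ

lemma parityD_vec (t : Std lam) (β α : Fin (N + 1) → ZMod 2) :
    parityD P lam (P.vec ρ t β α) = sgn K (deg β + deg α) • P.vec ρ t β α := by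
  obtain ⟨s, -, hs⟩ := exists_coe_vec hρ t β α
  ext u θ
  rw [coe_parityD, parity, Submodule.coe_smul, Pi.smul_apply, Pi.smul_apply, smul_eq_mul]
  by_cases h : u = t
  · subst h
    have h1 := sgn_mul_vac (P := P) (lam := lam) (θ + (β + α) ∘ dperm u)
    rw [deg_add, deg_comp, deg_add, sgn_add] at h1
    rw [hs]
    linear_combination -(s θ * sgn K (deg θ)) * h1 + (s θ * sgn K (deg β + deg α) *
      vac P lam (θ + (β + α) ∘ dperm u)) * sgn_mul_self K (deg θ)
  · rw [coe_vec_of_ne hρ h, Pi.zero_apply, mul_zero, mul_zero]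

variable (hsqrt : ∀ a : K, P.sqrt a * P.sqrt a = a) (h20 : (2 : K) ≠ 0)

include hsqrt h20

/-- The action of `X_i + X_i⁻¹`. -/
lemma X_add_Xinv_vec (t : Std lam) (β α : Fin (N + 1) → ZMod 2) (i : Fin (N + 1)) :
    ρ (gen P k (.X i) + gen P k (.Xinv i)) (P.vec ρ t β α) =
      uF P lam (ix t.1 i) • P.vec ρ t β α := by
  ext u θ
  rw [map_add, LinearMap.add_apply, Submodule.coe_add, Pi.add_apply, hρ, hρ, genOp, genOp,
    lX_apply, lXinv_apply, Submodule.coe_smul, Pi.smul_apply]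
  by_cases h : u = t
  · subst h
    rw [Pi.smul_apply, smul_eq_mul, ← (isEig hsqrt h20 lam).add_inv _ θ]
    exact (add_mul _ _ _).symm
  · rw [coe_vec_of_ne hρ h, mul_zero, mul_zero, smul_zero, add_zero]

omit h20 in
/-- For a pair `j⁻`, `j` of diagonal entries, `C_{j⁻} C_j` is diagonal on the basis. -/
lemma C_C_vec_pair {t : Std lam} {j : Fin (N + 1)} (hj : j ∈ diagSet t) (hpos : ¬ Odd (pos t j))
    (p : BasisIdx t) :
    ρ (gen P k (.C (prev t j)) * gen P k (.C j)) (P.vec ρ t p.1.1 p.2.1) =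
      (-P.sqrt (-1) * sgn K (p.2.1 (prev t j))) • P.vec ρ t p.1.1 p.2.1 := by
  have h1 := prev_mem_oddDiagSet hj hpos
  have h2 := degLE_eq_degLT_add p.2.1 (prev t j)
  have h3 (x : ZMod 2) : x + x = 0 := CharTwo.add_self_eq_zero x
  rw [map_mul, Module.End.mul_apply, C_vec_of_even hρ (hsqrt _) hj hpos (p.1.apply_diag hj)
    (p.2.apply_notMem fun h => hpos ((mem_oddDiagSet t).1 h).2), map_smul,
    C_vec_of_eq_zero t (p.1.apply_diag ((mem_oddDiagSet t).1 h1).1), smul_smul, add_e_add_e,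
    mul_assoc, ← sgn_add, degLT_add, degLT_e, if_neg (lt_irrefl _), h2]
  congr 3
  linear_combination h3 (deg p.1.1) + h3 (degLT p.2.1 (prev t j))

end Rho

section Partner

variable {t : Std lam}

/-- A diagonal entry at an odd position, other than the last one, is the first member of a pair. -/
lemma exists_prev_eq {i : Fin (N + 1)} (hi : i ∈ oddDiagSet t)
    (hne : pos t i ≠ (diagList lam).length) :
    ∃ j ∈ diagSet t, ¬ Odd (pos t j) ∧ prev t j = i := by
  obtain ⟨h1, p, hp⟩ := (mem_oddDiagSet t).1 hi
  have h2 : (diagList lam).idxOf (ix t.1 i) = 2 * p := Nat.succ_injective hp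
  have h3 : ix t.1 i ∈ diagList lam := mem_diagList.2 ((mem_diagSet t).1 h1)
  have h4 := List.idxOf_lt_length_of_mem h3
  have h5 : 2 * p + 1 < (diagList lam).length := by omega
  have h6 := isPair_getElem (diagList lam) p h5
  refine ⟨dperm t (diagList lam)[2 * p + 1], ?_, h6.not_odd_pos t, ?_⟩
  · rw [mem_diagSet, ix_dperm]
    exact mem_diagList.1 h6.mem_right
  · have h7 : pos t (dperm t (diagList lam)[2 * p + 1]) = 2 * p + 2 := by
      rw [pos, Equiv.symm_apply_apply, nodup_diagList.idxOf_getElem]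
    have h8 : (diagList lam)[2 * p]'(by omega) = ix t.1 i := by
      rw [← List.getElem_idxOf h4]
      congr 1
      exact h2.symm
    rw [prev, h7, Nat.add_sub_cancel, List.getD_eq_getElem _ _ (by omega), h8]
    exact (dperm t).apply_symm_apply i

lemma eq_of_pos_eq {i i' : Fin (N + 1)} (hi : i ∈ diagSet t) (h : pos t i = pos t i') : i = i' := by
  have h3 : ix t.1 i ∈ diagList lam := mem_diagList.2 ((mem_diagSet t).1 hi)
  exact ix_injective t.1 ((List.idxOf_inj h3).1 (Nat.succ_injective h))

end Partner

section StableSubspaces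

variable {ρ : Cyc P k N →ₐ[K] Module.End K (P.D lam)}
  (hρ : ∀ g x, (ρ (gen P k g) x : Ambient K lam) = genOp P lam g (x : Ambient K lam))
  (hsqrt : ∀ a : K, P.sqrt a * P.sqrt a = a) (h20 : (2 : K) ≠ 0)
  (hsep : ∀ mu : Shape k m (N + 1 + 1), P.IsSeparate mu) (hq : P.q ≠ 0)
  (hq2 : P.q ^ 2 ≠ -1) (hQ : ∀ i, P.Q i ≠ 0)

lemma notMem_diagSet_iff {t : Std lam} {i : Fin (N + 1)} :
    i ∉ diagSet t ↔ ¬ (bx t.1 i).IsDiag := by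
  rw [mem_diagSet, diag, Finset.mem_filter, ix, Equiv.symm_apply_apply]
  simp [bx]

include hsqrt h20 hsep hq hq2 hQ in
/-- Off the diagonal, the two eigenvalues of `X_i` differ. -/
lemma b_ne_inv {t : Std lam} {i : Fin (N + 1)} (hi : i ∉ diagSet t) :
    P.b t i ≠ (P.b t i)⁻¹ := by
  intro h
  have h1 := b_add_inv (P := P) hsqrt h20 t i
  have h2 := b_ne_zero (P := P) hsqrt h20 t i
  rw [← h, uF_ix] at h1
  have h3 : P.b t i * P.b t i = 1 := by
    nth_rewrite 2 [h]
    exact mul_inv_cancel₀ h2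
  refine qf_sq_ne_four (hq := hq) (hq2 := hq2) (h20 := h20) hsep hQ lam.isDiagram (bx_mem t.1 i)
    (notMem_diagSet_iff.1 hi) (by rw [lam.card_cells]) ?_
  rw [← h1]
  linear_combination 4 * h3

include hρ hsqrt h20 hsep hq hq2 hQ in
/-- A nonzero graded stable subspace contains a basis vector, as the basis vectors are separated by
the operators `X_i`, `C_{j⁻} C_j` and the parity. -/
lemma exists_vec_mem {S : Submodule K (P.D lam)} (hS : S ≠ ⊥) (hst : ∀ a, ∀ x ∈ S, ρ a x ∈ S)
    (hpar : ∀ x ∈ S, parityD P lam x ∈ S) :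
    ∃ (t : Std lam) (p : BasisIdx t), P.vec ρ t p.1.1 p.2.1 ∈ S := by
  have hI := hsqrt (-1)
  have hI0 : -P.sqrt (-1) ≠ 0 := fun h => by
    rw [neg_eq_zero] at h
    rw [h, mul_zero, zero_eq_neg] at hI
    exact one_ne_zero hI
  have hsgn (x y : ZMod 2) (h : sgn K x = sgn K y) : x = y := by
    have h1 : (1 : K) ≠ -1 := fun h => h20 (by linear_combination h)
    rcases zmod_two_cases x with rfl | rfl <;> rcases zmod_two_cases y with rfl | rfl
    · rfl
    · exact absurd (by simpa using h) h1
    · exact absurd (by simpa using h.symm) h1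
    · rfl
  obtain ⟨x, hx, hx0, hmin⟩ := exists_minimal_vector (basisD lam hρ hI h20) hS
  have ht : ∀ p ∈ ((basisD lam hρ hI h20).repr x).support,
      ∀ p' ∈ ((basisD lam hρ hI h20).repr x).support, p.1 = p'.1 := by
    intro p hp p' hp'
    refine Subtype.ext (eq_of_qf_eq hsep p.1.2 p'.1.2 fun i => ?_)
    rw [← uF_ix, ← uF_ix]
    refine hmin (ρ (gen P k (.X i) + gen P k (.Xinv i))) (fun p => uF P lam (ix p.1.1 i))
      (hst _) ?_ p hp p' hp'
    rintro ⟨u, p⟩ -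
    rw [basisD_apply]
    exact X_add_Xinv_vec hρ hsqrt h20 u _ _ i
  obtain ⟨⟨t, p⟩, hp⟩ : ((basisD lam hρ hI h20).repr x).support.Nonempty := by
    rw [Finsupp.support_nonempty_iff]
    simpa using hx0
  have hsingle : ((basisD lam hρ hI h20).repr x).support ⊆ {⟨t, p⟩} := by
    rintro ⟨u, p'⟩ hp'
    obtain rfl : t = u := ht _ hp _ hp'
    have hβ : p'.1 = p.1 := by
      refine Subtype.ext (funext fun i => ?_)
      by_cases hi : i ∈ diagSet t
      · rw [p.1.apply_diag hi, p'.1.apply_diag hi]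
      · have h1 := hmin (ρ (gen P k (.X i))) (fun p => P.b p.1 i ^ (-nu p.2.1.1 i)) (hst _) (by
          rintro ⟨u, p⟩ -
          rw [basisD_apply]
          exact X_vec hsqrt h20 hq hq2 hρ u i fun j hj => p.2.apply_not_diag hj) _ hp _ hp'
        have h2 := b_ne_inv hsqrt h20 hsep hq hq2 hQ hi
        rcases zmod_two_cases (p.1.1 i) with h | h <;>
          rcases zmod_two_cases (p'.1.1 i) with h' | h' <;>
          simp only [nu, h, h'] at h1 ⊢ <;> simp at h1 <;> exact absurd h1 (by tauto)
    have hα : p'.2 = p.2 := by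
      have hpair {i : Fin (N + 1)} (hi : p.2.1 i ≠ p'.2.1 i) :
          pos t i = (diagList lam).length := by
        by_contra hne
        have hio : i ∈ oddDiagSet t := by
          by_contra hio
          exact hi (by rw [p.2.apply_notMem hio, p'.2.apply_notMem hio])
        obtain ⟨j, hj, hpos, rfl⟩ := exists_prev_eq hio hne
        have h1 := hmin (ρ (gen P k (.C (prev t j)) * gen P k (.C j)))
          (fun p => -P.sqrt (-1) * sgn K (p.2.2.1 (prev t j))) (hst _) (by
            rintro ⟨u, p''⟩ hp''
            obtain rfl : t = u := ht _ hp _ hp''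
            rw [basisD_apply]
            exact C_C_vec_pair hρ hsqrt hj hpos p'') _ hp _ hp'
        exact hi (hsgn _ _ (mul_left_cancel₀ hI0 h1))
      by_contra hne
      obtain ⟨i, hi⟩ : ∃ i, p.2.1 i ≠ p'.2.1 i := by
        by_contra! h
        exact hne (Subtype.ext (funext fun i => (h i).symm))
      have hid : i ∈ diagSet t := by
        by_contra hio
        exact hi (by rw [p.2.apply_not_diag hio, p'.2.apply_not_diag hio])
      have hadd : p'.2.1 = p.2.1 + e i := by
        funext j
        by_cases hj : j = i
        · subst hj
          rw [add_e_self]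
          revert hi
          generalize p.2.1 j = x
          generalize p'.2.1 j = y
          revert x y
          decide
        · rw [add_e_of_ne _ hj]
          by_contra h
          exact hj (eq_of_pos_eq hid ((hpair hi).trans (hpair (Ne.symm h)).symm)).symm
      have h1 := hsgn _ _ (hmin (parityD P lam) (fun p => sgn K (deg p.2.1.1 + deg p.2.2.1)) hpar (by
        rintro ⟨u, p⟩ -
        rw [basisD_apply]
        exact parityD_vec hρ u _ _) _ hp _ hp')
      rw [hβ, hadd, deg_add, deg_e] at h1
      have h2 : deg p.2.1 ≠ deg p.2.1 + 1 := by
        generalize deg p.2.1 = x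
        revert x
        decide
      exact h2 (add_left_cancel h1)
    rw [Finset.mem_singleton, Prod.ext hβ hα]
  refine ⟨t, p, ?_⟩
  have h1 : x = (basisD lam hρ hI h20).repr x ⟨t, p⟩ • P.vec ρ t p.1.1 p.2.1 := by
    conv_lhs => rw [← (basisD lam hρ hI h20).linearCombination_repr x,
      Finsupp.linearCombination_apply, Finsupp.sum_of_support_subset _ hsingle _ (by simp),
      Finset.sum_singleton, basisD_apply]
  rw [h1] at hx
  exact (Submodule.smul_mem_iff _ (Finsupp.mem_support_iff.1 hp)).1 hx

include hρ hsqrt h20 hsep hq hq2 hQ in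
/-- Of the three terms of `T_i v_t`, the first two lie in `S` and the third is a nonzero multiple of
`v_{s_i t}`. -/
lemma v_mem_of_swap {S : Submodule K (P.D lam)} (hst : ∀ a, ∀ x ∈ S, ρ a x ∈ S) {t : Std lam}
    (i : Fin N) (h : IsStandard lam (swapped t i.castSucc i.succ)) (ht : P.v t ∈ S) :
    P.v (⟨swapped t i.castSucc i.succ, h⟩ : Std lam) ∈ S := by
  classical
  have hij : ((i.succ : Fin (N + 1)) : ℕ) = (i.castSucc : Fin (N + 1)) + 1 := by simp
  have hT := T_vec hsqrt h20 hsep hq hq2 hρ t i (β := 0) (α := 0) (fun _ _ => rfl)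
  rw [dif_pos h, Pi.zero_comp, vec_zero_zero] at hT
  have h1 := hst (gen P k (.T i)) _ ht
  rw [hT] at h1
  have h2 := (Submodule.add_mem_iff_right S (add_mem (S.smul_mem _ ht)
    (S.smul_mem _ (hst _ _ (hst _ _ ht))))).1 h1
  suffices h0 : sgn K ((0 : Fin (N + 1) → ZMod 2) i.castSucc * (0 : Fin (N + 1) → ZMod 2) i.succ +
      (0 : Fin (N + 1) → ZMod 2) i.castSucc * (0 : Fin (N + 1) → ZMod 2) i.succ) *
        P.sqrt (P.c t i.castSucc i.succ) ≠ 0 from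
    vec_zero_zero (ρ := ρ) (⟨swapped t i.castSucc i.succ, h⟩ : Std lam) ▸
      (Submodule.smul_mem_iff S h0).1 h2
  refine mul_ne_zero (sgn_ne_zero K _) fun h0 => ?_
  have h3 := hsqrt (P.c t i.castSucc i.succ)
  rw [h0, mul_zero, c_eq hsqrt h20 hsep t hij, uF_ix, uF_ix] at h3
  exact cf_ne_zero hsep hq hq2 hQ t.2 hij ((isStandard_swap_iff t.2 hij).1 h) h3.symm

include hρ hsqrt h20 hsep hq hq2 hQ in
lemma isSimpleSuper : P.IsSimpleSuper lam ρ := by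
  have hI := hsqrt (-1)
  refine ⟨⟨⟨P.v (initial lam), 0, fun h0 => ?_⟩⟩, fun S hst hpar => ?_⟩
  · have h1 := (coe_vec_apply_eq_zero_iff hρ h20 (t := initial lam)
      (⟨0, fun i h => (h rfl).elim⟩, ⟨0, fun i h => (h rfl).elim⟩)
      (⟨0, fun i h => (h rfl).elim⟩, ⟨0, fun i h => (h rfl).elim⟩)).1
    refine h1 ?_ rfl
    change (P.vec ρ (initial lam) 0 0 : Ambient K lam) _ _ = 0
    rw [vec_zero_zero, h0]
    rfl
  · refine or_iff_not_imp_left.2 fun hS => ?_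
    obtain ⟨t₀, p, hp⟩ := exists_vec_mem hρ hsqrt h20 hsep hq hq2 hQ hS hst fun x hx =>
      hpar x hx _ rfl
    have h0 : P.v t₀ ∈ S := by
      have hc := isClifford_gen P k N
      obtain ⟨w, hw⟩ := (hc.isUnit_cword p.1.1).mul (hc.isUnit_cword p.2.1)
      have h1 := hst (w⁻¹ : (Cyc P k N)ˣ) _ hp
      rw [Params.vec, show Cpow P k p.1.1 * Cpow P k p.2.1 = w from hw.symm,
        ← Module.End.mul_apply, ← map_mul, Units.inv_mul, map_one] at h1
      exact h1
    have hiff (t : Std lam) : P.v t ∈ S ↔ P.v (initial lam) ∈ S := by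
      induction t using std_induction with
      | init => rfl
      | swap t i j hij h ih =>
        obtain ⟨l, rfl⟩ : ∃ l : Fin N, i = l.castSucc := ⟨⟨i, by omega⟩, rfl⟩
        obtain rfl : j = l.succ := Fin.ext (by simpa using hij)
        rw [← ih]
        refine ⟨v_mem_of_swap hρ hsqrt h20 hsep hq hq2 hQ hst l h, fun h' => ?_⟩
        have hss : swapped (⟨swapped t l.castSucc l.succ, h⟩ : Std lam) l.castSucc l.succ = t.1 := by
          ext a
          simp [swapped]
        have h1 := v_mem_of_swap hρ hsqrt h20 hsep hq hq2 hQ hst l (hss ▸ t.2) h'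
        have h2 : (⟨_, hss ▸ t.2⟩ : Std lam) = t := Subtype.ext hss
        rwa [h2] at h1
    rw [eq_top_iff]
    refine (top_le_span_vec hρ hI).trans (Submodule.span_le.2 ?_)
    rintro _ ⟨⟨t, p⟩, rfl⟩
    exact hst _ _ ((hiff t).2 ((hiff t₀).1 h0))

end StableSubspaces

end Simplicity

end HeckeClifford

namespace HeckeClifford

/-! ### The parity of the generators -/

section Parity

variable {K : Type*} [Field K] {k : Kind} {m n : ℕ} {P : Params K m} {lam : Shape k m n}

lemma lX_parity (a : Fin n) (f : Ambient K lam) :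
    lX P lam a (parity f) = parity (lX P lam a f) := by
  ext t θ
  exact mul_left_comm _ _ _

lemma cl_sgn_mul (a : Fin n) (f : Tens K n) :
    cl a ((fun θ => sgn K (deg θ)) * f) = -((fun θ => sgn K (deg θ)) * cl a f) := by
  ext θ
  rw [Pi.neg_apply, Pi.mul_apply, cl_apply, cl_apply, Pi.mul_apply, deg_add, deg_e, sgn_add,
    sgn_one]
  ring

lemma lC_parity (a : Fin n) (f : Ambient K lam) :
    lC K lam a (parity f) = -parity (lC K lam a f) := by
  ext t : 1
  exact cl_sgn_mul _ _

lemma ext0_parity (f : Ambient K lam) (t : lam.cells ≃ Fin n) :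
    ext0 (parity f) t = (fun θ => sgn K (deg θ)) * ext0 f t := by
  by_cases h : IsStandard lam t
  · simp only [ext0_of _ h]; rfl
  · simp [ext0_of_not _ h]

lemma lT_parity (i j : Fin n) (f : Ambient K lam) :
    lT P lam i j (parity f) = parity (lT P lam i j f) := by
  ext t : 1
  have h (g : Ambient K lam) : parity g t = (fun θ => sgn K (deg θ)) * g t := rfl
  rw [h, lT_apply, lT_apply, ext0_parity, h, Xi_apply, Xi_apply, cl_sgn_mul, map_neg, cl_sgn_mul,
    neg_neg, mul_add, mul_add, mul_smul_comm, mul_left_comm,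
    mul_left_comm (fun β => rf _ _ _)]

end Parity

end HeckeClifford

/-! ### The simple supermodule `𝔻(λ)` -/

open HeckeClifford in
open Classical in
theorem theorem1p1 {K : Type*} [Field K] [IsAlgClosed K] (hchar : ringChar K ≠ 2)
    (k : Kind) (m N : ℕ) (P : Params K m)
    (hsqrt : ∀ a : K, P.sqrt a * P.sqrt a = a)
    (hq0 : P.q ≠ 0) (hq1 : P.q ^ 2 ≠ 1) (hq2 : P.q ^ 2 ≠ -1) (hQ : ∀ i, P.Q i ≠ 0)
    (hsep : ∀ mu : Shape k m (N + 1 + 1), P.IsSeparate mu)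
    (lam : Shape k m (N + 1)) :
    ∃ ρ : Cyc P k N →ₐ[K] Module.End K (P.D lam),
      -- the module structure of `𝔻(λ)`
      (∀ (a : Fin (N + 1)) (x : P.D lam),
        (ρ (gen P k (.X a)) x : Ambient K lam) = P.opX a (x : Ambient K lam)) ∧
      (∀ (a : Fin (N + 1)) (x : P.D lam),
        (ρ (gen P k (.C a)) x : Ambient K lam) = opC a (x : Ambient K lam)) ∧
      (∀ (i : Fin N) (x : P.D lam),
        (ρ (gen P k (.T i)) x : Ambient K lam)
          = P.opT i.castSucc i.succ (x : Ambient K lam)) ∧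
      -- it is a supermodule (`X_a` and `T_i` are even, `C_a` is odd) and simple
      (∀ x : P.D lam, parity (x : Ambient K lam) ∈ P.D lam) ∧
      (∀ x y : P.D lam, (y : Ambient K lam) = parity (x : Ambient K lam) →
        (∀ a, (ρ (gen P k (.X a)) y : Ambient K lam)
          = parity (ρ (gen P k (.X a)) x : Ambient K lam)) ∧
        (∀ i, (ρ (gen P k (.T i)) y : Ambient K lam)
          = parity (ρ (gen P k (.T i)) x : Ambient K lam)) ∧
        (∀ a, (ρ (gen P k (.C a)) y : Ambient K lam)
          = -parity (ρ (gen P k (.C a)) x : Ambient K lam))) ∧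
      P.IsSimpleSuper lam ρ ∧
      -- the basis
      (∃ B : Module.Basis
          (Σ t : Std lam, Z2 ((diagSet t : Set (Fin (N + 1)))ᶜ) × Z2 (oddDiagSet t : Set (Fin (N + 1))))
          K (P.D lam),
        (∀ t β α, B ⟨t, β, α⟩ = P.vec ρ t β.1 α.1) ∧
        (∀ t, (Submodule.span K (Set.range fun p : Z2 ((diagSet t : Set (Fin (N + 1)))ᶜ) ×
              Z2 (oddDiagSet t : Set (Fin (N + 1))) => P.vec ρ t p.1.1 p.2.1) : Set (P.D lam))
            = {x : P.D lam | ∀ u, u ≠ t → (x : Ambient K lam) u = 0})) ∧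
      -- the actions of the generators on the basis
      ∀ (t : Std lam) (β : Z2 ((diagSet t : Set (Fin (N + 1)))ᶜ))
        (α : Z2 (oddDiagSet t : Set (Fin (N + 1)))),
        (∀ i, ρ (gen P k (.X i)) (P.vec ρ t β.1 α.1)
          = (P.b t i ^ (-nu β.1 i)) • P.vec ρ t β.1 α.1) ∧
        ρ (gammaElt P t) (P.v t) = P.v t ∧
        (∀ i, ρ (gen P k (.C i)) (P.vec ρ t β.1 α.1)
          = if i ∈ diagSet t then
              if Odd (pos t i) then
                sgn K (deg β.1 + degLT α.1 i) • P.vec ρ t β.1 (α.1 + e i)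
              else
                (-P.sqrt (-1) * sgn K (deg β.1 + degLE α.1 (prev t i))) •
                  P.vec ρ t β.1 (α.1 + e (prev t i))
            else sgn K (degLT β.1 i) • P.vec ρ t (β.1 + e i) α.1) ∧
        (∀ i : Fin N, ρ (gen P k (.T i)) (P.vec ρ t β.1 α.1)
          = -(P.eps / (P.b t i.castSucc ^ (-nu β.1 i.castSucc)
                * P.b t i.succ ^ (nu β.1 i.succ) - 1)) • P.vec ρ t β.1 α.1
            + (P.eps / (P.b t i.castSucc ^ (nu β.1 i.castSucc)
                * P.b t i.succ ^ (nu β.1 i.succ) - 1)) •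
                P.R t (P.vec ρ t) i.castSucc i.succ β.1 α.1
            + if h : IsStandard lam (swapped t i.castSucc i.succ) then
                (sgn K (β.1 i.castSucc * β.1 i.succ + α.1 i.castSucc * α.1 i.succ)
                    * P.sqrt (P.c t i.castSucc i.succ)) •
                  P.vec ρ ⟨swapped t i.castSucc i.succ, h⟩
                    (β.1 ∘ Equiv.swap i.castSucc i.succ)
                    (α.1 ∘ Equiv.swap i.castSucc i.succ)
              else 0) := by
  have h20 : (2 : K) ≠ 0 := Ring.two_ne_zero hchar
  have hI := hsqrt (-1)
  have hρ := rep_gen (lam := lam) hsep hq0 hq2 hQ hsqrt h20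
  generalize rep (lam := lam) hsep hq0 hq2 hQ hsqrt h20 = ρ at hρ
  have hX (a : Fin (N + 1)) (x : P.D lam) :
      (ρ (gen P k (.X a)) x : Ambient K lam) = P.opX a (x : Ambient K lam) := hρ _ _
  have hC (a : Fin (N + 1)) (x : P.D lam) :
      (ρ (gen P k (.C a)) x : Ambient K lam) = opC a (x : Ambient K lam) := hρ _ _
  refine ⟨ρ, hX, hC, fun i x => ?_, fun x => parity_mem_D x.2, fun x y hxy => ⟨fun a => ?_,
    fun i => ?_, fun a => ?_⟩, isSimpleSuper hρ hsqrt h20 hsep hq0 hq2 hQ,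
    ⟨basisD lam hρ hI h20, fun t β α => basisD_apply hρ hI h20 t (β, α), span_vec hρ hI⟩,
    fun t β α => ⟨fun i => X_vec hsqrt h20 hq0 hq2 hρ t i fun _ hj => α.apply_not_diag hj,
      gamma_v hρ hI h20 t, fun i => C_vec_basis hρ hI t (β, α) i, fun i => ?_⟩⟩
  · exact (hρ _ _).trans (lT_eq hsep hsqrt h20 (by simp) _)
  · rw [hρ, hρ, hxy]
    exact lX_parity _ _
  · rw [hρ, hρ, hxy]
    exact lT_parity _ _ _
  · rw [hρ, hρ, hxy]
    exact lC_parity _ _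
  · rw [T_vec hsqrt h20 hsep hq0 hq2 hρ t i fun _ hj => α.apply_not_diag hj,
      C_C_vec hρ hI (by simp) (fun _ ha => β.apply_diag ha) fun _ ha => α.apply_notMem ha]
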